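/- A deterministic tree-walking-storage automaton (TWSDA) is a one-way finite-state automaton, reading its input $w$ followed by a right endmarker $\triangleright$, whose storage is a finite binary tree. The root is labeled by $\bot$, and all other nodes are labeled by symbols of a finite set $\Gamma$ with $\bot\notin\Gamma$. A tree pointer designates the current node and is initially at the root, which is initially the only node. In each step the automaton sees its state, the next input symbol (or, in a $\lambda$-step, no input), the label of the current node, and the type of the current node (whether it is the root, a left or a right descendant, and whether it has a left, respectively a right, descendant). Depending on these, it changes its state and moves the pointer to the parent, leaves it, moves it to an existing left or right descendant, pops the current node if it is a non-root leaf (moving the pointer to the parent), or pushes a new labeled left or right descendant where none exists (moving the pointer to it). The transition function is partial, only prescribes operations that can be performed, and never allows both a $\lambda$-step and a reading step in the same situation. A word is accepted if the automaton halts in an accepting state after having read the input and the endmarker entirely. The automaton is non-erasing (a TWSDNEA) if it never pops, and it works in real time if it has no $\lambda$-transitions. Let $\mathscr{L}_{rt}(\mathrm{TWSDA})$ and $\mathscr{L}_{rt}(\mathrm{TWSDNEA})$ be the families of languages over finite alphabets accepted in real time by TWSDAs and by TWSDNEAs, respectively. Over the alphabet $\{a,b,\$,\mathsf{c},\#_1,\#_2\}$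 of six distinct symbols define $$\hat L_p=\{\,x_1\$^{|x_1|}x_2\$^{|x_2|}\cdots x_k\$^{|x_k|}\,\mathsf{c}\,z\,\#_1\,y \mid k\ge 0,\ x_i\in\{a,b\}^*\ (1\le i\le k),\ z\in\{a,b,\$\}^*,\ \text{no } x_i \text{ is a proper prefix of } x_j \text{ for } 1\le j<i,\ \text{and there exists } m \text{ such that } x_m=y\,\},$$ $$\hat L_{mi}=\{\,x\,\mathsf{c}\,v\,\$\,v^R\,\#_2 \mid x\in\{a,b,\$\}^*,\ v\in\{a,b\}^*\,\}.$$ **Proposition.** Neither $\mathscr{L}_{rt}(\mathrm{TWSDA})$ nor $\mathscr{L}_{rt}(\mathrm{TWSDNEA})$ is closed under union, and neither is closed under intersection. The union $\hat L_p\cup\hat L_{mi}$ is a witness for the non-closure of both families under union: $\hat L_p$ and $\hat L_{mi}$ belong to $\mathscr{L}_{rt}(\mathrm{TWSDNEA})$, but $\hat L_p\cup\hat L_{mi}$ does not belong to $\mathscr{L}_{rt}(\mathrm{TWSDA})$. -/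

import Mathlib

/-! ## Storage trees -/

/-- The two kinds of descendants in a binary tree: left and right. -/
inductive Side : Type
  | l
  | r

/-- A word over `{l, r}` addressing a position in a binary tree. It is stored with its last letter
first: `[]` is the root and `d :: P` is the `d`-descendant of `P`, so that the ancestor of a node
is its tail. -/
abbrev TreeNode : Type := List Side

/-- A `Γ`-tree: a partial map (`none` means undefined) from a finite, non-empty, prefix-closed set
of positions to `Γ ∪ {⊥}`, with value `⊥` exactly at the root. That the root belongs to the domain
is contained in `label_eq_bot`. -/
structure StorageTree (Γ : Type) where
  label : TreeNode → Option (WithBot Γ)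
  finite_domain : {P | label P ≠ none}.Finite
  ancestor_mem : ∀ (d : Side) (P : TreeNode), label (d :: P) ≠ none → label P ≠ none
  label_eq_bot : ∀ P : TreeNode, label P = some ⊥ ↔ P = []

namespace StorageTree

variable {Γ : Type}

/-- `P` is a node of the tree `T`. -/
def IsNode (T : StorageTree Γ) (P : TreeNode) : Prop := T.label P ≠ none

/-- The tree consisting of the root only. -/
def initial (Γ : Type) : StorageTree Γ where
  label P := match P with
    | [] => some ⊥
    | _ :: _ => none
  finite_domain := by
    refine (Set.finite_singleton ([] : TreeNode)).subset ?_
    intro P hP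
    cases P with
    | nil => rfl
    | cons d P => exact absurd rfl hP
  ancestor_mem := by
    intro d P h
    exact absurd rfl h
  label_eq_bot := by
    intro P
    cases P <;> simp

end StorageTree

/-- Node types: the first component says whether the node is the root (`none`) or a left or right
descendant; the second and third components say whether it has a left, respectively a right,
descendant. -/
structure NodeType : Type where
  kind : Option Side
  hasLeft : Bool
  hasRight : Bool

/-- Whether a node of the given type has a `d`-descendant. -/
def NodeType.has (t : NodeType) : Side → Bool
  | Side.l => t.hasLeft
  | Side.r => t.hasRight

/-- The type of the position `P` in the tree `T`. -/
def StorageTree.nodeType {Γ : Type} (T : StorageTree Γ) (P : TreeNode) : NodeType where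
  kind := P.head?
  hasLeft := (T.label (Side.l :: P)).isSome
  hasRight := (T.label (Side.r :: P)).isSome

/-! ## Deterministic tree-walking-storage automata -/

/-- The operations on the storage: move up, stay, move to the `d`-descendant, pop the current leaf,
push a new `d`-descendant labeled `x`. -/
inductive StorageOp (Γ : Type) : Type
  | up
  | stay
  | down (d : Side)
  | pop
  | push (x : Γ) (d : Side)

/-- The operation can be performed at a node of type `t`: it does not move to a non-existing node,
does not pop the root or an inner node, and does not push an existing descendant. -/
def StorageOp.Admissible {Γ : Type} : StorageOp Γ → NodeType → Prop
  | up, t => t.kind ≠ none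
  | stay, _ => True
  | down d, t => t.has d = true
  | pop, t => t.kind ≠ none ∧ t.hasLeft = false ∧ t.hasRight = false
  | push _ d, t => t.has d = false

/-- `StorageOp.Acts op T P T' P'`: performing `op` on the tree `T` with tree pointer `P` results
in the tree `T'` with tree pointer `P'`. -/
inductive StorageOp.Acts {Γ : Type} :
    StorageOp Γ → StorageTree Γ → TreeNode → StorageTree Γ → TreeNode → Prop
  | up (T : StorageTree Γ) (d : Side) (P : TreeNode) :
      Acts StorageOp.up T (d :: P) T P
  | stay (T : StorageTree Γ) (P : TreeNode) :
      Acts StorageOp.stay T P T P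
  | down (T : StorageTree Γ) (d : Side) (P : TreeNode) :
      T.IsNode (d :: P) → Acts (StorageOp.down d) T P T (d :: P)
  | pop (T T' : StorageTree Γ) (d : Side) (P : TreeNode) :
      (∀ e : Side, ¬ T.IsNode (e :: d :: P)) →
      T'.label (d :: P) = none →
      (∀ R : TreeNode, R ≠ d :: P → T'.label R = T.label R) →
      Acts StorageOp.pop T (d :: P) T' P
  | push (T T' : StorageTree Γ) (x : Γ) (d : Side) (P : TreeNode) :
      ¬ T.IsNode (d :: P) →
      T'.label (d :: P) = some (x : WithBot Γ) →
      (∀ R : TreeNode, R ≠ d :: P → T'.label R = T.label R) →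
      Acts (StorageOp.push x d) T P T' (d :: P)

/-- Symbols on the input tape: the input symbols and the right endmarker. -/
inductive TapeSymbol (σ : Type) : Type
  | sym (a : σ)
  | endmarker

/-- A deterministic tree-walking-storage automaton with states `Q`, input symbols `σ` and tree
symbols `Γ` (finiteness is required where languages are considered). The transition function is
partial, and its second argument is `none` for a step without reading input. -/
structure TWSDA (Q σ Γ : Type) where
  δ : Q → Option (TapeSymbol σ) → NodeType → WithBot Γ → Option (Q × StorageOp Γ)
  start : Q
  accepting : Set Q
  /-- There is never a choice between reading an input symbol and not reading one. -/
  no_choice : ∀ (q : Q) (t : NodeType) (x : WithBot Γ),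
    δ q none t x ≠ none → ∀ a : TapeSymbol σ, δ q (some a) t x = none
  /-- The transition function is well defined: it only prescribes operations that can be
  performed. -/
  well_defined : ∀ (q : Q) (a : Option (TapeSymbol σ)) (t : NodeType) (x : WithBot Γ)
    (q' : Q) (op : StorageOp Γ), δ q a t x = some (q', op) → op.Admissible t

/-- Configurations: state, unread part of the input, tree, tree pointer. -/
structure TWSDAConfig (Q σ Γ : Type) where
  state : Q
  unread : List (TapeSymbol σ)
  tree : StorageTree Γ
  pointer : TreeNode

namespace TWSDA

variable {Q σ Γ : Type}

/-- The initial configuration on input `w`. -/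
def initialConfig (M : TWSDA Q σ Γ) (w : List σ) : TWSDAConfig Q σ Γ where
  state := M.start
  unread := w.map TapeSymbol.sym ++ [TapeSymbol.endmarker]
  tree := StorageTree.initial Γ
  pointer := []

/-- One step of the automaton; `a.toList` is the consumed part of the input, which is empty or a
single symbol. -/
def Step (M : TWSDA Q σ Γ) (c c' : TWSDAConfig Q σ Γ) : Prop :=
  ∃ (a : Option (TapeSymbol σ)) (x : WithBot Γ) (op : StorageOp Γ),
    c.unread = a.toList ++ c'.unread ∧
    c.tree.label c.pointer = some x ∧
    M.δ c.state a (c.tree.nodeType c.pointer) x = some (c'.state, op) ∧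
    op.Acts c.tree c.pointer c'.tree c'.pointer

/-- The automaton halts in `c`: no transition is defined, neither for the next symbol of the
unread input (if there is one) nor for a step without reading input. -/
def Halts (M : TWSDA Q σ Γ) (c : TWSDAConfig Q σ Γ) : Prop :=
  ∀ (a : Option (TapeSymbol σ)) (v : List (TapeSymbol σ)) (x : WithBot Γ),
    c.unread = a.toList ++ v → c.tree.label c.pointer = some x →
    M.δ c.state a (c.tree.nodeType c.pointer) x = none

/-- The language accepted by `M`: the words `w` on which `M` halts in an accepting state after
having read `w` and the endmarker entirely. -/
def language (M : TWSDA Q σ Γ) : Language σ :=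
  {w | ∃ c : TWSDAConfig Q σ Γ, Relation.ReflTransGen M.Step (M.initialConfig w) c ∧
    M.Halts c ∧ c.unread = [] ∧ c.state ∈ M.accepting}

/-- `M` works in real time: it has no transitions that do not read input. -/
def RealTime (M : TWSDA Q σ Γ) : Prop :=
  ∀ (q : Q) (t : NodeType) (x : WithBot Γ), M.δ q none t x = none

/-- `M` is non-erasing: it never pops. -/
def NonErasing (M : TWSDA Q σ Γ) : Prop :=
  ∀ (q : Q) (a : Option (TapeSymbol σ)) (t : NodeType) (x : WithBot Γ) (q' : Q),
    M.δ q a t x ≠ some (q', StorageOp.pop)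

end TWSDA

/-! ## Language families and closure -/

/-- A family of formal languages: a set of languages over each finite alphabet. -/
abbrev LanguageFamily : Type 1 := ∀ (σ : Type) [Finite σ], Set (Language σ)

/-- The languages accepted by deterministic tree-walking-storage automata in real time. -/
def rtTWSDA : LanguageFamily := fun σ _ =>
  {L | ∃ (Q Γ : Type) (_ : Finite Q) (_ : Finite Γ) (M : TWSDA Q σ Γ),
    M.RealTime ∧ M.language = L}

/-- The languages accepted by non-erasing deterministic tree-walking-storage automata in real
time. -/
def rtTWSDNEA : LanguageFamily := fun σ _ =>
  {L | ∃ (Q Γ : Type) (_ : Finite Q) (_ : Finite Γ) (M : TWSDA Q σ Γ),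
    M.NonErasing ∧ M.RealTime ∧ M.language = L}

/-- The family is closed under union. -/
def ClosedUnderUnion (F : LanguageFamily) : Prop :=
  ∀ (σ : Type) [Finite σ] (L₁ L₂ : Language σ), L₁ ∈ F σ → L₂ ∈ F σ → L₁ ⊔ L₂ ∈ F σ

/-- The family is closed under intersection. -/
def ClosedUnderIntersection (F : LanguageFamily) : Prop :=
  ∀ (σ : Type) [Finite σ] (L₁ L₂ : Language σ), L₁ ∈ F σ → L₂ ∈ F σ → L₁ ⊓ L₂ ∈ F σ

/-! ## The witness languages -/

/-- The alphabet `{a, b, $, ¢, #₁, #₂}` of the witness languages. -/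
inductive WSym : Type
  | a
  | b
  | dollar
  | cent
  | border₁
  | border₂

instance : Finite WSym :=
  Finite.of_surjective
    (fun i : Fin 6 => match i with
      | 0 => WSym.a
      | 1 => WSym.b
      | 2 => WSym.dollar
      | 3 => WSym.cent
      | 4 => WSym.border₁
      | 5 => WSym.border₂)
    (fun s => by
      cases s
      exacts [⟨0, rfl⟩, ⟨1, rfl⟩, ⟨2, rfl⟩, ⟨3, rfl⟩, ⟨4, rfl⟩, ⟨5, rfl⟩])

/-- The words over `{a, b}`. -/
def wordsAB : Set (List WSym) := {w | ∀ s ∈ w, s = WSym.a ∨ s = WSym.b}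

/-- The words over `{a, b, $}`. -/
def wordsABDollar : Set (List WSym) :=
  {w | ∀ s ∈ w, s = WSym.a ∨ s = WSym.b ∨ s = WSym.dollar}

/-- The words `x₁ $^|x₁| x₂ $^|x₂| ⋯ xₖ $^|xₖ| ¢ z #₁ y` with `xᵢ ∈ {a, b}*`, `z ∈ {a, b, $}*`, such
that no `xᵢ` is a proper prefix of an `xⱼ` with `j < i`, and `y` is one of the `xₘ`. -/
def hatLp : Language WSym :=
  {w | ∃ (xs : List (List WSym)) (z y : List WSym),
    (∀ x ∈ xs, x ∈ wordsAB) ∧ z ∈ wordsABDollar ∧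
    xs.Pairwise (fun xj xi => ¬ (xi <+: xj ∧ xi ≠ xj)) ∧
    y ∈ xs ∧
    w = xs.flatMap (fun x => x ++ List.replicate x.length WSym.dollar) ++
      [WSym.cent] ++ z ++ [WSym.border₁] ++ y}

/-- The words `x ¢ v $ vᴿ #₂` with `x ∈ {a, b, $}*` and `v ∈ {a, b}*`. -/
def hatLmi : Language WSym :=
  {w | ∃ x v : List WSym, x ∈ wordsABDollar ∧ v ∈ wordsAB ∧
    w = x ++ [WSym.cent] ++ v ++ [WSym.dollar] ++ v.reverse ++ [WSym.border₂]}

/-! ## Deterministic semantics of real-time automata -/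

/-! A real-time automaton is deterministic and, with a sink state added, total. Hence both families
are closed under complementation (`TWSDA.complement_language`), and by De Morgan closure under
intersection would imply closure under union. Everything reduces to the witness.

Both languages have non-erasing automata. `mirrorAutomaton` keeps `v` as the address of its pointer
and compares while climbing back. `prefixAutomaton` stores the words `xᵢ` in a trie; the dollars
give it the time to return to the root. The prefix condition makes marking ends of words possible
without relabeling: a word ends either at a new node or at an old leaf, and old leaves are already
marked.

The lower bound (`Snapshot.not_recognizes_sup`) takes `2 ^ e` words of length `e + d`, each an index
of length `e` followed by `d` free letters. Right after these blocks a query `¢ #₁ y` must be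
answered within about `e + d` steps, so the part of the tree within this distance of the pointer
determines all free letters (`Snapshot.eq_of_similar`). Now let `¢ v $` follow. For some `v` the
pointer must leave the vicinity of its position, since otherwise two different `v` would lead to the
same snapshot (`Snapshot.exists_not_near`). A prefix of `v $` can also serve as `z` in a query, so
the vicinity of a second, distant position determines all free letters as well.

On the path between the two positions some edge is crossed rarely (`Snapshot.exists_cut`). Given
what crosses this edge and the labels around it, the letters read below determine one vicinity and
those read above determine the other. Each of the two sets of letters therefore determines all of
them, although every letter is read on one side only. So at most the square root of all inputs share
the same data about the cut (`Snapshot.card_sq_le_of_separates`), and there must be at least `2 ^ (2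
^ e * d / 2)` possible data. Counting the sparse crossing sequences (`card_sparse_le`) shows that
there are fewer when `d` is large. -/

instance : DecidableEq Side := fun a b => by
  cases a <;> cases b <;> first | exact isTrue rfl | exact isFalse (by intro h; cases h)

/-- The labels of the tree after performing an operation. -/
def StorageOp.treeAfter {Γ : Type} :
    StorageOp Γ → (TreeNode → Option (WithBot Γ)) → TreeNode → TreeNode → Option (WithBot Γ)
  | pop, T, P => Function.update T P none
  | push x d, T, P => Function.update T (d :: P) (some (x : WithBot Γ))
  | up, T, _ => T
  | stay, T, _ => T
  | down _, T, _ => T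

/-- The tree pointer after performing an operation. -/
def StorageOp.pointerAfter {Γ : Type} : StorageOp Γ → TreeNode → TreeNode
  | pop, P => P.tail
  | push _ d, P => d :: P
  | up, P => P.tail
  | stay, P => P
  | down d, P => d :: P

/-- The type of a position in a tree given by its labels. -/
def labelNodeType {Γ : Type} (T : TreeNode → Option (WithBot Γ)) (P : TreeNode) : NodeType where
  kind := P.head?
  hasLeft := (T (Side.l :: P)).isSome
  hasRight := (T (Side.r :: P)).isSome

/-- A configuration without the input. -/
@[ext]
structure Snapshot (Q Γ : Type) where
  state : Q
  tree : TreeNode → Option (WithBot Γ)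
  pointer : TreeNode

/-- Total transition functions for automata which read a symbol in every step. -/
abbrev StepRule (Q σ Γ : Type) : Type :=
  Q → TapeSymbol σ → NodeType → Option (WithBot Γ) → Q × StorageOp Γ

namespace Snapshot

variable {Q σ Γ : Type}

/-- The tree consisting of the root, with the pointer there. -/
def initial (q : Q) : Snapshot Q Γ := ⟨q, (StorageTree.initial Γ).label, []⟩

/-- One step. -/
def step (F : StepRule Q σ Γ) (c : Snapshot Q Γ) (a : TapeSymbol σ) : Snapshot Q Γ :=
  ⟨(F c.state a (labelNodeType c.tree c.pointer) (c.tree c.pointer)).1,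
    (F c.state a (labelNodeType c.tree c.pointer) (c.tree c.pointer)).2.treeAfter c.tree c.pointer,
    (F c.state a (labelNodeType c.tree c.pointer) (c.tree c.pointer)).2.pointerAfter c.pointer⟩

/-- Reading a word. -/
def run (F : StepRule Q σ Γ) (c : Snapshot Q Γ) (w : List (TapeSymbol σ)) : Snapshot Q Γ :=
  w.foldl (step F) c

@[simp]
theorem run_nil (F : StepRule Q σ Γ) (c : Snapshot Q Γ) : run F c [] = c := rfl

@[simp]
theorem run_cons (F : StepRule Q σ Γ) (c : Snapshot Q Γ) (a : TapeSymbol σ)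
    (w : List (TapeSymbol σ)) : run F c (a :: w) = run F (step F c a) w := rfl

theorem run_append (F : StepRule Q σ Γ) (c : Snapshot Q Γ) (v w : List (TapeSymbol σ)) :
    run F c (v ++ w) = run F (run F c v) w := List.foldl_append

/-- The tree is a storage tree and the pointer is one of its nodes. -/
def Valid (c : Snapshot Q Γ) : Prop :=
  ∃ T : StorageTree Γ, T.label = c.tree ∧ c.tree c.pointer ≠ none

theorem valid_initial (q : Q) : (initial q : Snapshot Q Γ).Valid :=
  ⟨StorageTree.initial Γ, rfl, by simp [initial, StorageTree.initial]⟩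

end Snapshot

/-- Admissibility is what preserves the tree axioms: only leaves are popped, and descendants are
pushed only below existing nodes. This supplies the storage tree demanded by `Acts`, so that runs
can be computed on bare label functions. -/
theorem StorageOp.exists_acts {Γ : Type} (op : StorageOp Γ) (T : StorageTree Γ) (P : TreeNode)
    (hP : T.label P ≠ none) (hop : op.Admissible (T.nodeType P)) :
    ∃ T' : StorageTree Γ, T'.label = op.treeAfter T.label P ∧
      op.Acts T P T' (op.pointerAfter P) ∧ T'.label (op.pointerAfter P) ≠ none := by
  cases op with
  | up =>
    cases P with
    | nil => exact absurd rfl hop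
    | cons d P => exact ⟨T, rfl, .up T d P, T.ancestor_mem d P hP⟩
  | stay => exact ⟨T, rfl, .stay T P, hP⟩
  | down d =>
    have h : T.IsNode (d :: P) := by
      cases d <;> simpa [StorageOp.Admissible, NodeType.has, StorageTree.nodeType,
        Option.isSome_iff_ne_none, StorageTree.IsNode] using hop
    exact ⟨T, rfl, .down T d P h, h⟩
  | pop =>
    cases P with
    | nil => exact absurd rfl hop.1
    | cons d P =>
      have hch : ∀ e : Side, ¬ T.IsNode (e :: d :: P) := by
        have := hop.2
        simp only [StorageTree.nodeType, Option.isSome_eq_false_iff, Option.isNone_iff_eq_none]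
          at this
        intro e
        cases e
        · exact not_not.2 this.1
        · exact not_not.2 this.2
      refine ⟨⟨Function.update T.label (d :: P) none, ?_, ?_, ?_⟩, rfl, ?_, ?_⟩
      · refine T.finite_domain.subset fun R hR => ?_
        by_cases h : R = d :: P
        · simp [h] at hR
        · simpa [h] using hR
      · intro e R h
        by_cases h1 : e :: R = d :: P
        · simp [h1] at h
        · rw [Function.update_of_ne h1] at h
          by_cases h2 : R = d :: P
          · subst h2
            exact absurd h (hch e)
          · rw [Function.update_of_ne h2]
            exact T.ancestor_mem e R h
      · intro R
        by_cases h : R = d :: P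
        · simp [h]
        · rw [Function.update_of_ne h]
          exact T.label_eq_bot R
      · exact .pop T _ d P hch (by simp) (fun R hR => by simp [hR])
      · simpa [StorageOp.pointerAfter] using T.ancestor_mem d P hP
  | push x d =>
    have h : ¬ T.IsNode (d :: P) := by
      cases d <;> simpa [StorageOp.Admissible, NodeType.has, StorageTree.nodeType,
        StorageTree.IsNode] using hop
    refine ⟨⟨Function.update T.label (d :: P) (some (x : WithBot Γ)), ?_, ?_, ?_⟩, rfl, ?_, ?_⟩
    · refine (T.finite_domain.insert (d :: P)).subset fun R hR => ?_
      by_cases h : R = d :: P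
      · simp [h]
      · exact Or.inr (by simpa [h] using hR)
    · intro e R h1
      by_cases h2 : R = d :: P
      · simp [h2]
      · rw [Function.update_of_ne h2]
        by_cases h3 : e :: R = d :: P
        · simp only [List.cons.injEq] at h3
          rw [h3.2]
          exact hP
        · rw [Function.update_of_ne h3] at h1
          exact T.ancestor_mem e R h1
    · intro R
      by_cases h2 : R = d :: P
      · simp [h2]
      · rw [Function.update_of_ne h2]
        exact T.label_eq_bot R
    · exact .push T _ x d P h (by simp) (fun R hR => by simp [hR])
    · simp [StorageOp.pointerAfter]

theorem StorageOp.Acts.eq {Γ : Type} {op : StorageOp Γ} {T T' : StorageTree Γ} {P P' : TreeNode}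
    (h : op.Acts T P T' P') :
    T'.label = op.treeAfter T.label P ∧ P' = op.pointerAfter P := by
  cases h with
  | up => exact ⟨rfl, rfl⟩
  | stay => exact ⟨rfl, rfl⟩
  | down => exact ⟨rfl, rfl⟩
  | pop _ _ d _ h1 h2 h3 =>
    refine ⟨funext fun R => ?_, rfl⟩
    by_cases h : R = d :: P'
    · simp [StorageOp.treeAfter, h, h2]
    · simp [StorageOp.treeAfter, h, h3 R h]
  | push _ _ x d _ h1 h2 h3 =>
    refine ⟨funext fun R => ?_, rfl⟩
    by_cases h : R = d :: P
    · simp [StorageOp.treeAfter, h, h2]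
    · simp [StorageOp.treeAfter, h, h3 R h]

namespace TWSDA

variable {Q σ Γ : Type}

/-- The reading steps of the automaton, made total by a sink state `none`. -/
def stepRule (M : TWSDA Q σ Γ) : StepRule (Option Q) σ Γ := fun q a t x =>
  match q, x with
  | some q, some x =>
    match M.δ q (some a) t x with
    | some r => (some r.1, r.2)
    | none => (none, .stay)
  | _, _ => (none, .stay)

theorem stepRule_none (M : TWSDA Q σ Γ) (a : TapeSymbol σ) (t : NodeType)
    (x : Option (WithBot Γ)) : M.stepRule none a t x = (none, .stay) := rfl

theorem stepRule_some (M : TWSDA Q σ Γ) (q : Q) (a : TapeSymbol σ) (t : NodeType)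
    (x : WithBot Γ) : M.stepRule (some q) a t (some x) =
      ((M.δ q (some a) t x).map Prod.fst, ((M.δ q (some a) t x).map Prod.snd).getD .stay) := by
  rcases h : M.δ q (some a) t x with _ | r <;> simp [stepRule, h]

theorem stepRule_admissible (M : TWSDA Q σ Γ) (q : Option Q) (a : TapeSymbol σ) (t : NodeType)
    (x : Option (WithBot Γ)) : (M.stepRule q a t x).2.Admissible t := by
  rcases q with _ | q
  · trivial
  rcases x with _ | x
  · trivial
  rw [stepRule_some]
  rcases h : M.δ q (some a) t x with _ | ⟨r, op⟩
  · trivial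
  · exact M.well_defined _ _ _ _ _ _ h

theorem step_valid (M : TWSDA Q σ Γ) {c : Snapshot (Option Q) Γ} (hc : c.Valid)
    (a : TapeSymbol σ) : (c.step M.stepRule a).Valid := by
  obtain ⟨T, hT, hp⟩ := hc
  obtain ⟨T', h1, -, h3⟩ := StorageOp.exists_acts _ T c.pointer (by rwa [hT])
    (M.stepRule_admissible c.state a (T.nodeType c.pointer) (c.tree c.pointer))
  refine ⟨T', ?_, ?_⟩
  · rw [h1, hT]
    simp only [Snapshot.step, labelNodeType, StorageTree.nodeType, hT]
  · rw [h1, hT] at h3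
    simpa only [Snapshot.step, labelNodeType, StorageTree.nodeType, hT] using h3

theorem run_state_none (M : TWSDA Q σ Γ) (w : List (TapeSymbol σ))
    (c : Snapshot (Option Q) Γ) (hc : c.state = none) : (c.run M.stepRule w).state = none := by
  induction w generalizing c with
  | nil => exact hc
  | cons a w ih => exact ih _ (by simp [Snapshot.step, hc, stepRule_none])

/-- The snapshot belongs to the configuration. -/
def Matches (c : TWSDAConfig Q σ Γ) (s : Snapshot (Option Q) Γ) : Prop :=
  s.state = some c.state ∧ s.tree = c.tree.label ∧ s.pointer = c.pointer

theorem Step.matches {M : TWSDA Q σ Γ} (hM : M.RealTime) {c c' : TWSDAConfig Q σ Γ}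
    (h : M.Step c c') {s : Snapshot (Option Q) Γ} (hs : Matches c s) :
    ∃ a, c.unread = a :: c'.unread ∧ Matches c' (s.step M.stepRule a) := by
  obtain ⟨a, x, op, h1, h2, h3, h4⟩ := h
  obtain ⟨s1, s2, s3⟩ := hs
  rcases a with _ | a
  · rw [hM] at h3
    exact absurd h3 (by simp)
  · have key : M.stepRule s.state a (labelNodeType s.tree s.pointer) (s.tree s.pointer) =
        (some c'.state, op) := by
      have : labelNodeType s.tree s.pointer = c.tree.nodeType c.pointer := by
        rw [s2, s3]; rfl
      rw [s1, this, s2, s3, h2, stepRule_some, h3]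
      rfl
    refine ⟨a, h1, ?_, ?_, ?_⟩
    · simp only [Snapshot.step, key]
    · simp only [Snapshot.step, key, h4.eq.1]
      rw [s2, s3]
    · simp only [Snapshot.step, key, h4.eq.2]
      rw [s3]

theorem exists_step {M : TWSDA Q σ Γ} {c : TWSDAConfig Q σ Γ} {s : Snapshot (Option Q) Γ}
    (hs : Matches c s) {a : TapeSymbol σ} {w : List (TapeSymbol σ)} (hc : c.unread = a :: w)
    (hp : c.tree.label c.pointer ≠ none) (hn : (s.step M.stepRule a).state ≠ none) :
    ∃ c', M.Step c c' ∧ c'.unread = w ∧ Matches c' (s.step M.stepRule a) ∧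
      c'.tree.label c'.pointer ≠ none := by
  obtain ⟨s1, s2, s3⟩ := hs
  obtain ⟨x, hx⟩ := Option.ne_none_iff_exists'.1 hp
  have ht : labelNodeType s.tree s.pointer = c.tree.nodeType c.pointer := by
    rw [s2, s3]; rfl
  have key : M.stepRule s.state a (labelNodeType s.tree s.pointer) (s.tree s.pointer) =
      M.stepRule (some c.state) a (c.tree.nodeType c.pointer) (some x) := by
    rw [s1, ht, s2, s3, hx]
  rw [stepRule_some] at key
  rcases hd : M.δ c.state (some a) (c.tree.nodeType c.pointer) x with _ | ⟨q', op⟩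
  · exact absurd (by simp [Snapshot.step, key, hd]) hn
  · simp only [hd, Option.map_some, Option.getD_some] at key
    obtain ⟨T', t1, t2, t3⟩ := op.exists_acts c.tree c.pointer hp
      (M.well_defined _ _ _ _ _ _ hd)
    refine ⟨⟨q', w, T', op.pointerAfter c.pointer⟩, ⟨some a, x, op, hc, hx, hd, t2⟩, rfl,
      ⟨?_, ?_, ?_⟩, t3⟩
    · simp only [Snapshot.step, key]
    · simp only [Snapshot.step, key, t1]
      rw [s2, s3]
    · simp only [Snapshot.step, key]
      rw [s3]

theorem reflTransGen_matches {M : TWSDA Q σ Γ} (hM : M.RealTime) {c c' : TWSDAConfig Q σ Γ}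
    (h : Relation.ReflTransGen M.Step c c') {s : Snapshot (Option Q) Γ} (hs : Matches c s) :
    ∃ u, c.unread = u ++ c'.unread ∧ Matches c' (s.run M.stepRule u) := by
  induction h with
  | refl => exact ⟨[], rfl, hs⟩
  | tail _ h2 ih =>
    obtain ⟨u, hu, hm⟩ := ih
    obtain ⟨a, ha, hm'⟩ := h2.matches hM hm
    exact ⟨u ++ [a], by simp [hu, ha], by rw [Snapshot.run_append]; exact hm'⟩

theorem exists_reflTransGen {M : TWSDA Q σ Γ} (w : List (TapeSymbol σ))
    {c : TWSDAConfig Q σ Γ} {s : Snapshot (Option Q) Γ}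
    (hs : Matches c s) (hc : c.unread = w) (hp : c.tree.label c.pointer ≠ none)
    (hn : (s.run M.stepRule w).state ≠ none) :
    ∃ c', Relation.ReflTransGen M.Step c c' ∧ c'.unread = [] ∧
      Matches c' (s.run M.stepRule w) := by
  induction w generalizing c s with
  | nil => exact ⟨c, .refl, hc, hs⟩
  | cons a w ih =>
    obtain ⟨c', h1, h2, h3, h4⟩ := exists_step (M := M) hs hc hp
      (fun h => hn (M.run_state_none w _ h))
    obtain ⟨c'', h5, h6, h7⟩ := ih h3 h2 h4 hn
    exact ⟨c'', .head h1 h5, h6, h7⟩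

/-- The snapshot after reading the word and the endmarker. -/
def finalSnapshot (M : TWSDA Q σ Γ) (w : List σ) : Snapshot (Option Q) Γ :=
  (Snapshot.initial (some M.start)).run M.stepRule (w.map .sym ++ [.endmarker])

/-- Halting comes for free: once the input is exhausted, only a step without reading could follow,
and a real-time automaton has none. Acceptance thus depends only on the last state of a total run.
-/
theorem mem_language_iff {M : TWSDA Q σ Γ} (hM : M.RealTime) (w : List σ) :
    w ∈ M.language ↔ ∃ q ∈ M.accepting, (M.finalSnapshot w).state = some q := by
  have h0 : Matches (M.initialConfig w) (Snapshot.initial (some M.start)) := ⟨rfl, rfl, rfl⟩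
  constructor
  · rintro ⟨c, h1, -, h3, h4⟩
    obtain ⟨u, hu, hm⟩ := reflTransGen_matches hM h1 h0
    rw [h3, List.append_nil] at hu
    refine ⟨c.state, h4, ?_⟩
    rw [← hm.1, ← hu]
    rfl
  · rintro ⟨q, hq, h⟩
    obtain ⟨c, h1, h2, h3⟩ := exists_reflTransGen (M := M) _ h0 rfl
      (by simp [initialConfig, StorageTree.initial]) (by
        change (M.finalSnapshot w).state ≠ none
        simp [h])
    refine ⟨c, h1, ?_, h2, ?_⟩
    · rintro (_ | a) v x hv -
      · exact hM _ _ _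
      · rw [h2] at hv
        simp at hv
    · have : some c.state = some q := h3.1.symm.trans h
      rw [Option.some_injective _ this]
      exact hq

/-! ### Closure under complementation -/

/-- The automaton accepting the complement of a language accepted in real time. -/
def complement (M : TWSDA Q σ Γ) : TWSDA (Option Q) σ Γ where
  δ q a t x := a.map fun a => M.stepRule q a t (some x)
  start := some M.start
  accepting := {q | ∀ p ∈ M.accepting, q ≠ some p}
  no_choice q t x h := absurd rfl h
  well_defined q a t x q' op h := by
    rcases a with _ | a
    · simp at h
    · simp only [Option.map_some, Option.some.injEq] at h
      have := M.stepRule_admissible q a t (some x)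
      rwa [h] at this

theorem complement_realTime (M : TWSDA Q σ Γ) : M.complement.RealTime := fun _ _ _ => rfl

theorem complement_nonErasing {M : TWSDA Q σ Γ} (hM : M.NonErasing) :
    M.complement.NonErasing := by
  rintro q (_ | a) t x q' h
  · simp [complement] at h
  · simp only [complement, Option.map_some, Option.some.injEq] at h
    rcases q with _ | q
    · simp [stepRule_none] at h
    · rw [stepRule_some] at h
      rcases hd : M.δ q (some a) t x with _ | ⟨r, op⟩
      · simp [hd] at h
      · simp only [hd, Option.map_some, Option.getD_some, Prod.mk.injEq] at h
        rw [h.2] at hd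
        exact hM _ _ _ _ _ hd

/-- Validity guarantees that the pointer always sees a label. So the complement automaton never
falls into its own sink and simulates the sink of `M` as an ordinary state. -/
theorem complement_run (M : TWSDA Q σ Γ) (w : List (TapeSymbol σ))
    (c : Snapshot (Option Q) Γ) (hc : c.Valid) :
    Snapshot.run M.complement.stepRule ⟨some c.state, c.tree, c.pointer⟩ w =
      ⟨some (c.run M.stepRule w).state, (c.run M.stepRule w).tree,
        (c.run M.stepRule w).pointer⟩ := by
  induction w generalizing c with
  | nil => rfl
  | cons a w ih =>
    rw [Snapshot.run_cons, Snapshot.run_cons, ← ih _ (M.step_valid hc a)]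
    congr 1
    obtain ⟨T, -, hp⟩ := hc
    obtain ⟨x, hx⟩ := Option.ne_none_iff_exists'.1 hp
    simp only [Snapshot.step, hx, stepRule_some]
    simp [complement]

theorem complement_language {M : TWSDA Q σ Γ} (hM : M.RealTime) :
    M.complement.language = M.languageᶜ := by
  ext w
  change _ ↔ ¬ w ∈ M.language
  rw [mem_language_iff hM, mem_language_iff M.complement_realTime]
  have : M.complement.finalSnapshot w = _ := M.complement_run _ _ (Snapshot.valid_initial _)
  rw [this]
  simp only [Option.some.injEq, exists_eq_right']
  change (∀ p ∈ M.accepting, (M.finalSnapshot w).state ≠ some p) ↔ _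
  push Not
  rfl

end TWSDA

theorem compl_mem_rtTWSDA {σ : Type} [Finite σ] {L : Language σ} (h : L ∈ rtTWSDA σ) :
    Lᶜ ∈ rtTWSDA σ := by
  obtain ⟨Q, Γ, _, _, M, hM, rfl⟩ := h
  exact ⟨Option Q, Γ, inferInstance, inferInstance, M.complement, M.complement_realTime,
    TWSDA.complement_language hM⟩

theorem compl_mem_rtTWSDNEA {σ : Type} [Finite σ] {L : Language σ} (h : L ∈ rtTWSDNEA σ) :
    Lᶜ ∈ rtTWSDNEA σ := by
  obtain ⟨Q, Γ, _, _, M, hN, hM, rfl⟩ := h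
  exact ⟨Option Q, Γ, inferInstance, inferInstance, M.complement, TWSDA.complement_nonErasing hN,
    M.complement_realTime, TWSDA.complement_language hM⟩

theorem rtTWSDNEA_subset_rtTWSDA (σ : Type) [Finite σ] : rtTWSDNEA σ ⊆ rtTWSDA σ := by
  rintro L ⟨Q, Γ, h1, h2, M, -, hM, hL⟩
  exact ⟨Q, Γ, h1, h2, M, hM, hL⟩

/-- By De Morgan's laws, a family closed under complementation and intersection is closed under
union. -/
theorem ClosedUnderIntersection.closedUnderUnion {F : LanguageFamily}
    (hF : ClosedUnderIntersection F)
    (hc : ∀ (σ : Type) [Finite σ] (L : Language σ), L ∈ F σ → Lᶜ ∈ F σ) :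
    ClosedUnderUnion F := by
  intro σ _ L₁ L₂ h₁ h₂
  have h := hc σ _ (hF σ _ _ (hc σ _ h₁) (hc σ _ h₂))
  rwa [compl_inf, compl_compl, compl_compl] at h

/-! ### Acceptance from an intermediate snapshot -/

namespace TWSDA

variable {Q σ Γ : Type}

/-- Started in the snapshot `c`, the automaton accepts the remaining word `w`. -/
def AcceptsFrom (M : TWSDA Q σ Γ) (c : Snapshot (Option Q) Γ) (w : List σ) : Prop :=
  ∃ q ∈ M.accepting, (c.run M.stepRule (w.map .sym ++ [.endmarker])).state = some q

theorem mem_language_iff_acceptsFrom {M : TWSDA Q σ Γ} (hM : M.RealTime) (w : List σ) :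
    w ∈ M.language ↔ M.AcceptsFrom (Snapshot.initial (some M.start)) w :=
  mem_language_iff hM w

theorem acceptsFrom_cons_iff {M : TWSDA Q σ Γ} {q q' : Q} {a : σ}
    {T : TreeNode → Option (WithBot Γ)} {P : TreeNode} {x : WithBot Γ} {op : StorageOp Γ}
    (hx : T P = some x) (h : M.δ q (some (.sym a)) (labelNodeType T P) x = some (q', op))
    (w : List σ) :
    M.AcceptsFrom ⟨some q, T, P⟩ (a :: w) ↔
      M.AcceptsFrom ⟨some q', op.treeAfter T P, op.pointerAfter P⟩ w := by
  simp [AcceptsFrom, Snapshot.step, hx, stepRule_some, h]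

theorem not_acceptsFrom_cons {M : TWSDA Q σ Γ} {q : Q} {a : σ}
    {T : TreeNode → Option (WithBot Γ)} {P : TreeNode} {x : WithBot Γ}
    (hx : T P = some x) (h : M.δ q (some (.sym a)) (labelNodeType T P) x = none)
    (w : List σ) : ¬ M.AcceptsFrom ⟨some q, T, P⟩ (a :: w) := by
  rintro ⟨p, -, hp⟩
  rw [List.map_cons, List.cons_append, Snapshot.run_cons, run_state_none] at hp
  · simp at hp
  · simp [Snapshot.step, hx, stepRule_some, h]

theorem acceptsFrom_nil_iff {M : TWSDA Q σ Γ} {q : Q}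
    {T : TreeNode → Option (WithBot Γ)} {P : TreeNode} {x : WithBot Γ} (hx : T P = some x) :
    M.AcceptsFrom ⟨some q, T, P⟩ [] ↔
      ∃ q' ∈ M.accepting, ∃ op,
        M.δ q (some .endmarker) (labelNodeType T P) x = some (q', op) := by
  rcases h : M.δ q (some .endmarker) (labelNodeType T P) x with _ | ⟨r, op⟩ <;>
    simp [AcceptsFrom, Snapshot.step, hx, stepRule_some, h]

end TWSDA

/-- The input symbol by which a descendant is addressed. -/
def Side.sym : Side → WSym
  | l => WSym.a
  | r => WSym.b

theorem Side.sym_injective : Function.Injective Side.sym := by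
  intro d e h
  cases d <;> cases e <;> first | rfl | cases h

theorem mem_wordsAB_iff (w : List WSym) : w ∈ wordsAB ↔ ∃ u : List Side, w = u.map Side.sym := by
  constructor
  · intro h
    induction w with
    | nil => exact ⟨[], rfl⟩
    | cons s w ih =>
      obtain ⟨u, rfl⟩ := ih fun t ht => h t (List.mem_cons_of_mem _ ht)
      rcases h s List.mem_cons_self with rfl | rfl
      · exact ⟨Side.l :: u, rfl⟩
      · exact ⟨Side.r :: u, rfl⟩
  · rintro ⟨u, rfl⟩ s hs
    obtain ⟨d, -, rfl⟩ := List.mem_map.1 hs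
    cases d
    · exact Or.inl rfl
    · exact Or.inr rfl

theorem nil_mem_wordsABDollar : ([] : List WSym) ∈ wordsABDollar := by simp [wordsABDollar]

theorem cons_mem_wordsABDollar {s : WSym} {w : List WSym} :
    s :: w ∈ wordsABDollar ↔
      (s = WSym.a ∨ s = WSym.b ∨ s = WSym.dollar) ∧ w ∈ wordsABDollar := by
  simp [wordsABDollar]

/-! ## The language of mirrored words -/

/-- The tree consisting of a single path. -/
def pathTree (p : TreeNode) (X : TreeNode) : Option (WithBot Unit) :=
  if X = [] then some ⊥ else if X <:+ p then some ((() : Unit) : WithBot Unit) else none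

theorem pathTree_of_suffix {p X : TreeNode} (h : X <:+ p) :
    ∃ x, pathTree p X = some x := by
  unfold pathTree
  split_ifs
  exacts [⟨_, rfl⟩, ⟨_, rfl⟩]

theorem pathTree_child (p : TreeNode) (d : Side) : pathTree p (d :: p) = none := by
  have : ¬ (d :: p) <:+ p := fun h => by simpa using h.length_le
  simp [pathTree, this]

theorem update_pathTree (p : TreeNode) (d : Side) :
    Function.update (pathTree p) (d :: p) (some ((() : Unit) : WithBot Unit)) =
      pathTree (d :: p) := by
  funext X
  by_cases h : X = d :: p
  · simp [h, pathTree]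
  · simp [h, pathTree, List.suffix_cons_iff]

/-- The states of the automaton for the mirrored words. -/
inductive MirrorState : Type
  | skip
  | store
  | compare
  | close
  | accept

instance : Finite MirrorState :=
  Finite.of_surjective
    (fun i : Fin 5 => match i with
      | 0 => MirrorState.skip
      | 1 => MirrorState.store
      | 2 => MirrorState.compare
      | 3 => MirrorState.close
      | 4 => MirrorState.accept)
    (fun s => by
      cases s
      exacts [⟨0, rfl⟩, ⟨1, rfl⟩, ⟨2, rfl⟩, ⟨3, rfl⟩, ⟨4, rfl⟩])

/-- The reading transitions of the automaton for the mirrored words: the word `v` is stored as the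
address of the pointer. -/
def mirrorStep : MirrorState → TapeSymbol WSym → NodeType → Option (MirrorState × StorageOp Unit)
  | .skip, .sym .a, _ => some (.skip, .stay)
  | .skip, .sym .b, _ => some (.skip, .stay)
  | .skip, .sym .dollar, _ => some (.skip, .stay)
  | .skip, .sym .cent, _ => some (.store, .stay)
  | .store, .sym .a, t => if t.hasLeft = false then some (.store, .push () .l) else none
  | .store, .sym .b, t => if t.hasRight = false then some (.store, .push () .r) else none
  | .store, .sym .dollar, _ => some (.compare, .stay)
  | .compare, .sym .a, t => if t.kind = some .l then some (.compare, .up) else none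
  | .compare, .sym .b, t => if t.kind = some .r then some (.compare, .up) else none
  | .compare, .sym .border₂, t => if t.kind = none then some (.close, .stay) else none
  | .close, .endmarker, _ => some (.accept, .stay)
  | _, _, _ => none

theorem mirrorStep_spec {q q' : MirrorState} {a : TapeSymbol WSym} {t : NodeType}
    {op : StorageOp Unit} (h : mirrorStep q a t = some (q', op)) :
    op.Admissible t ∧ op ≠ .pop := by
  unfold mirrorStep at h
  split at h <;> first
    | (simp at h; done)
    | (simp only [Option.some.injEq, Prod.mk.injEq] at h
       obtain ⟨-, rfl⟩ := h
       exact ⟨trivial, by simp⟩)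
    | (split_ifs at h with ht
       simp only [Option.some.injEq, Prod.mk.injEq] at h
       obtain ⟨-, rfl⟩ := h
       simp [StorageOp.Admissible, NodeType.has, ht])

/-- The automaton for the mirrored words. -/
def mirrorAutomaton : TWSDA MirrorState WSym Unit where
  δ q a t _ := a.bind fun a => mirrorStep q a t
  start := .skip
  accepting := {.accept}
  no_choice q t x h := absurd rfl h
  well_defined q a t x q' op h := by
    rcases a with _ | a
    · cases h
    · exact (mirrorStep_spec h).1

theorem mirrorAutomaton_δ (q : MirrorState) (a : TapeSymbol WSym) (t : NodeType)
    (x : WithBot Unit) : mirrorAutomaton.δ q (some a) t x = mirrorStep q a t := rfl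

theorem mirrorAutomaton_close {T : TreeNode → Option (WithBot Unit)} {P : TreeNode}
    {x : WithBot Unit} (hx : T P = some x) (w : List WSym) :
    mirrorAutomaton.AcceptsFrom ⟨some .close, T, P⟩ w ↔ w = [] := by
  cases w with
  | nil => simp [TWSDA.acceptsFrom_nil_iff hx, mirrorStep, mirrorAutomaton]
  | cons s w =>
    simp only [reduceCtorEq, iff_false]
    exact TWSDA.not_acceptsFrom_cons hx (by rw [mirrorAutomaton_δ, mirrorStep] <;> simp) w

/-- An address lists its last letter first, so climbing from `P` meets the stored letters in exactly
the order of the reversed word. The tree stays fixed while the pointer shrinks, hence the separate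
`p`. -/
theorem mirrorAutomaton_compare {p P : TreeNode} (hP : P <:+ p) (w : List WSym) :
    mirrorAutomaton.AcceptsFrom ⟨some .compare, pathTree p, P⟩ w ↔
      w = P.map Side.sym ++ [WSym.border₂] := by
  induction P generalizing w with
  | nil =>
    obtain ⟨x, hx⟩ := pathTree_of_suffix hP
    cases w with
    | nil => simp [TWSDA.acceptsFrom_nil_iff hx, mirrorAutomaton_δ, mirrorStep]
    | cons s w =>
      cases s
      case border₂ =>
        rw [TWSDA.acceptsFrom_cons_iff hx (q' := .close) (op := .stay) (by
          simp [mirrorAutomaton_δ, mirrorStep, labelNodeType])]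
        simpa [StorageOp.treeAfter, StorageOp.pointerAfter] using mirrorAutomaton_close hx w
      all_goals
        simp only [List.map_nil, List.nil_append, List.cons.injEq, reduceCtorEq, false_and,
          iff_false]
        exact TWSDA.not_acceptsFrom_cons hx
          (by simp [mirrorAutomaton_δ, mirrorStep, labelNodeType]) w
  | cons d P ih =>
    obtain ⟨x, hx⟩ := pathTree_of_suffix hP
    have hP' := (List.suffix_cons d P).trans hP
    cases w with
    | nil => simp [TWSDA.acceptsFrom_nil_iff hx, mirrorAutomaton_δ, mirrorStep]
    | cons s w =>
      by_cases hs : s = d.sym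
      · subst hs
        rw [TWSDA.acceptsFrom_cons_iff hx (q' := .compare) (op := .up) (by
          cases d <;> simp [mirrorAutomaton_δ, mirrorStep, labelNodeType, Side.sym])]
        simpa [StorageOp.treeAfter, StorageOp.pointerAfter] using ih hP' w
      · simp only [List.map_cons, List.cons_append, List.cons.injEq, hs, false_and, iff_false]
        refine TWSDA.not_acceptsFrom_cons hx ?_ w
        cases d <;> cases s <;>
          first
          | exact absurd rfl hs
          | simp [mirrorAutomaton_δ, mirrorStep, labelNodeType]

/-- The address `p` is the part of `v` read so far, reversed. The pointer is always at the lower end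
of the path, so a push is never blocked. -/
theorem mirrorAutomaton_store (p : TreeNode) (w : List WSym) :
    mirrorAutomaton.AcceptsFrom ⟨some .store, pathTree p, p⟩ w ↔
      ∃ u : List Side, w = u.map Side.sym ++ [WSym.dollar] ++
        (u.reverse ++ p).map Side.sym ++ [WSym.border₂] := by
  induction w generalizing p with
  | nil =>
    obtain ⟨x, hx⟩ := pathTree_of_suffix p.suffix_refl
    simp [TWSDA.acceptsFrom_nil_iff hx, mirrorAutomaton_δ, mirrorStep]
  | cons s w ih =>
    obtain ⟨x, hx⟩ := pathTree_of_suffix p.suffix_refl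
    have push : ∀ d : Side, mirrorAutomaton.AcceptsFrom ⟨some .store, pathTree p, p⟩
        (d.sym :: w) ↔ ∃ u : List Side, d.sym :: w = u.map Side.sym ++ [WSym.dollar] ++
          (u.reverse ++ p).map Side.sym ++ [WSym.border₂] := by
      intro d
      rw [TWSDA.acceptsFrom_cons_iff hx (q' := .store) (op := .push () d) (by
        cases d <;> simp [mirrorAutomaton_δ, mirrorStep, labelNodeType, Side.sym,
          pathTree_child])]
      simp only [StorageOp.treeAfter, StorageOp.pointerAfter, update_pathTree]
      rw [ih]
      constructor
      · rintro ⟨u, rfl⟩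
        exact ⟨d :: u, by simp⟩
      · rintro ⟨u, hu⟩
        cases u with
        | nil => cases d <;> simp [Side.sym] at hu
        | cons e u =>
          simp only [List.map_cons, List.cons_append, List.cons.injEq] at hu
          obtain rfl := Side.sym_injective hu.1
          exact ⟨u, by simpa using hu.2⟩
    cases s
    case a => exact push Side.l
    case b => exact push Side.r
    case dollar =>
      rw [TWSDA.acceptsFrom_cons_iff hx (q' := .compare) (op := .stay) rfl]
      simp only [StorageOp.treeAfter, StorageOp.pointerAfter]
      rw [mirrorAutomaton_compare p.suffix_refl]
      constructor
      · rintro rfl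
        exact ⟨[], by simp⟩
      · rintro ⟨u, hu⟩
        cases u with
        | nil => simpa using hu
        | cons e u => cases e <;> simp [Side.sym] at hu
    all_goals
      refine iff_of_false (TWSDA.not_acceptsFrom_cons hx rfl w) ?_
      rintro ⟨_ | ⟨_ | _, u⟩, hu⟩ <;> simp [Side.sym] at hu

theorem mirrorAutomaton_skip (w : List WSym) :
    mirrorAutomaton.AcceptsFrom ⟨some .skip, pathTree [], []⟩ w ↔ w ∈ hatLmi := by
  induction w with
  | nil =>
    rw [TWSDA.acceptsFrom_nil_iff (x := ⊥) rfl]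
    refine iff_of_false (by simp [mirrorAutomaton_δ, mirrorStep]) ?_
    rintro ⟨x, v, -, -, h⟩
    simp at h
  | cons s w ih =>
    have stay : s = WSym.a ∨ s = WSym.b ∨ s = WSym.dollar →
        (mirrorAutomaton.AcceptsFrom ⟨some .skip, pathTree [], []⟩ (s :: w) ↔
          s :: w ∈ hatLmi) := by
      intro hs
      rw [TWSDA.acceptsFrom_cons_iff (x := ⊥) rfl (q' := .skip) (op := .stay) (by
        rcases hs with rfl | rfl | rfl <;> rfl)]
      simp only [StorageOp.treeAfter, StorageOp.pointerAfter]
      rw [ih]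
      constructor
      · rintro ⟨x, v, hx, hv, rfl⟩
        exact ⟨s :: x, v, cons_mem_wordsABDollar.2 ⟨hs, hx⟩, hv, by simp⟩
      · rintro ⟨x, v, hx, hv, h⟩
        cases x with
        | nil => rcases hs with rfl | rfl | rfl <;> simp at h
        | cons t x =>
          simp only [List.cons_append, List.cons.injEq] at h
          exact ⟨x, v, (cons_mem_wordsABDollar.1 hx).2, hv, h.2⟩
    cases s
    case a => exact stay (by simp)
    case b => exact stay (by simp)
    case dollar => exact stay (by simp)
    case cent =>
      rw [TWSDA.acceptsFrom_cons_iff (x := ⊥) rfl (q' := .store) (op := .stay) rfl]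
      simp only [StorageOp.treeAfter, StorageOp.pointerAfter]
      rw [mirrorAutomaton_store]
      constructor
      · rintro ⟨u, rfl⟩
        exact ⟨[], u.map Side.sym, nil_mem_wordsABDollar, (mem_wordsAB_iff _).2 ⟨u, rfl⟩,
          by simp⟩
      · rintro ⟨x, v, hx, hv, h⟩
        obtain ⟨u, rfl⟩ := (mem_wordsAB_iff _).1 hv
        cases x with
        | nil => exact ⟨u, by simpa using h⟩
        | cons t x =>
          simp only [List.cons_append, List.cons.injEq] at h
          have := (cons_mem_wordsABDollar.1 hx).1
          simp [← h.1] at this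
    all_goals
      refine iff_of_false (TWSDA.not_acceptsFrom_cons (x := ⊥) rfl rfl w) ?_
      rintro ⟨_ | ⟨t, x⟩, v, hx, hv, h⟩
      · simp at h
      · simp only [List.cons_append, List.cons.injEq] at h
        have := (cons_mem_wordsABDollar.1 hx).1
        simp [← h.1] at this

theorem hatLmi_mem_rtTWSDNEA : hatLmi ∈ rtTWSDNEA WSym := by
  refine ⟨MirrorState, Unit, inferInstance, inferInstance, mirrorAutomaton, ?_, fun _ _ _ => rfl,
    ?_⟩
  · rintro q (_ | a) t x q' h
    · cases h
    · exact (mirrorStep_spec h).2 rfl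
  · ext w
    rw [TWSDA.mem_language_iff_acceptsFrom (fun _ _ _ => rfl), ← mirrorAutomaton_skip]
    have : (Snapshot.initial (some mirrorAutomaton.start) : Snapshot (Option MirrorState) Unit) =
        ⟨some .skip, pathTree [], []⟩ := by
      refine Snapshot.ext rfl (funext fun X => ?_) rfl
      cases X <;> simp [Snapshot.initial, StorageTree.initial, pathTree]
    rw [this]

/-! ## The language of stored prefixes -/

/-- The trie with the given ends of words, together with the path to `p`. The labels tell whether
a node is at depth one and whether it is the end of a word. -/
def trie (ns : List TreeNode) (p X : TreeNode) : Option (WithBot (Bool × Bool)) :=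
  if X = [] then some ⊥
  else if ∃ n ∈ ns, X <:+ n then
    some ((decide (X.length = 1), decide (X ∈ ns)) : Bool × Bool)
  else if X <:+ p then some ((decide (X.length = 1), false) : Bool × Bool)
  else none

theorem trie_eq_none_iff {ns : List TreeNode} {p X : TreeNode} :
    trie ns p X = none ↔ X ≠ [] ∧ (∀ n ∈ ns, ¬ X <:+ n) ∧ ¬ X <:+ p := by
  unfold trie
  split_ifs with h1 h2 h3
  · simp [h1]
  · simp only [false_iff, not_and]
    obtain ⟨n, hn, h⟩ := h2
    exact fun _ h' => absurd h (h' n hn)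
  · simp [h3]
  · push Not at h2
    exact ⟨fun _ => ⟨h1, h2, h3⟩, fun _ => rfl⟩

theorem exists_trie_eq_some {ns : List TreeNode} {p X : TreeNode}
    (h : X = [] ∨ (∃ n ∈ ns, X <:+ n) ∨ X <:+ p) : ∃ x, trie ns p X = some x := by
  rw [← Option.ne_none_iff_exists', Ne, trie_eq_none_iff]
  rintro ⟨h1, h2, h3⟩
  rcases h with h | ⟨n, hn, h⟩ | h
  exacts [h1 h, h2 n hn h, h3 h]

theorem not_cons_suffix_self (d : Side) (p : TreeNode) : ¬ (d :: p) <:+ p :=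
  fun h => by simpa using h.length_le

theorem trie_cons_of_mem {ns : List TreeNode} {p : TreeNode} {d : Side}
    (h : ∃ n ∈ ns, d :: p <:+ n) : trie ns (d :: p) = trie ns p := by
  funext X
  unfold trie
  by_cases hX : X = d :: p
  · subst hX
    rw [if_pos h, if_pos h]
  · simp [List.suffix_cons_iff, hX]

theorem update_trie {ns : List TreeNode} {p : TreeNode} {d : Side}
    (h : trie ns p (d :: p) = none) :
    Function.update (trie ns p) (d :: p)
      (some ((decide (p = []), false) : Bool × Bool)) = trie ns (d :: p) := by
  rw [trie_eq_none_iff] at h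
  funext X
  by_cases hX : X = d :: p
  · subst hX
    have : ¬ ∃ n ∈ ns, d :: p <:+ n := by simpa using h.2.1
    simp [trie, this]
  · simp [trie, List.suffix_cons_iff, hX]

/-- The auxiliary path is absorbed by the new word: every node on the way to `p` is an ancestor of
`d :: p`, and such nodes carry the same labels in both descriptions. -/
theorem update_trie_end {ns : List TreeNode} {p : TreeNode} {d : Side} :
    Function.update (trie ns p) (d :: p)
      (some ((decide (p = []), true) : Bool × Bool)) = trie ((d :: p) :: ns) [] := by
  funext X
  by_cases hX : X = d :: p
  · subst hX
    simp [trie]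
  · by_cases h0 : X = []
    · simp [trie, h0]
    rw [Function.update_of_ne hX]
    by_cases h1 : ∃ n ∈ ns, X <:+ n
    · have h2 : ∃ n ∈ (d :: p) :: ns, X <:+ n := by
        obtain ⟨n, hn, h1⟩ := h1
        exact ⟨n, List.mem_cons_of_mem _ hn, h1⟩
      simp only [trie, if_neg h0, if_pos h1, if_pos h2]
      simp [hX]
    · have hm : X ∉ ns := fun hm => h1 ⟨X, hm, X.suffix_refl⟩
      have h2 : (∃ n ∈ (d :: p) :: ns, X <:+ n) ↔ X <:+ p := by
        simp only [List.mem_cons, exists_eq_or_imp, h1, or_false, List.suffix_cons_iff, hX,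
          false_or]
      have h3 : X <:+ d :: p ↔ X <:+ p := by simp [List.suffix_cons_iff, hX]
      by_cases hp : X <:+ p
      · simp only [trie, if_neg h0, if_neg h1, if_pos (h2.2 hp), if_pos hp]
        simp [hX, hm]
      · simp only [trie, if_neg h0, if_neg h1, if_neg (mt h2.1 hp), if_neg hp]
        simp [h0]

theorem trie_of_suffix {ns : List TreeNode} {p : TreeNode} (h : ∃ n ∈ ns, p <:+ n) :
    trie ns p = trie ns [] := by
  funext X
  unfold trie
  by_cases h1 : ∃ n ∈ ns, X <:+ n
  · simp [h1]
  · have : ¬ X <:+ p := by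
      obtain ⟨n, hn, h⟩ := h
      exact fun h' => h1 ⟨n, hn, h'.trans h⟩
    by_cases h0 : X = [] <;> simp [h0, h1, this]

theorem trie_cons_of_mem_self {ns : List TreeNode} {n : TreeNode} (h : n ∈ ns) :
    trie (n :: ns) [] = trie ns [] := by
  have h1 : ∀ X, X ∈ n :: ns ↔ X ∈ ns := fun X => by
    rw [List.mem_cons]
    exact ⟨fun h' => h'.elim (fun e => e ▸ h) id, Or.inr⟩
  funext X
  simp only [trie, h1]

/-- The states of the automaton for the stored prefixes. In state `hold d`, the last letter read
has not been processed yet. -/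
inductive PrefixState : Type
  | start
  | hold (d : Side)
  | turn
  | climb
  | skip
  | query
  | accept

instance : Finite PrefixState :=
  Finite.of_surjective
    (fun i : Fin 8 => match i with
      | 0 => PrefixState.start
      | 1 => PrefixState.hold .l
      | 2 => PrefixState.hold .r
      | 3 => PrefixState.turn
      | 4 => PrefixState.climb
      | 5 => PrefixState.skip
      | 6 => PrefixState.query
      | 7 => PrefixState.accept)
    (fun s => by
      rcases s with _ | (_ | _)
      exacts [⟨0, rfl⟩, ⟨1, rfl⟩, ⟨2, rfl⟩, ⟨3, rfl⟩, ⟨4, rfl⟩, ⟨5, rfl⟩, ⟨6, rfl⟩, ⟨7, rfl⟩])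

/-- Move to the `d`-descendant, which is pushed if necessary; `e` tells whether it is the end of
a word. -/
def descend (d : Side) (t : NodeType) (e : Bool) : StorageOp (Bool × Bool) :=
  if t.has d = true then .down d else .push (t.kind.isNone, e) d

/-- The transitions on the way up: at depth one, the next block or the symbol `¢` is read. -/
def climbStep (first : Bool) : TapeSymbol WSym → NodeType →
    Option (PrefixState × StorageOp (Bool × Bool))
  -- Because of the delayed letter, the pointer reaches depth `|x|` only with the first dollar. The
  -- other `|x| - 1` dollars lead to depth one, so the move to the root has to be combined with
  -- reading the next symbol; the label mark for depth one makes this possible.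
  | .sym .a, t => if first = true ∧ t.kind ≠ none then some (.hold .l, .up) else none
  | .sym .b, t => if first = true ∧ t.kind ≠ none then some (.hold .r, .up) else none
  | .sym .cent, t => if first = true ∧ t.kind ≠ none then some (.skip, .up) else none
  | .sym .dollar, t => if first = false ∧ t.kind ≠ none then some (.climb, .up) else none
  | _, _ => none

/-- The reading transitions of the automaton for the stored prefixes; the node label is given as
the pair of its marks. -/
def prefixStep (m : Bool × Bool) : PrefixState → TapeSymbol WSym → NodeType →
    Option (PrefixState × StorageOp (Bool × Bool))
  | .start, .sym .a, _ => some (.hold .l, .stay)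
  | .start, .sym .b, _ => some (.hold .r, .stay)
  | .start, .sym .cent, _ => some (.skip, .stay)
  | .hold d, .sym .a, t => some (.hold .l, descend d t false)
  | .hold d, .sym .b, t => some (.hold .r, descend d t false)
  -- The delay by one letter exists for this transition: the first dollar reveals that the pending
  -- letter ends the word before its node is pushed, and later the label could no longer be changed.
  | .hold d, .sym .dollar, t => some (.turn, descend d t true)
  -- A word ending at a node with descendants is a proper prefix of an earlier word, hence the test
  -- for a leaf.
  | .turn, a, t => if t.hasLeft = false ∧ t.hasRight = false then climbStep m.1 a t else none
  | .climb, a, t => climbStep m.1 a t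
  | .skip, .sym .a, _ => some (.skip, .stay)
  | .skip, .sym .b, _ => some (.skip, .stay)
  | .skip, .sym .dollar, _ => some (.skip, .stay)
  | .skip, .sym .border₁, _ => some (.query, .stay)
  | .query, .sym .a, t => if t.hasLeft = true then some (.query, .down .l) else none
  | .query, .sym .b, t => if t.hasRight = true then some (.query, .down .r) else none
  -- The root carries no end mark; the empty word is always a valid answer, as it can be added to
  -- the list without changing the input.
  | .query, .endmarker, t => if t.kind = none ∨ m.2 = true then some (.accept, .stay) else none
  | _, _, _ => none

theorem descend_spec (d : Side) (t : NodeType) (e : Bool) :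
    (descend d t e).Admissible t ∧ descend d t e ≠ .pop := by
  unfold descend
  split_ifs with h
  · exact ⟨h, by simp⟩
  · exact ⟨by simpa [StorageOp.Admissible] using h, by simp⟩

theorem climbStep_spec {f : Bool} {q' : PrefixState} {a : TapeSymbol WSym} {t : NodeType}
    {op : StorageOp (Bool × Bool)} (h : climbStep f a t = some (q', op)) :
    op.Admissible t ∧ op ≠ .pop := by
  unfold climbStep at h
  split at h <;> first
    | (cases h)
    | (split_ifs at h with ht
       simp only [Option.some.injEq, Prod.mk.injEq] at h
       obtain ⟨-, rfl⟩ := h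
       exact ⟨ht.2, by simp⟩)

theorem prefixStep_spec {m : Bool × Bool} {q q' : PrefixState} {a : TapeSymbol WSym}
    {t : NodeType} {op : StorageOp (Bool × Bool)} (h : prefixStep m q a t = some (q', op)) :
    op.Admissible t ∧ op ≠ .pop := by
  unfold prefixStep at h
  split at h <;> first
    | (cases h; done)
    | exact climbStep_spec h
    | (simp only [Option.some.injEq, Prod.mk.injEq] at h
       obtain ⟨-, rfl⟩ := h
       first
         | exact ⟨trivial, by simp⟩
         | exact descend_spec _ _ _)
    | (split_ifs at h with ht
       first
         | exact climbStep_spec h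
         | (simp only [Option.some.injEq, Prod.mk.injEq] at h
            obtain ⟨-, rfl⟩ := h
            first
              | exact ⟨trivial, by simp⟩
              | exact ⟨ht, by simp⟩))

/-- The automaton for the stored prefixes. -/
def prefixAutomaton : TWSDA PrefixState WSym (Bool × Bool) where
  δ q a t x := a.bind fun a => prefixStep (x.unbotD (false, false)) q a t
  start := .start
  accepting := {.accept}
  no_choice q t x h := absurd rfl h
  well_defined q a t x q' op h := by
    rcases a with _ | a
    · cases h
    · exact (prefixStep_spec h).1

theorem prefixAutomaton_δ (q : PrefixState) (a : TapeSymbol WSym) (t : NodeType)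
    (x : WithBot (Bool × Bool)) :
    prefixAutomaton.δ q (some a) t x = prefixStep (x.unbotD (false, false)) q a t := rfl

theorem labelNodeType_has {Γ : Type} (T : TreeNode → Option (WithBot Γ)) (P : TreeNode)
    (d : Side) : (labelNodeType T P).has d = (T (d :: P)).isSome := by
  cases d <;> rfl

theorem descend_of_none {T : TreeNode → Option (WithBot (Bool × Bool))} {P : TreeNode}
    {d : Side} (h : T (d :: P) = none) (e : Bool) :
    descend d (labelNodeType T P) e = .push (decide (P = []), e) d := by
  have : ¬ (labelNodeType T P).has d = true := by simp [labelNodeType_has, h]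
  rw [descend, if_neg this]
  cases P <;> simp [labelNodeType]

theorem descend_of_ne_none {T : TreeNode → Option (WithBot (Bool × Bool))} {P : TreeNode}
    {d : Side} (h : T (d :: P) ≠ none) (e : Bool) :
    descend d (labelNodeType T P) e = .down d := by
  have : (labelNodeType T P).has d = true := by
    rw [labelNodeType_has, Option.isSome_iff_ne_none]
    exact h
  rw [descend, if_pos this]

theorem map_sym_cons_ne {d : Side} {u v : List WSym} {s : WSym}
    (hs : s ≠ WSym.a ∧ s ≠ WSym.b) : d.sym :: u ≠ s :: v := by
  rintro h
  cases d
  · exact hs.1 (List.cons.inj h).1.symm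
  · exact hs.2 (List.cons.inj h).1.symm

theorem WSym.letter_or (s : WSym) :
    (∃ d : Side, s = d.sym) ∨ (s ≠ WSym.a ∧ s ≠ WSym.b) := by
  cases s
  · exact Or.inl ⟨Side.l, rfl⟩
  · exact Or.inl ⟨Side.r, rfl⟩
  all_goals exact Or.inr ⟨by simp, by simp⟩

theorem prefixAutomaton_query (ns : List TreeNode) {P : TreeNode}
    (hP : P = [] ∨ ∃ n ∈ ns, P <:+ n) (w : List WSym) :
    prefixAutomaton.AcceptsFrom ⟨some .query, trie ns [], P⟩ w ↔
      ∃ y : List Side, (y.reverse ++ P = [] ∨ y.reverse ++ P ∈ ns) ∧ w = y.map Side.sym := by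
  induction w generalizing P with
  | nil =>
    have hx : trie ns [] P = some (if P = [] then (⊥ : WithBot (Bool × Bool))
        else ((decide (P.length = 1), decide (P ∈ ns)) : Bool × Bool)) := by
      unfold trie
      by_cases h0 : P = []
      · simp [h0]
      · simp [h0, hP.resolve_left h0]
    rw [TWSDA.acceptsFrom_nil_iff hx]
    by_cases h0 : P = []
    · subst h0
      exact iff_of_true ⟨.accept, rfl, .stay,
        by simp [prefixAutomaton_δ, prefixStep, labelNodeType]⟩ ⟨[], Or.inl rfl, rfl⟩
    · by_cases h1 : P ∈ ns <;>
        simp [h0, h1, prefixStep, labelNodeType, prefixAutomaton]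
  | cons s w ih =>
    obtain ⟨x, hx⟩ := exists_trie_eq_some (ns := ns) (p := []) (X := P)
      (hP.imp id Or.inl)
    rcases s.letter_or with ⟨d, rfl⟩ | hs
    · have hr : (∃ y : List Side, (y.reverse ++ P = [] ∨ y.reverse ++ P ∈ ns) ∧
          d.sym :: w = y.map Side.sym) ↔
          ∃ y : List Side, (y.reverse ++ d :: P = [] ∨ y.reverse ++ d :: P ∈ ns) ∧
            w = y.map Side.sym := by
        constructor
        · rintro ⟨_ | ⟨e, y⟩, hy, h⟩
          · simp at h
          · simp only [List.map_cons, List.cons.injEq] at h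
            obtain rfl := Side.sym_injective h.1
            exact ⟨y, by simpa using hy, h.2⟩
        · rintro ⟨y, hy, rfl⟩
          exact ⟨d :: y, by simpa using hy, rfl⟩
      rw [hr]
      by_cases hd : ∃ n ∈ ns, d :: P <:+ n
      · obtain ⟨x', hx'⟩ := exists_trie_eq_some (ns := ns) (p := []) (Or.inr (Or.inl hd))
        rw [TWSDA.acceptsFrom_cons_iff hx (q' := .query) (op := .down d) (by
          cases d <;> simp [prefixAutomaton_δ, Side.sym, prefixStep, labelNodeType, hx'])]
        exact ih (Or.inr hd)
      · have hn : trie ns [] (d :: P) = none :=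
          trie_eq_none_iff.2 ⟨by simp, by simpa using hd, by simp⟩
        refine iff_of_false (TWSDA.not_acceptsFrom_cons hx (by
          cases d <;> simp [prefixAutomaton_δ, Side.sym, prefixStep, labelNodeType, hn]) w) ?_
        rintro ⟨y, hy | hy, -⟩
        · simp at hy
        · exact hd ⟨_, hy, List.suffix_append _ _⟩
    · refine iff_of_false (TWSDA.not_acceptsFrom_cons hx ?_ w) ?_
      · cases s
        · exact absurd rfl hs.1
        · exact absurd rfl hs.2
        all_goals rfl
      · rintro ⟨_ | ⟨d, y⟩, -, h⟩
        · simp at h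
        · exact map_sym_cons_ne hs h.symm

theorem prefixAutomaton_skip (ns : List TreeNode) (w : List WSym) :
    prefixAutomaton.AcceptsFrom ⟨some .skip, trie ns [], []⟩ w ↔
      ∃ (z : List WSym) (y : List Side), z ∈ wordsABDollar ∧ (y = [] ∨ y.reverse ∈ ns) ∧
        w = z ++ WSym.border₁ :: y.map Side.sym := by
  induction w with
  | nil =>
    rw [TWSDA.acceptsFrom_nil_iff (x := ⊥) rfl]
    exact iff_of_false (by simp [prefixAutomaton_δ, prefixStep]) (by simp)
  | cons s w ih =>
    have stay : s = WSym.a ∨ s = WSym.b ∨ s = WSym.dollar →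
        (prefixAutomaton.AcceptsFrom ⟨some .skip, trie ns [], []⟩ (s :: w) ↔
          ∃ (z : List WSym) (y : List Side), z ∈ wordsABDollar ∧ (y = [] ∨ y.reverse ∈ ns) ∧
            s :: w = z ++ WSym.border₁ :: y.map Side.sym) := by
      intro hs
      rw [TWSDA.acceptsFrom_cons_iff (x := ⊥) rfl (q' := .skip) (op := .stay) (by
        rcases hs with rfl | rfl | rfl <;> rfl)]
      simp only [StorageOp.treeAfter, StorageOp.pointerAfter]
      rw [ih]
      constructor
      · rintro ⟨z, y, hz, hy, rfl⟩
        exact ⟨s :: z, y, cons_mem_wordsABDollar.2 ⟨hs, hz⟩, hy, rfl⟩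
      · rintro ⟨_ | ⟨t, z⟩, y, hz, hy, h⟩
        · rcases hs with rfl | rfl | rfl <;> simp at h
        · simp only [List.cons_append, List.cons.injEq] at h
          exact ⟨z, y, (cons_mem_wordsABDollar.1 hz).2, hy, h.2⟩
    cases s
    case a => exact stay (by simp)
    case b => exact stay (by simp)
    case dollar => exact stay (by simp)
    case border₁ =>
      rw [TWSDA.acceptsFrom_cons_iff (x := ⊥) rfl (q' := .query) (op := .stay) rfl]
      simp only [StorageOp.treeAfter, StorageOp.pointerAfter]
      rw [prefixAutomaton_query ns (Or.inl rfl)]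
      constructor
      · rintro ⟨y, hy, rfl⟩
        exact ⟨[], y, nil_mem_wordsABDollar, by simpa using hy, rfl⟩
      · rintro ⟨_ | ⟨t, z⟩, y, hz, hy, h⟩
        · exact ⟨y, by simpa using hy, by simpa using h⟩
        · simp only [List.cons_append, List.cons.injEq] at h
          have := (cons_mem_wordsABDollar.1 hz).1
          simp [← h.1] at this
    all_goals
      refine iff_of_false (TWSDA.not_acceptsFrom_cons (x := ⊥) rfl rfl w) ?_
      rintro ⟨_ | ⟨t, z⟩, y, hz, hy, h⟩
      · simp at h
      · simp only [List.cons_append, List.cons.injEq] at h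
        have := (cons_mem_wordsABDollar.1 hz).1
        simp [← h.1] at this

/-- At depth one the state `climb` reacts to each symbol as `start` does at the root, the move up
being hidden in that step. The remaining dollars therefore number one less than the depth of the
node. -/
theorem prefixAutomaton_climb (ns : List TreeNode) {d : Side} {P : TreeNode}
    (hP : ∃ n ∈ ns, d :: P <:+ n) (w : List WSym) :
    prefixAutomaton.AcceptsFrom ⟨some .climb, trie ns [], d :: P⟩ w ↔
      ∃ v, w = List.replicate P.length WSym.dollar ++ v ∧
        prefixAutomaton.AcceptsFrom ⟨some .start, trie ns [], []⟩ v := by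
  induction P generalizing d w with
  | nil =>
    have hx : trie ns [] [d] = some ((true, decide ([d] ∈ ns)) : Bool × Bool) := by
      simp only [trie, hP, if_true]
      simp
    simp only [List.length_nil, List.replicate_zero, List.nil_append, exists_eq_left']
    cases w with
    | nil =>
      rw [TWSDA.acceptsFrom_nil_iff hx, TWSDA.acceptsFrom_nil_iff (x := ⊥) rfl]
      simp [prefixAutomaton_δ, prefixStep, climbStep]
    | cons s w =>
      have both : ∀ q' : PrefixState, (s = WSym.a ∧ q' = .hold .l ∨ s = WSym.b ∧ q' = .hold .r ∨
          s = WSym.cent ∧ q' = .skip) →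
          (prefixAutomaton.AcceptsFrom ⟨some .climb, trie ns [], [d]⟩ (s :: w) ↔
            prefixAutomaton.AcceptsFrom ⟨some .start, trie ns [], []⟩ (s :: w)) := by
        intro q' hq
        rw [TWSDA.acceptsFrom_cons_iff hx (q' := q') (op := .up), TWSDA.acceptsFrom_cons_iff
          (x := ⊥) rfl (q' := q') (op := .stay)]
        · rfl
        all_goals
          rcases hq with ⟨rfl, rfl⟩ | ⟨rfl, rfl⟩ | ⟨rfl, rfl⟩ <;>
            simp [prefixAutomaton_δ, prefixStep, climbStep, labelNodeType]
      cases s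
      case a => exact both _ (Or.inl ⟨rfl, rfl⟩)
      case b => exact both _ (Or.inr (Or.inl ⟨rfl, rfl⟩))
      case cent => exact both _ (Or.inr (Or.inr ⟨rfl, rfl⟩))
      all_goals
        refine iff_of_false (TWSDA.not_acceptsFrom_cons hx ?_ w)
          (TWSDA.not_acceptsFrom_cons (x := ⊥) rfl rfl w)
        simp [prefixAutomaton_δ, prefixStep, climbStep]
  | cons e P ih =>
    have hP' : ∃ n ∈ ns, e :: P <:+ n := by
      obtain ⟨n, hn, h⟩ := hP
      exact ⟨n, hn, (List.suffix_cons _ _).trans h⟩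
    have hx : trie ns [] (d :: e :: P) =
        some ((false, decide (d :: e :: P ∈ ns)) : Bool × Bool) := by
      simp only [trie, hP, if_true]
      simp
    cases w with
    | nil =>
      rw [TWSDA.acceptsFrom_nil_iff hx]
      simp [prefixAutomaton_δ, prefixStep, climbStep]
    | cons s w =>
      by_cases hs : s = WSym.dollar
      · subst hs
        rw [TWSDA.acceptsFrom_cons_iff hx (q' := .climb) (op := .up) (by
          simp [prefixAutomaton_δ, prefixStep, climbStep, labelNodeType])]
        refine (ih hP' w).trans ?_
        simp [List.replicate_succ]
      · refine iff_of_false (TWSDA.not_acceptsFrom_cons hx ?_ w) ?_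
        · cases s <;> first
            | exact absurd rfl hs
            | simp [prefixAutomaton_δ, prefixStep, climbStep]
        · rintro ⟨v, h, -⟩
          simp only [List.length_cons, List.replicate_succ, List.cons_append,
            List.cons.injEq] at h
          exact hs h.1

theorem prefixAutomaton_turn {T : TreeNode → Option (WithBot (Bool × Bool))} {P : TreeNode}
    {x : WithBot (Bool × Bool)} (hx : T P = some x) (h : ∀ d : Side, T (d :: P) = none)
    (w : List WSym) :
    prefixAutomaton.AcceptsFrom ⟨some .turn, T, P⟩ w ↔
      prefixAutomaton.AcceptsFrom ⟨some .climb, T, P⟩ w := by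
  have key : ∀ a, prefixAutomaton.δ .turn (some a) (labelNodeType T P) x =
      prefixAutomaton.δ .climb (some a) (labelNodeType T P) x := by
    intro a
    simp [prefixAutomaton_δ, prefixStep, labelNodeType, h]
  cases w with
  | nil => rw [TWSDA.acceptsFrom_nil_iff hx, TWSDA.acceptsFrom_nil_iff hx, key]
  | cons s w =>
    rcases hd : prefixAutomaton.δ .climb (some (.sym s)) (labelNodeType T P) x with _ | ⟨q, op⟩
    · exact iff_of_false (TWSDA.not_acceptsFrom_cons hx ((key _).trans hd) w)
        (TWSDA.not_acceptsFrom_cons hx hd w)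
    · rw [TWSDA.acceptsFrom_cons_iff hx ((key _).trans hd), TWSDA.acceptsFrom_cons_iff hx hd]

theorem not_prefixAutomaton_turn {T : TreeNode → Option (WithBot (Bool × Bool))} {P : TreeNode}
    {x : WithBot (Bool × Bool)} (hx : T P = some x) {d : Side} (h : T (d :: P) ≠ none)
    (w : List WSym) : ¬ prefixAutomaton.AcceptsFrom ⟨some .turn, T, P⟩ w := by
  have key : ∀ a, prefixAutomaton.δ .turn (some a) (labelNodeType T P) x = none := by
    intro a
    obtain ⟨y, hy⟩ := Option.ne_none_iff_exists'.1 h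
    cases d <;> simp [prefixAutomaton_δ, prefixStep, labelNodeType, hy]
  cases w with
  | nil => simp [TWSDA.acceptsFrom_nil_iff hx, key]
  | cons s w => exact TWSDA.not_acceptsFrom_cons hx (key _) w

/-- `n` is a proper ancestor of none of the given nodes. -/
def NotProperAncestor (n : TreeNode) (ns : List TreeNode) : Prop :=
  ∀ m ∈ ns, n <:+ m → n = m

/-- There are three cases. A new node is pushed with its end mark and is a leaf. An old leaf is
already the end of a stored word, so nothing has to be marked. An old inner node means that the word
is a proper prefix of a stored one, and the automaton rejects. -/
theorem prefixAutomaton_hold_dollar (ns : List TreeNode) (d : Side) (p : TreeNode)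
    (w : List WSym) :
    prefixAutomaton.AcceptsFrom ⟨some .turn,
        (descend d (labelNodeType (trie ns p) p) true).treeAfter (trie ns p) p,
        (descend d (labelNodeType (trie ns p) p) true).pointerAfter p⟩ w ↔
      NotProperAncestor (d :: p) ns ∧ ∃ v, w = List.replicate p.length WSym.dollar ++ v ∧
        prefixAutomaton.AcceptsFrom ⟨some .start, trie ((d :: p) :: ns) [], []⟩ v := by
  by_cases h : trie ns p (d :: p) = none
  · rw [descend_of_none h]
    simp only [StorageOp.treeAfter, StorageOp.pointerAfter]
    rw [update_trie_end]
    have h' := trie_eq_none_iff.1 h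
    have hn : NotProperAncestor (d :: p) ns := fun m hm hs => absurd hs (h'.2.1 m hm)
    have hself : ∃ n ∈ (d :: p) :: ns, d :: p <:+ n :=
      ⟨_, List.mem_cons_self, List.suffix_refl _⟩
    obtain ⟨x, hx⟩ := exists_trie_eq_some (p := []) (Or.inr (Or.inl hself))
    rw [prefixAutomaton_turn hx, prefixAutomaton_climb _ hself]
    · simp [hn]
    · intro e
      refine trie_eq_none_iff.2 ⟨by simp, ?_, by simp⟩
      intro m hm hs
      rcases List.mem_cons.1 hm with rfl | hm
      · exact not_cons_suffix_self _ _ hs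
      · exact h'.2.1 m hm ((List.suffix_cons _ _).trans hs)
  · rw [descend_of_ne_none h]
    simp only [StorageOp.treeAfter, StorageOp.pointerAfter]
    have hm : ∃ n ∈ ns, d :: p <:+ n := by
      by_contra hm
      exact h (trie_eq_none_iff.2 ⟨by simp, by simpa using hm, not_cons_suffix_self d p⟩)
    have hp : ∃ n ∈ ns, p <:+ n := by
      obtain ⟨n, hn, hs⟩ := hm
      exact ⟨n, hn, (List.suffix_cons _ _).trans hs⟩
    rw [trie_of_suffix hp]
    obtain ⟨x, hx⟩ := exists_trie_eq_some (p := []) (Or.inr (Or.inl hm))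
    by_cases hl : ∀ e : Side, trie ns [] (e :: d :: p) = none
    · have hn : NotProperAncestor (d :: p) ns := by
        rintro m hm ⟨u, rfl⟩
        rcases List.eq_nil_or_concat' u with rfl | ⟨u, e, rfl⟩
        · rfl
        · exact absurd (by simp) ((trie_eq_none_iff.1 (hl e)).2.1 _ hm)
      have hmem : d :: p ∈ ns := by
        obtain ⟨m, hm, hs⟩ := hm
        rwa [hn m hm hs]
      rw [prefixAutomaton_turn hx hl, prefixAutomaton_climb _ hm, trie_cons_of_mem_self hmem]
      simp [hn]
    · push Not at hl
      obtain ⟨e, he⟩ := hl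
      refine iff_of_false (not_prefixAutomaton_turn hx he w) ?_
      rintro ⟨hn, -⟩
      refine he (trie_eq_none_iff.2 ⟨by simp, fun m hm hs => ?_, by simp⟩)
      have := hn m hm ((List.suffix_cons _ _).trans hs)
      rw [← this] at hs
      exact not_cons_suffix_self _ _ hs

/-- The word of the current block is `p` reversed, then the pending letter `d`, then `x`. The number
of dollars is its total length, which stays the same when a letter passes from `x` into the path. -/
theorem prefixAutomaton_hold (ns : List TreeNode) (d : Side) (p : TreeNode) (w : List WSym) :
    prefixAutomaton.AcceptsFrom ⟨some (.hold d), trie ns p, p⟩ w ↔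
      ∃ (x : List Side) (v : List WSym), NotProperAncestor (x.reverse ++ d :: p) ns ∧
        w = x.map Side.sym ++ (List.replicate (x.length + p.length + 1) WSym.dollar ++ v) ∧
        prefixAutomaton.AcceptsFrom
          ⟨some .start, trie ((x.reverse ++ d :: p) :: ns) [], []⟩ v := by
  obtain ⟨y, hy⟩ := exists_trie_eq_some (ns := ns) (p := p)
    (Or.inr (Or.inr p.suffix_refl))
  induction w generalizing d p y with
  | nil =>
    rw [TWSDA.acceptsFrom_nil_iff hy]
    refine iff_of_false (by simp [prefixAutomaton_δ, prefixStep]) ?_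
    rintro ⟨x, v, -, h, -⟩
    simp [List.replicate_succ] at h
  | cons s w ih =>
    rcases s.letter_or with ⟨e, rfl⟩ | hs
    · rw [TWSDA.acceptsFrom_cons_iff hy (q' := .hold e)
        (op := descend d (labelNodeType (trie ns p) p) false) (by cases e <;> rfl)]
      have hT : (descend d (labelNodeType (trie ns p) p) false).treeAfter (trie ns p) p =
          trie ns (d :: p) ∧
          (descend d (labelNodeType (trie ns p) p) false).pointerAfter p = d :: p := by
        by_cases h : trie ns p (d :: p) = none
        · rw [descend_of_none h]
          exact ⟨update_trie h, rfl⟩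
        · rw [descend_of_ne_none h]
          refine ⟨(trie_cons_of_mem ?_).symm, rfl⟩
          by_contra hm
          exact h (trie_eq_none_iff.2 ⟨by simp, by simpa using hm, not_cons_suffix_self d p⟩)
      rw [hT.1, hT.2]
      obtain ⟨y', hy'⟩ := exists_trie_eq_some (ns := ns) (p := d :: p)
        (Or.inr (Or.inr (d :: p).suffix_refl))
      rw [ih e (d :: p) y' hy']
      constructor
      · rintro ⟨x, v, h1, rfl, h3⟩
        exact ⟨e :: x, v, by simpa using h1, by simp [add_right_comm, add_assoc],
          by simpa using h3⟩
      · rintro ⟨_ | ⟨e', x⟩, v, h1, h2, h3⟩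
        · rw [List.map_nil, List.nil_append, List.replicate_succ] at h2
          exact absurd h2 (map_sym_cons_ne (by simp))
        · simp only [List.map_cons, List.cons_append, List.cons.injEq] at h2
          obtain rfl := Side.sym_injective h2.1
          exact ⟨x, v, by simpa using h1, by simpa [add_right_comm, add_assoc] using h2.2,
            by simpa using h3⟩
    · by_cases hd : s = WSym.dollar
      · subst hd
        rw [TWSDA.acceptsFrom_cons_iff hy (q' := .turn)
          (op := descend d (labelNodeType (trie ns p) p) true) rfl,
          prefixAutomaton_hold_dollar]
        constructor
        · rintro ⟨h1, v, rfl, h3⟩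
          exact ⟨[], v, h1, by simp [List.replicate_succ], h3⟩
        · rintro ⟨_ | ⟨e', x⟩, v, h1, h2, h3⟩
          · exact ⟨h1, v, by simpa [List.replicate_succ] using h2, h3⟩
          · exact absurd h2.symm (map_sym_cons_ne hs)
      · refine iff_of_false (TWSDA.not_acceptsFrom_cons hy ?_ w) ?_
        · cases s <;> first
            | exact absurd rfl hs.1
            | exact absurd rfl hs.2
            | exact absurd rfl hd
            | rfl
        · rintro ⟨_ | ⟨e', x⟩, v, h1, h2, h3⟩
          · rw [List.map_nil, List.nil_append, List.replicate_succ, List.cons_append,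
              List.cons.injEq] at h2
            exact hd h2.1
          · exact absurd h2.symm (map_sym_cons_ne hs)

/-! ### From runs on blocks to the words of `hatLp` -/

/-- The words `xs` are non-empty, and none of them is a proper prefix of a preceding one or of
a word stored at `ns`. -/
def Appendable : List TreeNode → List (List Side) → Prop
  | _, [] => True
  | ns, x :: xs => x ≠ [] ∧ NotProperAncestor x.reverse ns ∧ Appendable (x.reverse :: ns) xs

theorem appendable_iff (ns : List TreeNode) (xs : List (List Side)) :
    Appendable ns xs ↔ (∀ x ∈ xs, x ≠ []) ∧ (∀ x ∈ xs, NotProperAncestor x.reverse ns) ∧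
      xs.Pairwise (fun x y => y <+: x → y = x) := by
  induction xs generalizing ns with
  | nil => simp [Appendable]
  | cons x xs ih =>
    rw [Appendable, ih]
    simp only [List.mem_cons, forall_eq_or_imp, List.pairwise_cons]
    have : ∀ y, NotProperAncestor y.reverse (x.reverse :: ns) ↔
        (y <+: x → y = x) ∧ NotProperAncestor y.reverse ns := by
      intro y
      simp [NotProperAncestor]
    simp only [this, forall_and]
    tauto

/-- The encoding of a list of words. -/
def blocks (xs : List (List Side)) : List WSym :=
  xs.flatMap fun x => x.map Side.sym ++ List.replicate x.length WSym.dollar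

/-- A whole block is consumed at once, so the induction runs over a bound `n` for the length of the
input. -/
theorem prefixAutomaton_start (n : ℕ) (ns : List TreeNode) (w : List WSym) (hw : w.length ≤ n) :
    prefixAutomaton.AcceptsFrom ⟨some .start, trie ns [], []⟩ w ↔
      ∃ (xs : List (List Side)) (z : List WSym) (y : List Side), Appendable ns xs ∧
        z ∈ wordsABDollar ∧ (y = [] ∨ y.reverse ∈ ns ∨ y ∈ xs) ∧
        w = blocks xs ++ WSym.cent :: (z ++ WSym.border₁ :: y.map Side.sym) := by
  induction n generalizing ns w with
  | zero =>
    obtain rfl : w = [] := by simpa using hw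
    rw [TWSDA.acceptsFrom_nil_iff (x := ⊥) rfl]
    exact iff_of_false (by simp [prefixAutomaton_δ, prefixStep]) (by simp)
  | succ n ih =>
    cases w with
    | nil =>
      rw [TWSDA.acceptsFrom_nil_iff (x := ⊥) rfl]
      exact iff_of_false (by simp [prefixAutomaton_δ, prefixStep]) (by simp)
    | cons s w =>
      simp only [List.length_cons, Nat.add_le_add_iff_right] at hw
      rcases s.letter_or with ⟨d, rfl⟩ | hs
      · rw [TWSDA.acceptsFrom_cons_iff (x := ⊥) rfl (q' := .hold d) (op := .stay)
          (by cases d <;> rfl)]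
        simp only [StorageOp.treeAfter, StorageOp.pointerAfter]
        rw [prefixAutomaton_hold]
        constructor
        · rintro ⟨x, v, h1, rfl, h3⟩
          rw [ih _ _ (by simp at hw; omega)] at h3
          obtain ⟨xs, z, y, g1, g2, g3, rfl⟩ := h3
          refine ⟨(d :: x) :: xs, z, y, ⟨by simp, by simpa using h1, by simpa using g1⟩, g2,
            ?_, by simp [blocks]⟩
          rcases g3 with g3 | g3 | g3
          · exact Or.inl g3
          · rcases List.mem_cons.1 g3 with g3 | g3
            · refine Or.inr (Or.inr (List.mem_cons.2 (Or.inl ?_)))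
              rw [← List.reverse_inj, g3]
              simp
            · exact Or.inr (Or.inl g3)
          · exact Or.inr (Or.inr (List.mem_cons_of_mem _ g3))
        · rintro ⟨_ | ⟨_ | ⟨d', x⟩, xs⟩, z, y, g1, g2, g3, h⟩
          · exact absurd h (map_sym_cons_ne (by simp))
          · exact absurd rfl g1.1
          · simp only [blocks, List.flatMap_cons, List.map_cons, List.cons_append,
              List.append_assoc, List.cons.injEq] at h
            obtain ⟨h0, h⟩ := h
            obtain rfl := Side.sym_injective h0
            have h1 := g1.2.1
            have h2 := g1.2.2
            simp only [List.reverse_cons] at h1 h2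
            refine ⟨x, _, h1, by simpa using h, ?_⟩
            rw [ih]
            · refine ⟨xs, z, y, h2, g2, ?_, rfl⟩
              rcases g3 with g3 | g3 | g3
              · exact Or.inl g3
              · exact Or.inr (Or.inl (List.mem_cons_of_mem _ g3))
              · rcases List.mem_cons.1 g3 with g3 | g3
                · exact Or.inr (Or.inl (by simp [g3]))
                · exact Or.inr (Or.inr g3)
            · rw [h] at hw
              simp at hw ⊢
              omega
      · by_cases hc : s = WSym.cent
        · subst hc
          rw [TWSDA.acceptsFrom_cons_iff (x := ⊥) rfl (q' := .skip) (op := .stay) rfl]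
          simp only [StorageOp.treeAfter, StorageOp.pointerAfter]
          rw [prefixAutomaton_skip]
          constructor
          · rintro ⟨z, y, hz, hy, rfl⟩
            exact ⟨[], z, y, trivial, hz, by simpa using hy, rfl⟩
          · rintro ⟨_ | ⟨_ | ⟨d', x⟩, xs⟩, z, y, g1, g2, g3, h⟩
            · exact ⟨z, y, g2, by simpa using g3, by simpa [blocks] using h⟩
            · exact absurd rfl g1.1
            · exact absurd h.symm (map_sym_cons_ne hs)
        · refine iff_of_false (TWSDA.not_acceptsFrom_cons (x := ⊥) rfl ?_ w) ?_
          · cases s <;> first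
              | exact absurd rfl hs.1
              | exact absurd rfl hs.2
              | exact absurd rfl hc
              | rfl
          · rintro ⟨_ | ⟨_ | ⟨d', x⟩, xs⟩, z, y, g1, g2, g3, h⟩
            · exact hc (List.cons.inj h).1
            · exact absurd rfl g1.1
            · exact absurd h.symm (map_sym_cons_ne hs)

theorem exists_map_sym {xs : List (List WSym)} (h : ∀ x ∈ xs, x ∈ wordsAB) :
    ∃ us : List (List Side), xs = us.map (List.map Side.sym) := by
  induction xs with
  | nil => exact ⟨[], rfl⟩
  | cons x xs ih =>
    obtain ⟨us, rfl⟩ := ih fun y hy => h y (List.mem_cons_of_mem _ hy)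
    obtain ⟨u, rfl⟩ := (mem_wordsAB_iff x).1 (h _ List.mem_cons_self)
    exact ⟨u :: us, rfl⟩

theorem map_sym_injective : Function.Injective (List.map Side.sym) :=
  List.map_injective_iff.2 Side.sym_injective

theorem map_sym_prefix_iff {u v : List Side} :
    u.map Side.sym <+: v.map Side.sym ↔ u <+: v := by
  constructor
  · rintro ⟨t, ht⟩
    obtain ⟨v1, v2, rfl, h1, -⟩ := List.map_eq_append_iff.1 ht.symm
    rw [map_sym_injective h1]
    exact List.prefix_append _ _
  · rintro ⟨t, rfl⟩
    simp

/-- The words of `hatLp`, with all `xᵢ` non-empty. -/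
theorem mem_hatLp_iff (w : List WSym) : w ∈ hatLp ↔
    ∃ (xs : List (List Side)) (z : List WSym) (y : List Side), (∀ x ∈ xs, x ≠ []) ∧
      xs.Pairwise (fun x y => y <+: x → y = x) ∧ z ∈ wordsABDollar ∧ (y = [] ∨ y ∈ xs) ∧
      w = blocks xs ++ WSym.cent :: (z ++ WSym.border₁ :: y.map Side.sym) := by
  have hpw : ∀ us : List (List Side), (us.map (List.map Side.sym)).Pairwise
      (fun xj xi => ¬ (xi <+: xj ∧ xi ≠ xj)) ↔ us.Pairwise (fun x y => y <+: x → y = x) := by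
    intro us
    rw [List.pairwise_map]
    simp [map_sym_prefix_iff, map_sym_injective.eq_iff]
  have hbl : ∀ us : List (List Side), (us.map (List.map Side.sym)).flatMap
      (fun x => x ++ List.replicate x.length WSym.dollar) = blocks us := by
    intro us
    simp [blocks, List.flatMap_map]
  constructor
  · rintro ⟨xs, z, y, h1, h2, h3, h4, rfl⟩
    obtain ⟨us, rfl⟩ := exists_map_sym h1
    obtain ⟨y, hy, rfl⟩ := List.mem_map.1 h4
    rw [hpw] at h3
    -- Empty words contribute neither letters nor dollars and can be dropped from the list.
    refine ⟨us.filter (· ≠ []), z, y, by simp, h3.filter _, h2, ?_, ?_⟩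
    · by_cases h : y = []
      · exact Or.inl h
      · exact Or.inr (by simp [h, hy])
    · rw [hbl]
      have : blocks (us.filter (· ≠ [])) = blocks us := by
        clear h1 h3 h4 hy hpw hbl
        induction us with
        | nil => rfl
        | cons u us ih =>
          by_cases hu : u = []
          · simpa [hu, blocks] using ih
          · simpa [hu, blocks] using ih
      rw [this]
      simp
  · rintro ⟨us, z, y, h1, h2, h3, h4, rfl⟩
    have hmem : ∀ vs : List (List Side), ∀ x ∈ vs.map (List.map Side.sym), x ∈ wordsAB := by
      intro vs x hx
      obtain ⟨v, -, rfl⟩ := List.mem_map.1 hx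
      exact (mem_wordsAB_iff _).2 ⟨v, rfl⟩
    -- Conversely an empty word may be put in front to justify `y = []`: in first position it has
    -- only itself as a prefix, so the prefix condition survives.
    refine ⟨([] :: us).map (List.map Side.sym), z, y.map Side.sym, hmem _, h3, ?_, ?_, ?_⟩
    · rw [hpw]
      exact List.pairwise_cons.2 ⟨fun v _ hv => List.prefix_nil.1 hv, h2⟩
    · refine List.mem_map.2 ⟨y, ?_, rfl⟩
      rcases h4 with rfl | h4
      · exact List.mem_cons_self
      · exact List.mem_cons_of_mem _ h4
    · rw [hbl]
      simp [blocks]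

theorem hatLp_mem_rtTWSDNEA : hatLp ∈ rtTWSDNEA WSym := by
  refine ⟨PrefixState, Bool × Bool, inferInstance, inferInstance, prefixAutomaton, ?_,
    fun _ _ _ => rfl, ?_⟩
  · rintro q (_ | a) t x q' h
    · cases h
    · exact (prefixStep_spec h).2 rfl
  · ext w
    rw [TWSDA.mem_language_iff_acceptsFrom (fun _ _ _ => rfl), mem_hatLp_iff]
    have : (Snapshot.initial (some prefixAutomaton.start) :
        Snapshot (Option PrefixState) (Bool × Bool)) = ⟨some .start, trie [] [], []⟩ := by
      refine Snapshot.ext rfl (funext fun X => ?_) rfl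
      cases X <;> simp [Snapshot.initial, StorageTree.initial, trie]
    rw [this, prefixAutomaton_start _ _ _ le_rfl]
    simp [appendable_iff, NotProperAncestor, and_assoc]

/-! ## Locality of the storage operations -/

theorem append_drop_eq_iff (R P : TreeNode) (j : ℕ) : R ++ P.drop j = P ↔ R = P.take j := by
  constructor
  · intro h
    have h2 : R ++ P.drop j = P.take j ++ P.drop j := by rw [h, List.take_append_drop]
    exact List.append_cancel_right h2
  · rintro rfl
    exact List.take_append_drop j P

namespace StorageOp

variable {Γ : Type}

/-- An operation started outside of the subtree at `u`. -/
theorem tree_eq_of_outside (op : StorageOp Γ) (T : TreeNode → Option (WithBot Γ))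
    {P u : TreeNode} (hP : ¬ u <:+ P) :
    (¬ u <:+ op.pointerAfter P → ∀ R, op.treeAfter T P (R ++ u) = T (R ++ u)) ∧
    (u <:+ op.pointerAfter P → op.pointerAfter P = u ∧
      ∀ R ≠ [], op.treeAfter T P (R ++ u) = T (R ++ u)) := by
  have tail : ¬ u <:+ P.tail := fun h => hP (h.trans (List.tail_suffix P))
  have enter : ∀ d : Side, u <:+ d :: P → d :: P = u := fun d h =>
    ((List.suffix_cons_iff.1 h).resolve_right hP).symm
  cases op with
  | up => exact ⟨fun _ _ => rfl, fun h => absurd h tail⟩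
  | stay => exact ⟨fun _ _ => rfl, fun h => absurd h hP⟩
  | down d => exact ⟨fun _ _ => rfl, fun h => ⟨enter d h, fun _ _ => rfl⟩⟩
  | pop =>
    refine ⟨fun _ R => Function.update_of_ne ?_ _ _, fun h => absurd h tail⟩
    rintro rfl
    exact hP (List.suffix_append _ _)
  | push x d =>
    refine ⟨fun h R => Function.update_of_ne ?_ _ _,
      fun h => ⟨enter d h, fun R hR => Function.update_of_ne ?_ _ _⟩⟩
    · intro e
      apply h
      change u <:+ d :: P
      rw [← e]
      exact List.suffix_append _ _
    · rw [enter d h]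
      intro e
      exact hR (List.append_left_eq_self.1 e)

/-- An operation started within the subtree at `u`. -/
theorem tree_eq_of_inside (op : StorageOp Γ) (T : TreeNode → Option (WithBot Γ))
    {P u : TreeNode} (hP : u <:+ P) :
    (∀ X, ¬ u <:+ X → op.treeAfter T P X = T X) ∧
    (¬ u <:+ op.pointerAfter P → P = u ∧ op.pointerAfter P = u.tail) := by
  have leave : ¬ u <:+ P.tail → P = u := by
    intro h
    cases P with
    | nil => exact (List.suffix_nil.1 hP).symm
    | cons d P => exact ((List.suffix_cons_iff.1 hP).resolve_right h).symm
  have ne : ∀ X Y, u <:+ Y → ¬ u <:+ X → X ≠ Y := by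
    rintro X _ h1 h2 rfl
    exact h2 h1
  have child : ∀ d : Side, u <:+ d :: P := fun d => hP.trans (List.suffix_cons d P)
  cases op with
  | up => exact ⟨fun _ _ => rfl, fun h => ⟨leave h, by rw [leave h]; rfl⟩⟩
  | stay => exact ⟨fun _ _ => rfl, fun h => absurd hP h⟩
  | down d => exact ⟨fun _ _ => rfl, fun h => absurd (child d) h⟩
  | pop => exact ⟨fun X hX => Function.update_of_ne (ne X P hP hX) _ _,
      fun h => ⟨leave h, by rw [leave h]; rfl⟩⟩
  | push x d => exact ⟨fun X hX => Function.update_of_ne (ne X _ (child d) hX) _ _,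
      fun h => absurd (child d) h⟩

/-- The effect of an operation within a subtree. -/
theorem inside_congr (op : StorageOp Γ) {T₁ T₂ : TreeNode → Option (WithBot Γ)}
    {ρ u₁ u₂ : TreeNode} (h₁ : u₁ ≠ []) (h₂ : u₂ ≠ [])
    (hT : ∀ R, T₁ (R ++ u₁) = T₂ (R ++ u₂)) :
    (∀ R, op.treeAfter T₁ (ρ ++ u₁) (R ++ u₁) = op.treeAfter T₂ (ρ ++ u₂) (R ++ u₂)) ∧
    ((∃ ρ', op.pointerAfter (ρ ++ u₁) = ρ' ++ u₁ ∧ op.pointerAfter (ρ ++ u₂) = ρ' ++ u₂) ∨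
      (¬ u₁ <:+ op.pointerAfter (ρ ++ u₁) ∧ ¬ u₂ <:+ op.pointerAfter (ρ ++ u₂))) := by
  have upd : ∀ (τ : TreeNode) (y : Option (WithBot Γ)) (R : TreeNode),
      Function.update T₁ (τ ++ u₁) y (R ++ u₁) = Function.update T₂ (τ ++ u₂) y (R ++ u₂) := by
    intro τ y R
    by_cases h : R = τ
    · simp [h]
    · rw [Function.update_of_ne, Function.update_of_ne, hT]
      · exact fun h' => h (List.append_cancel_right h')
      · exact fun h' => h (List.append_cancel_right h')
  have not_tail : ∀ u : TreeNode, u ≠ [] → ¬ u <:+ u.tail := by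
    intro u hu h
    cases u with
    | nil => exact hu rfl
    | cons d u => exact not_cons_suffix_self d u h
  have tail : (∃ ρ', (ρ ++ u₁).tail = ρ' ++ u₁ ∧ (ρ ++ u₂).tail = ρ' ++ u₂) ∨
      (¬ u₁ <:+ (ρ ++ u₁).tail ∧ ¬ u₂ <:+ (ρ ++ u₂).tail) := by
    cases ρ with
    | nil => exact Or.inr ⟨not_tail u₁ h₁, not_tail u₂ h₂⟩
    | cons d ρ => exact Or.inl ⟨ρ, rfl, rfl⟩
  cases op with
  | up => exact ⟨hT, tail⟩
  | stay => exact ⟨hT, Or.inl ⟨ρ, rfl, rfl⟩⟩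
  | down d => exact ⟨hT, Or.inl ⟨d :: ρ, rfl, rfl⟩⟩
  | pop => exact ⟨upd ρ none, tail⟩
  | push x d => exact ⟨upd (d :: ρ) _, Or.inl ⟨d :: ρ, rfl, rfl⟩⟩

/-- The effect of an operation outside of a subtree. -/
theorem outside_congr (op : StorageOp Γ) {T₁ T₂ : TreeNode → Option (WithBot Γ)}
    {P u : TreeNode} (hT : ∀ X, ¬ u <:+ X → T₁ X = T₂ X)
    (hu : (T₁ u).isSome = (T₂ u).isSome) :
    (∀ X, ¬ u <:+ X → op.treeAfter T₁ P X = op.treeAfter T₂ P X) ∧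
    (op.treeAfter T₁ P u).isSome = (op.treeAfter T₂ P u).isSome := by
  have upd : ∀ (Y : TreeNode) (y : Option (WithBot Γ)),
      (∀ X, ¬ u <:+ X → Function.update T₁ Y y X = Function.update T₂ Y y X) ∧
      (Function.update T₁ Y y u).isSome = (Function.update T₂ Y y u).isSome := by
    intro Y y
    constructor
    · intro X hX
      by_cases h : X = Y
      · simp [h]
      · simp [h, hT X hX]
    · by_cases h : u = Y
      · simp [h]
      · simp [h, hu]
  cases op with
  | up => exact ⟨hT, hu⟩
  | stay => exact ⟨hT, hu⟩
  | down d => exact ⟨hT, hu⟩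
  | pop => exact upd _ _
  | push x d => exact upd _ _

end StorageOp

namespace Snapshot

variable {Q σ Γ : Type}

/-- The transition performed on the next symbol. -/
def move (F : StepRule Q σ Γ) (c : Snapshot Q Γ) (a : TapeSymbol σ) : Q × StorageOp Γ :=
  F c.state a (labelNodeType c.tree c.pointer) (c.tree c.pointer)

theorem step_eq (F : StepRule Q σ Γ) (c : Snapshot Q Γ) (a : TapeSymbol σ) :
    step F c a = ⟨(move F c a).1, (move F c a).2.treeAfter c.tree c.pointer,
      (move F c a).2.pointerAfter c.pointer⟩ := rfl

/-- The snapshots during the work on an infinite input. -/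
def trajectory (F : StepRule Q σ Γ) (c : Snapshot Q Γ) (w : ℕ → TapeSymbol σ) :
    ℕ → Snapshot Q Γ
  | 0 => c
  | t + 1 => step F (trajectory F c w t) (w t)

theorem run_take_eq_trajectory (F : StepRule Q σ Γ) (c : Snapshot Q Γ)
    (w : List (TapeSymbol σ)) {t : ℕ} (ht : t ≤ w.length) :
    run F c (w.take t) = trajectory F c (fun i => w.getD i .endmarker) t := by
  induction t with
  | zero => rfl
  | succ t ih =>
    have h : t < w.length := ht
    rw [List.take_succ_eq_append_getElem h, run_append, ih h.le]
    simp [trajectory, h]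

/-! ### Information crossing an edge of the tree -/

open Classical in
/-- The information crossing the edge from `u` to its parent in the step from `c` to `c'`: the new
state and the new label of `u`. -/
def crossing (u : TreeNode) (c c' : Snapshot Q Γ) : Option (Q × Option (WithBot Γ)) :=
  -- The label of `u` is needed in both directions: a push may create `u` on entering its subtree,
  -- and a pop may delete it on leaving.
  if (u <:+ c.pointer) ↔ (u <:+ c'.pointer) then none else some (c'.state, c'.tree u)

theorem crossing_eq_none_iff {u : TreeNode} {c c' : Snapshot Q Γ} :
    crossing u c c' = none ↔ ((u <:+ c.pointer) ↔ (u <:+ c'.pointer)) := by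
  unfold crossing
  split_ifs with h
  · simp [h]
  · simp [h]

theorem crossing_eq_some {u : TreeNode} {c c' : Snapshot Q Γ}
    (h : ¬ ((u <:+ c.pointer) ↔ (u <:+ c'.pointer))) :
    crossing u c c' = some (c'.state, c'.tree u) := if_neg h

theorem side_congr {u₁ u₂ : TreeNode} {c₁ c₁' c₂ c₂' : Snapshot Q Γ}
    (h : crossing u₁ c₁ c₁' = crossing u₂ c₂ c₂')
    (hs : u₁ <:+ c₁.pointer ↔ u₂ <:+ c₂.pointer) :
    u₁ <:+ c₁'.pointer ↔ u₂ <:+ c₂'.pointer := by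
  have h1 := crossing_eq_none_iff (u := u₁) (c := c₁) (c' := c₁')
  have h2 := crossing_eq_none_iff (u := u₂) (c := c₂) (c' := c₂')
  rw [h] at h1
  have h3 := h1.symm.trans h2
  tauto

theorem eq_of_crossing_eq {u₁ u₂ : TreeNode} {c₁ c₁' c₂ c₂' : Snapshot Q Γ}
    (h : crossing u₁ c₁ c₁' = crossing u₂ c₂ c₂')
    (hs : u₁ <:+ c₁.pointer ↔ u₂ <:+ c₂.pointer)
    (hc : ¬ ((u₁ <:+ c₁.pointer) ↔ (u₁ <:+ c₁'.pointer))) :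
    c₁'.state = c₂'.state ∧ c₁'.tree u₁ = c₂'.tree u₂ := by
  have hs' := side_congr h hs
  have hc' : ¬ ((u₂ <:+ c₂.pointer) ↔ (u₂ <:+ c₂'.pointer)) := by tauto
  rw [crossing_eq_some hc, crossing_eq_some hc'] at h
  simpa using h

/-- Both snapshots agree on the subtrees at `u₁` and `u₂`. -/
def InsideEq (u₁ u₂ : TreeNode) (c₁ c₂ : Snapshot Q Γ) : Prop :=
  (u₁ <:+ c₁.pointer ↔ u₂ <:+ c₂.pointer) ∧ (∀ R, c₁.tree (R ++ u₁) = c₂.tree (R ++ u₂)) ∧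
    ∀ ρ, c₁.pointer = ρ ++ u₁ → c₂.pointer = ρ ++ u₂ ∧ c₁.state = c₂.state

/-- With the pointer below, the move depends only on data relative to `u`; the kind of `u` itself is
supplied by `head?`, so the two subtrees may sit at different places. With the pointer elsewhere,
nothing below can change except `u` at the moment of entry, which the crossing information covers.
-/
theorem InsideEq.step {F : StepRule Q σ Γ} {u₁ u₂ : TreeNode} {c₁ c₂ : Snapshot Q Γ}
    {a₁ a₂ : TapeSymbol σ} (h : InsideEq u₁ u₂ c₁ c₂) (h₁ : u₁ ≠ []) (h₂ : u₂ ≠ [])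
    (hh : u₁.head? = u₂.head?)
    (hc : crossing u₁ c₁ (c₁.step F a₁) = crossing u₂ c₂ (c₂.step F a₂))
    (ha : u₁ <:+ c₁.pointer → a₁ = a₂) :
    InsideEq u₁ u₂ (c₁.step F a₁) (c₂.step F a₂) := by
  obtain ⟨hs, hT, hp⟩ := h
  have hs' := side_congr hc hs
  by_cases hin : u₁ <:+ c₁.pointer
  · obtain ⟨ρ, hρ⟩ := hin
    obtain ⟨hρ₂, hst⟩ := hp ρ hρ.symm
    obtain rfl := ha ⟨ρ, hρ⟩
    have hm : move F c₁ a₁ = move F c₂ a₁ := by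
      have e1 : c₁.tree c₁.pointer = c₂.tree c₂.pointer := by
        rw [← hρ, hρ₂]
        exact hT ρ
      have e2 : labelNodeType c₁.tree c₁.pointer = labelNodeType c₂.tree c₂.pointer := by
        rw [← hρ, hρ₂]
        have k : (ρ ++ u₁).head? = (ρ ++ u₂).head? := by cases ρ <;> simp [hh]
        simp only [labelNodeType, k, ← List.cons_append, hT]
      rw [move, move, e1, e2, hst]
    obtain ⟨k1, k2⟩ := (move F c₂ a₁).2.inside_congr (ρ := ρ) h₁ h₂ hT
    refine ⟨hs', ?_, ?_⟩
    · intro R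
      simp only [step_eq, hm, ← hρ, hρ₂]
      exact k1 R
    · intro ρ' h'
      simp only [step_eq, hm, ← hρ, hρ₂] at h' ⊢
      rcases k2 with ⟨ρ'', g1, g2⟩ | ⟨g1, g2⟩
      · rw [g1] at h'
        obtain rfl := List.append_cancel_right h'
        exact ⟨g2, trivial⟩
      · rw [h'] at g1
        exact absurd (List.suffix_append _ _) g1
  · have hin₂ : ¬ u₂ <:+ c₂.pointer := fun h => hin (hs.2 h)
    obtain ⟨k1, k1'⟩ := (move F c₁ a₁).2.tree_eq_of_outside c₁.tree hin
    obtain ⟨k2, k2'⟩ := (move F c₂ a₂).2.tree_eq_of_outside c₂.tree hin₂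
    by_cases hin' : u₁ <:+ (c₁.step F a₁).pointer
    · have hin₂' := hs'.1 hin'
      obtain ⟨e1, e2⟩ := eq_of_crossing_eq hc hs (by tauto)
      refine ⟨hs', fun R => ?_, fun ρ' h' => ?_⟩
      · by_cases hR : R = []
        · subst hR
          exact e2
        · exact ((k1' hin').2 R hR).trans ((hT R).trans ((k2' hin₂').2 R hR).symm)
      · have g1 : (c₁.step F a₁).pointer = u₁ := (k1' hin').1
        have g2 : (c₂.step F a₂).pointer = u₂ := (k2' hin₂').1
        rw [g1] at h'
        have : ρ' = [] := List.append_left_eq_self.1 h'.symm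
        subst this
        exact ⟨g2, e1⟩
    · have hin₂' : ¬ u₂ <:+ (c₂.step F a₂).pointer := fun h => hin' (hs'.2 h)
      refine ⟨hs', fun R => (k1 hin' R).trans ((hT R).trans (k2 hin₂' R).symm),
        fun ρ' h' => ?_⟩
      rw [h'] at hin'
      exact absurd (List.suffix_append _ _) hin'

/-- Both snapshots agree outside of the subtree at `u`. -/
def OutsideEq (u : TreeNode) (c₁ c₂ : Snapshot Q Γ) : Prop :=
  (u <:+ c₁.pointer ↔ u <:+ c₂.pointer) ∧ (∀ X, ¬ u <:+ X → c₁.tree X = c₂.tree X) ∧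
    (¬ u <:+ c₁.pointer → c₁.pointer = c₂.pointer ∧ c₁.state = c₂.state ∧
      (c₁.tree u).isSome = (c₂.tree u).isSome)

/-- From outside, the only visible trace of the subtree is whether `u` exists. From inside, this can
change only when `u` is popped, which moves the pointer out; the agreement is then restored by the
crossing information and need not be maintained in between. -/
theorem OutsideEq.step {F : StepRule Q σ Γ} {u : TreeNode} {c₁ c₂ : Snapshot Q Γ}
    {a₁ a₂ : TapeSymbol σ} (h : OutsideEq u c₁ c₂)
    (hc : crossing u c₁ (c₁.step F a₁) = crossing u c₂ (c₂.step F a₂))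
    (ha : ¬ u <:+ c₁.pointer → a₁ = a₂) :
    OutsideEq u (c₁.step F a₁) (c₂.step F a₂) := by
  obtain ⟨hs, hT, hp⟩ := h
  have hs' := side_congr hc hs
  by_cases hin : u <:+ c₁.pointer
  · have hin₂ := hs.1 hin
    obtain ⟨k1, k1'⟩ := (move F c₁ a₁).2.tree_eq_of_inside c₁.tree hin
    obtain ⟨k2, k2'⟩ := (move F c₂ a₂).2.tree_eq_of_inside c₂.tree hin₂
    refine ⟨hs', fun X hX => (k1 X hX).trans ((hT X hX).trans (k2 X hX).symm), fun hout => ?_⟩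
    have hout₂ : ¬ u <:+ (c₂.step F a₂).pointer := fun h => hout (hs'.2 h)
    obtain ⟨e1, e2⟩ := eq_of_crossing_eq hc hs (by tauto)
    exact ⟨(k1' hout).2.trans (k2' hout₂).2.symm, e1, by rw [e2]⟩
  · obtain ⟨hptr, hst, hu⟩ := hp hin
    obtain rfl := ha hin
    have isSome_eq : ∀ d : Side, (c₁.tree (d :: c₂.pointer)).isSome =
        (c₂.tree (d :: c₂.pointer)).isSome := by
      intro d
      by_cases hd : u <:+ d :: c₂.pointer
      · rw [hptr] at hin
        rw [← (List.suffix_cons_iff.1 hd).resolve_right hin]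
        exact hu
      · rw [hT _ hd]
    have hm : move F c₁ a₁ = move F c₂ a₁ := by
      rw [move, move, hT _ hin, hptr, hst]
      simp only [labelNodeType, isSome_eq]
    obtain ⟨k1, k2⟩ := (move F c₂ a₁).2.outside_congr (P := c₂.pointer) hT hu
    refine ⟨hs', fun X hX => ?_, fun hout => ⟨?_, ?_, ?_⟩⟩
    · simp only [step_eq, hm, hptr]
      exact k1 X hX
    · simp only [step_eq, hm, hptr]
    · simp only [step_eq, hm]
    · simp only [step_eq, hm, hptr]
      exact k2

/-- The tree below `u` is determined by the crossing information at `u` and the symbols read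
there. -/
theorem insideEq_trajectory {F : StepRule Q σ Γ} {q : Q} {w₁ w₂ : ℕ → TapeSymbol σ}
    {u₁ u₂ : TreeNode} (h₁ : u₁ ≠ []) (h₂ : u₂ ≠ []) (hh : u₁.head? = u₂.head?) (n : ℕ)
    (hc : ∀ t < n, crossing u₁ (trajectory F (initial q) w₁ t)
        (trajectory F (initial q) w₁ (t + 1)) =
      crossing u₂ (trajectory F (initial q) w₂ t) (trajectory F (initial q) w₂ (t + 1)))
    (hw : ∀ t < n, u₁ <:+ (trajectory F (initial q) w₁ t).pointer → w₁ t = w₂ t) :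
    InsideEq u₁ u₂ (trajectory F (initial q) w₁ n) (trajectory F (initial q) w₂ n) := by
  induction n with
  | zero =>
    refine ⟨by simp [trajectory, initial, h₁, h₂], fun R => ?_, fun ρ h => ?_⟩
    · have : ∀ u : TreeNode, u ≠ [] → (StorageTree.initial Γ).label (R ++ u) = none := by
        intro u hu
        rcases h : R ++ u with _ | ⟨d, P⟩
        · exact absurd (List.append_eq_nil_iff.1 h).2 hu
        · rfl
      exact (this u₁ h₁).trans (this u₂ h₂).symm
    · exact absurd (List.append_eq_nil_iff.1 h.symm).2 h₁
  | succ n ih =>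
    exact (ih (fun t ht => hc t (by omega)) (fun t ht => hw t (by omega))).step h₁ h₂ hh
      (hc n (by omega)) (hw n (by omega))

/-- The tree outside of the subtree at `u` is determined by the crossing information at `u` and the
symbols read there; the position of `u` is determined as soon as there is a crossing. -/
theorem outsideEq_trajectory {F : StepRule Q σ Γ} {q : Q} {w₁ w₂ : ℕ → TapeSymbol σ}
    {u₁ u₂ : TreeNode} (h₁ : u₁ ≠ []) (h₂ : u₂ ≠ []) (n : ℕ)
    (hc : ∀ t < n, crossing u₁ (trajectory F (initial q) w₁ t)
        (trajectory F (initial q) w₁ (t + 1)) =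
      crossing u₂ (trajectory F (initial q) w₂ t) (trajectory F (initial q) w₂ (t + 1)))
    (hw : ∀ t < n, ¬ u₁ <:+ (trajectory F (initial q) w₁ t).pointer → w₁ t = w₂ t)
    (hx : ∃ t ≤ n, u₁ <:+ (trajectory F (initial q) w₁ t).pointer) :
    u₁ = u₂ ∧ ∀ m ≤ n,
      OutsideEq u₁ (trajectory F (initial q) w₁ m) (trajectory F (initial q) w₂ m) := by
  have hsides : ∀ m ≤ n, (u₁ <:+ (trajectory F (initial q) w₁ m).pointer ↔
      u₂ <:+ (trajectory F (initial q) w₂ m).pointer) := by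
    intro m hm
    induction m with
    | zero => simp [trajectory, initial, h₁, h₂]
    | succ m ih => exact side_congr (hc m hm) (ih (by omega))
  -- Before the first entry both runs read the same symbols and coincide, and a pointer entering a
  -- subtree lands exactly on its root.
  have hu : u₁ = u₂ := by
    classical
    obtain ⟨hm1, hm2⟩ := Nat.find_spec hx
    rcases hm : Nat.find hx with _ | m
    · rw [hm] at hm2
      exact absurd (List.suffix_nil.1 hm2) h₁
    · rw [hm] at hm1 hm2
      have hbefore : ∀ t ≤ m, ¬ u₁ <:+ (trajectory F (initial q) w₁ t).pointer := by
        intro t ht hin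
        exact Nat.find_min hx (m := t) (by omega) ⟨by omega, hin⟩
      have heq : ∀ t ≤ m + 1, trajectory F (initial q) w₁ t = trajectory F (initial q) w₂ t := by
        intro t ht
        induction t with
        | zero => rfl
        | succ t ih =>
          rw [trajectory, trajectory, ih (by omega),
            hw t (by omega) (hbefore t (by omega))]
      have hin₂ := (hsides (m + 1) hm1).1 hm2
      have hout := hbefore m le_rfl
      have hout₂ := mt (hsides m (by omega)).2 hout
      rw [← ((move F _ _).2.tree_eq_of_outside (trajectory F (initial q) w₁ m).tree hout).2
        hm2 |>.1, ← ((move F _ _).2.tree_eq_of_outside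
          (trajectory F (initial q) w₂ m).tree hout₂).2 hin₂ |>.1]
      exact congrArg pointer (heq (m + 1) le_rfl)
  subst hu
  refine ⟨rfl, fun m hm => ?_⟩
  induction m with
  | zero => exact ⟨Iff.rfl, fun _ _ => rfl, fun _ => ⟨rfl, rfl, rfl⟩⟩
  | succ m ih => exact (ih (by omega)).step (hc m hm) (hw m hm)

/-! ### Snapshots which look the same from the pointer -/

/-- The snapshots agree within distance `k` from the pointer. -/
def Similar (k : ℕ) (c₁ c₂ : Snapshot Q Γ) : Prop :=
  c₁.state = c₂.state ∧ c₁.pointer.take k = c₂.pointer.take k ∧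
    ∀ (j : ℕ) (R : TreeNode), j + R.length ≤ k →
      c₁.tree (R ++ c₁.pointer.drop j) = c₂.tree (R ++ c₂.pointer.drop j)

/-- A step sees the nodes at distance one and moves by at most one edge, so one unit of radius is
lost. The agreement of the last letters of the addresses decides whether a relative address denotes
the node that is pushed or popped. -/
theorem Similar.step {F : StepRule Q σ Γ} {k : ℕ} {c₁ c₂ : Snapshot Q Γ}
    (h : Similar (k + 1) c₁ c₂) (a : TapeSymbol σ) :
    Similar k (c₁.step F a) (c₂.step F a) := by
  obtain ⟨hst, hp, hT⟩ := h
  have hm : move F c₁ a = move F c₂ a := by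
    have e1 : c₁.tree c₁.pointer = c₂.tree c₂.pointer := hT 0 [] (by simp)
    have e2 : ∀ d, c₁.tree (d :: c₁.pointer) = c₂.tree (d :: c₂.pointer) := fun d =>
      hT 0 [d] (by simp)
    have e3 : c₁.pointer.head? = c₂.pointer.head? := by
      have : ∀ l : TreeNode, (l.take (k + 1)).head? = l.head? := fun l => by cases l <;> rfl
      rw [← this, hp, this]
    rw [move, move, hst, e1]
    simp only [labelNodeType, e2, e3]
  have htake : ∀ j ≤ k + 1, c₁.pointer.take j = c₂.pointer.take j := by
    intro j hj
    have := congrArg (List.take j) hp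
    simpa [List.take_take, hj] using this
  have htail : c₁.pointer.tail.take k = c₂.pointer.tail.take k := by
    have := congrArg List.tail hp
    rcases h1 : c₁.pointer with _ | ⟨d, P⟩ <;> rcases h2 : c₂.pointer with _ | ⟨e, P'⟩ <;>
      simp_all
  have hcons : ∀ d : Side, (d :: c₁.pointer).take k = (d :: c₂.pointer).take k := by
    intro d
    cases k with
    | zero => rfl
    | succ k => rw [List.take_succ_cons, List.take_succ_cons, htake k (by omega)]
  have hup : ∀ (j : ℕ) (R : TreeNode), j + R.length ≤ k →
      c₁.tree (R ++ c₁.pointer.tail.drop j) = c₂.tree (R ++ c₂.pointer.tail.drop j) := by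
    intro j R hj
    simpa using hT (j + 1) R (by omega)
  have hdown : ∀ (d : Side) (j : ℕ) (R : TreeNode), j + R.length ≤ k →
      c₁.tree (R ++ (d :: c₁.pointer).drop j) = c₂.tree (R ++ (d :: c₂.pointer).drop j) := by
    intro d j R hj
    cases j with
    | zero => simpa using hT 0 (R ++ [d]) (by simp at hj ⊢; omega)
    | succ j => exact hT j R (by omega)
  refine ⟨by rw [step_eq, step_eq, hm], ?_, ?_⟩
  · simp only [step_eq, hm]
    cases (move F c₂ a).2 with
    | up => exact htail
    | stay => exact htake k (by omega)
    | down d => exact hcons d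
    | pop => exact htail
    | push x d => exact hcons d
  · intro j R hj
    simp only [step_eq, hm]
    cases (move F c₂ a).2 with
    | up => exact hup j R hj
    | stay => exact hT j R (by omega)
    | down d => exact hdown d j R hj
    | pop =>
      have key : ∀ P : TreeNode, R ++ P.tail.drop j = P ↔ R = P.take (j + 1) := by
        intro P
        rw [← append_drop_eq_iff R P (j + 1)]
        simp
      simp only [StorageOp.treeAfter, StorageOp.pointerAfter]
      by_cases h : R ++ c₁.pointer.tail.drop j = c₁.pointer
      · have h' : R ++ c₂.pointer.tail.drop j = c₂.pointer := by
          rwa [key, ← htake (j + 1) (by omega), ← key]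
        rw [h, h', Function.update_self, Function.update_self]
      · have h' : ¬ R ++ c₂.pointer.tail.drop j = c₂.pointer := by
          rwa [key, ← htake (j + 1) (by omega), ← key]
        rw [Function.update_of_ne h, Function.update_of_ne h']
        exact hup j R hj
    | push x d =>
      simp only [StorageOp.treeAfter, StorageOp.pointerAfter]
      have htk : (d :: c₁.pointer).take j = (d :: c₂.pointer).take j := by
        cases j with
        | zero => rfl
        | succ j => rw [List.take_succ_cons, List.take_succ_cons, htake j (by omega)]
      by_cases h : R ++ (d :: c₁.pointer).drop j = d :: c₁.pointer
      · have h' : R ++ (d :: c₂.pointer).drop j = d :: c₂.pointer := by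
          rwa [append_drop_eq_iff, ← htk, ← append_drop_eq_iff]
        rw [h, h', Function.update_self, Function.update_self]
      · have h' : ¬ R ++ (d :: c₂.pointer).drop j = d :: c₂.pointer := by
          rwa [append_drop_eq_iff, ← htk, ← append_drop_eq_iff]
        rw [Function.update_of_ne h, Function.update_of_ne h']
        exact hdown d j R hj

theorem Similar.run_state_eq {F : StepRule Q σ Γ} {k : ℕ} {c₁ c₂ : Snapshot Q Γ}
    (h : Similar k c₁ c₂) (w : List (TapeSymbol σ)) (hw : w.length ≤ k) :
    (c₁.run F w).state = (c₂.run F w).state := by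
  induction w generalizing k c₁ c₂ with
  | nil => exact h.1
  | cons a w ih =>
    cases k with
    | zero => simp at hw
    | succ k => exact ih (h.step a) (by simpa using hw)

end Snapshot

/-! ## Cutting the tree between two positions -/

/-- The position `P'` is reached from `P` by at most `D` steps up and at most `D` steps down. -/
def Near (D : ℕ) (P P' : TreeNode) : Prop :=
  ∃ (j : ℕ) (R : TreeNode), j ≤ D ∧ R.length ≤ D ∧ P' = R ++ P.drop j

/-- The position `P` is not below `u` and has distance at least `s` from `u`. -/
def FarAbove (s : ℕ) (u P : TreeNode) : Prop :=
  ∀ (j : ℕ) (R R' : TreeNode), R ++ P.drop j = R' ++ u → R'.length + s ≤ j + R.length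

theorem FarAbove.not_suffix {s : ℕ} {u P : TreeNode} (h : FarAbove s u P) (hs : 0 < s) :
    ¬ u <:+ P := by
  rintro ⟨R', hR'⟩
  have := h 0 [] R' (by simp [hR'])
  simp at this
  omega

/-- The two words do not end with the same letter. -/
def LastNe (α β : TreeNode) : Prop :=
  ∀ (a b : Side) (α' β' : TreeNode), α = α' ++ [a] → β = β' ++ [b] → a ≠ b

theorem LastNe.symm {α β : TreeNode} (h : LastNe α β) : LastNe β α :=
  fun a b α' β' h1 h2 => (h b a β' α' h2 h1).symm

theorem LastNe.drop {α β : TreeNode} (h : LastNe α β) (i : ℕ) : LastNe (α.drop i) β := by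
  intro a b α' β' h1 h2
  refine h a b (α.take i ++ α') β' ?_ h2
  rw [List.append_assoc, ← h1, List.take_append_drop]

theorem LastNe.eq_nil_of_append {β γ R R' : TreeNode} (h : LastNe γ β) (hγ : γ ≠ [])
    (e : R ++ β = R' ++ γ) : β = [] := by
  rcases List.eq_nil_or_concat' β with hβ | ⟨β', b, rfl⟩
  · exact hβ
  rcases List.eq_nil_or_concat' γ with hγ' | ⟨γ', a, rfl⟩
  · exact absurd hγ' hγ
  rw [← List.append_assoc, ← List.append_assoc] at e
  have := (List.append_inj' e rfl).2
  simp only [List.cons.injEq, and_true] at this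
  exact absurd this.symm (h a b γ' β' rfl rfl)

/-- Here `c` is the lowest common ancestor, and `α`, `β` are the two legs descending from it. -/
theorem exists_common_suffix (P P' : TreeNode) :
    ∃ α β c, P = α ++ c ∧ P' = β ++ c ∧ LastNe α β := by
  induction P using List.reverseRecOn generalizing P' with
  | nil => exact ⟨[], P', [], rfl, by simp, fun a b α' β' h1 => by simp at h1⟩
  | append_singleton P a ih =>
    rcases List.eq_nil_or_concat' P' with rfl | ⟨P', b, rfl⟩
    · exact ⟨P ++ [a], [], [], by simp, rfl, fun a b α' β' _ h2 => by simp at h2⟩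
    · by_cases hab : a = b
      · subst hab
        obtain ⟨α, β, c, rfl, rfl, h⟩ := ih P'
        exact ⟨α, β, c ++ [a], by simp, by simp, h⟩
      · refine ⟨P ++ [a], P' ++ [b], [], by simp, by simp, fun a' b' α' β' h1 h2 => ?_⟩
        have h1 := (List.append_inj' h1 rfl).2
        have h2 := (List.append_inj' h2 rfl).2
        simp only [List.cons.injEq, and_true] at h1 h2
        rwa [← h1, ← h2]

/-- The legs part at `c`, so a walk into the subtree at `γ ++ c` has to climb all of `β` and then
descend through all of `γ`. -/
theorem farAbove_of_lastNe {s : ℕ} {β γ c : TreeNode} (h : LastNe γ β) (hs : s ≤ γ.length)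
    (hγ : γ ≠ []) : FarAbove s (γ ++ c) (β ++ c) := by
  intro j R R' e
  rw [List.drop_append, ← List.append_assoc, ← List.append_assoc] at e
  have hl := congrArg List.length e
  simp only [List.length_append, List.length_drop] at hl
  by_cases hj : β.length ≤ j
  · omega
  · exfalso
    rw [show j - β.length = 0 by omega, List.drop_zero] at e
    have e' := List.append_cancel_right e
    have := (LastNe.symm (h.symm.drop j)).eq_nil_of_append hγ e'
    rw [List.drop_eq_nil_iff] at this
    exact hj this

namespace Snapshot

variable {Q σ Γ : Type}

theorem pointer_of_crossing {F : StepRule Q σ Γ} {c : Snapshot Q Γ} {a : TapeSymbol σ}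
    {u : TreeNode} (h : crossing u c (c.step F a) ≠ none) :
    ((c.step F a).pointer = u ∧ ¬ u <:+ c.pointer) ∨
      (c.pointer = u ∧ (c.step F a).pointer = u.tail ∧ ¬ u <:+ (c.step F a).pointer) := by
  rw [Ne, crossing_eq_none_iff] at h
  by_cases hin : u <:+ c.pointer
  · have hout : ¬ u <:+ (c.step F a).pointer := by tauto
    have := ((move F c a).2.tree_eq_of_inside c.tree hin).2 hout
    exact Or.inr ⟨this.1, this.2, hout⟩
  · have hin' : u <:+ (c.step F a).pointer := by tauto
    exact Or.inl ⟨(((move F c a).2.tree_eq_of_outside c.tree hin).2 hin').1, hin⟩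

/-- A step crosses at most one edge. -/
theorem crossing_unique {F : StepRule Q σ Γ} {c : Snapshot Q Γ} {a : TapeSymbol σ}
    {u u' : TreeNode} (h : crossing u c (c.step F a) ≠ none)
    (h' : crossing u' c (c.step F a) ≠ none) : u = u' := by
  rcases pointer_of_crossing h with ⟨h1, h2⟩ | ⟨h1, h2, h3⟩ <;>
    rcases pointer_of_crossing h' with ⟨h1', h2'⟩ | ⟨h1', h2', h3'⟩
  · rw [← h1, h1']
  · refine absurd ?_ h2
    rw [h1', ← h1, h2']
    exact List.tail_suffix _
  · refine absurd ?_ h2'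
    rw [h1, ← h1', h2]
    exact List.tail_suffix _
  · rw [← h1, h1']

open Classical in
/-- The times of the first `n` steps in which the edge above `u` is crossed. -/
def crossingTimes (f : ℕ → Snapshot Q Γ) (u : TreeNode) (n : ℕ) : Finset ℕ :=
  (Finset.range n).filter fun t => crossing u (f t) (f (t + 1)) ≠ none

/-- Each step crosses at most one edge, so the crossing times of the `s` distinct edges are disjoint
subsets of the `n` steps; some edge has at most the average. -/
theorem exists_few_crossings (F : StepRule Q σ Γ) (c : Snapshot Q Γ) (w : ℕ → TapeSymbol σ)
    (n s : ℕ) (v : ℕ → TreeNode) (hv : Set.InjOn v (Finset.range s)) (hs : 0 < s) :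
    ∃ i < s, s * (crossingTimes (trajectory F c w) (v i) n).card ≤ n := by
  classical
  by_contra! h
  have h1 : ∑ i ∈ Finset.range s, (crossingTimes (trajectory F c w) (v i) n).card ≤ n := by
    rw [← Finset.card_biUnion]
    · calc _ ≤ (Finset.range n).card := by
            refine Finset.card_le_card (Finset.biUnion_subset.2 fun i _ => ?_)
            exact Finset.filter_subset _ _
        _ = n := Finset.card_range n
    · intro i hi j hj hij
      rw [Function.onFun, Finset.disjoint_left]
      intro t ht ht'
      exact hij (hv hi hj (crossing_unique (Finset.mem_filter.1 ht).2
        (Finset.mem_filter.1 ht').2))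
  have h2 : ∑ i ∈ Finset.range s, n <
      ∑ i ∈ Finset.range s, s * (crossingTimes (trajectory F c w) (v i) n).card :=
    Finset.sum_lt_sum_of_nonempty (Finset.nonempty_range_iff.2 hs.ne')
      fun i hi => h i (Finset.mem_range.1 hi)
  rw [← Finset.mul_sum, Finset.sum_const, Finset.card_range, smul_eq_mul] at h2
  exact absurd (Nat.mul_le_mul_left s h1) (not_le.2 h2)

/-- `P` is below `u` at depth at least `s`, and `P'` is far above `u`. -/
def Separates (s : ℕ) (u P P' : TreeNode) : Prop :=
  (∃ ρ : TreeNode, P = ρ ++ u ∧ s ≤ ρ.length) ∧ FarAbove s u P'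

/-- The leg `α` is divided into thirds. The `s` candidates for the cut come from the middle, which
leaves distance at least `s` to either end. -/
theorem exists_cut_below (F : StepRule Q σ Γ) (c₀ : Snapshot Q Γ) (w : ℕ → TapeSymbol σ)
    (n s : ℕ) (hs : 0 < s) {α β c : TreeNode} (h : LastNe α β) (hα : 3 * s ≤ α.length) :
    ∃ u, u ≠ [] ∧ s * (crossingTimes (trajectory F c₀ w) u n).card ≤ n ∧
      Separates s u (α ++ c) (β ++ c) := by
  obtain ⟨i, hi, h1⟩ := exists_few_crossings F c₀ w n s (fun i => α.drop (s + i) ++ c) (by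
    intro i hi j hj hij
    have := congrArg List.length hij
    simp only [Finset.coe_range, Set.mem_Iio, List.length_append, List.length_drop]
      at hi hj this
    omega) hs
  have hne : α.drop (s + i) ≠ [] := by
    rw [Ne, List.drop_eq_nil_iff]
    omega
  refine ⟨_, ?_, h1, ⟨α.take (s + i), ?_, ?_⟩, farAbove_of_lastNe (h.drop _) ?_ hne⟩
  · simp only [ne_eq, List.append_eq_nil_iff, not_and]
    exact fun h => absurd h hne
  · rw [← List.append_assoc, List.take_append_drop]
  · rw [List.length_take]
    omega
  · rw [List.length_drop]
    omega

/-- If the positions are not near, one of the two legs from their lowest common ancestor has length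
at least `3 * s`. The cut is made in that leg, so either position may be the one below. -/
theorem exists_cut (F : StepRule Q σ Γ) (c₀ : Snapshot Q Γ) (w : ℕ → TapeSymbol σ)
    (n s : ℕ) (hs : 0 < s) {P P' : TreeNode} (h : ¬ Near (3 * s) P P') :
    ∃ u, u ≠ [] ∧ s * (crossingTimes (trajectory F c₀ w) u n).card ≤ n ∧
      (Separates s u P P' ∨ Separates s u P' P) := by
  obtain ⟨α, β, c, rfl, rfl, hl⟩ := exists_common_suffix P P'
  by_cases hα : 3 * s ≤ α.length
  · obtain ⟨u, h1, h2, h3⟩ := exists_cut_below F c₀ w n s hs (c := c) hl hα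
    exact ⟨u, h1, h2, Or.inl h3⟩
  by_cases hβ : 3 * s ≤ β.length
  · obtain ⟨u, h1, h2, h3⟩ := exists_cut_below F c₀ w n s hs (c := c) hl.symm hβ
    exact ⟨u, h1, h2, Or.inr h3⟩
  · exact absurd ⟨α.length, β, by omega, by omega, by simp⟩ h

/-- The labels around `u` up to distance `h` coincide. -/
def AroundEq (h : ℕ) (u₁ u₂ : TreeNode) (c₁ c₂ : Snapshot Q Γ) : Prop :=
  ∀ (j : ℕ) (R : TreeNode), j ≤ h → R.length ≤ h →
    c₁.tree (R ++ u₁.drop j) = c₂.tree (R ++ u₂.drop j)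

/-- A node within distance `k` of the pointer either lies below `u` or is reached after spending at
least `s` moves on the way up to `u`. At most `h` moves are left then, so the node is among those
around `u`. -/
theorem InsideEq.similar {s h k : ℕ} {u₁ u₂ ρ : TreeNode} {c₁ c₂ : Snapshot Q Γ}
    (H : InsideEq u₁ u₂ c₁ c₂) (hu : u₁.take h = u₂.take h) (ha : AroundEq h u₁ u₂ c₁ c₂)
    (hρ : c₁.pointer = ρ ++ u₁) (hs : s ≤ ρ.length) (hk : k ≤ h + s) : Similar k c₁ c₂ := by
  obtain ⟨-, hT, hp⟩ := H
  obtain ⟨hρ₂, hst⟩ := hp ρ hρ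
  refine ⟨hst, ?_, fun j R hj => ?_⟩
  · have htake : ∀ i ≤ h, u₁.take i = u₂.take i := by
      intro i hi
      have := congrArg (List.take i) hu
      simpa [List.take_take, hi] using this
    rw [hρ, hρ₂, List.take_append, List.take_append, htake _ (by omega)]
  · rw [hρ, hρ₂, List.drop_append, List.drop_append]
    by_cases hj' : j ≤ ρ.length
    · rw [show j - ρ.length = 0 by omega, List.drop_zero, List.drop_zero,
        ← List.append_assoc, ← List.append_assoc]
      exact hT _
    · rw [List.drop_eq_nil_of_le (by omega), List.nil_append, List.nil_append]
      exact ha _ R (by omega) (by omega)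

/-- The vicinity of the pointer meets the subtree at `u` only in depth at most `k - s ≤ h`, where
the labels are known from `AroundEq`. -/
theorem OutsideEq.similar {s h k : ℕ} {u : TreeNode} {c₁ c₂ : Snapshot Q Γ}
    (H : OutsideEq u c₁ c₂) (ha : AroundEq h u u c₁ c₂) (hs : 0 < s)
    (hf : FarAbove s u c₁.pointer) (hk : k ≤ h + s) : Similar k c₁ c₂ := by
  obtain ⟨-, hT, hp⟩ := H
  obtain ⟨hptr, hst, -⟩ := hp (hf.not_suffix hs)
  refine ⟨hst, by rw [hptr], fun j R hj => ?_⟩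
  rw [← hptr]
  by_cases hin : u <:+ R ++ c₁.pointer.drop j
  · obtain ⟨R', hR'⟩ := hin
    have := hf j R R' hR'.symm
    rw [← hR']
    exact ha 0 R' (by omega) (by omega)
  · exact hT _ hin

/-! ### Staying near a position -/

/-- As long as the pointer stays near `P`, other parts of the tree do not change. -/
theorem tree_eq_of_near {F : StepRule Q σ Γ} {D : ℕ} {P : TreeNode} {c : Snapshot Q Γ}
    {a : TapeSymbol σ} (h : Near D P c.pointer) (h' : Near D P (c.step F a).pointer)
    {X : TreeNode} (hX : ¬ Near D P X) : (c.step F a).tree X = c.tree X := by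
  have h1 : X ≠ c.pointer := by rintro rfl; exact hX h
  have h2 : X ≠ (c.step F a).pointer := by rintro rfl; exact hX h'
  rw [step_eq] at h2 ⊢
  revert h2
  cases (move F c a).2 with
  | up => exact fun _ => rfl
  | stay => exact fun _ => rfl
  | down d => exact fun _ => rfl
  | pop => exact fun _ => Function.update_of_ne h1 _ _
  | push x d => exact fun h2 => Function.update_of_ne h2 _ _

theorem run_tree_eq_of_near {F : StepRule Q σ Γ} {D : ℕ} {P : TreeNode}
    (w : List (TapeSymbol σ)) {c : Snapshot Q Γ}
    (h : ∀ v, v <+: w → Near D P (c.run F v).pointer)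
    {X : TreeNode} (hX : ¬ Near D P X) : (c.run F w).tree X = c.tree X := by
  induction w generalizing c with
  | nil => rfl
  | cons a w ih =>
    have h0 : Near D P c.pointer := h [] List.nil_prefix
    have h1 : Near D P (c.step F a).pointer := h [a] (by simp)
    rw [run_cons, ih, tree_eq_of_near h0 h1 hX]
    intro v hv
    exact h (a :: v) (by simpa using hv)

end Snapshot

/-! ### Finite codes of short addresses -/

instance : Fintype Side := ⟨{Side.l, Side.r}, fun d => by cases d <;> simp⟩

theorem card_side : Fintype.card Side = 2 := rfl

/-- Codes of the words of length at most `h` over the two sides. -/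
abbrev NodeCode (h : ℕ) : Type := Fin (h + 1) × (Fin h → Side)

/-- The word with the given code. -/
def NodeCode.decode {h : ℕ} (c : NodeCode h) : TreeNode := (List.ofFn c.2).take c.1

theorem NodeCode.exists_decode_eq {h : ℕ} {R : TreeNode} (hR : R.length ≤ h) :
    ∃ c : NodeCode h, c.decode = R := by
  refine ⟨(⟨R.length, by omega⟩, fun i => R.getD i Side.l), ?_⟩
  refine List.ext_getElem (by simp [decode, hR]) fun i h1 h2 => ?_
  simp [decode, h2]

theorem NodeCode.card (h : ℕ) : Fintype.card (NodeCode h) = (h + 1) * 2 ^ h := by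
  simp [NodeCode, card_side]

/-! ## Membership in the union of the witness languages -/

theorem append_cons_inj_of_notMem_left {α : Type*} {a : α} {l₁ l₂ r₁ r₂ : List α}
    (h : l₁ ++ a :: r₁ = l₂ ++ a :: r₂) (h₁ : a ∉ l₁) (h₂ : a ∉ l₂) : l₁ = l₂ ∧ r₁ = r₂ := by
  induction l₁ generalizing l₂ with
  | nil =>
    cases l₂ with
    | nil => simpa using h
    | cons b l₂ =>
      rw [List.nil_append, List.cons_append, List.cons.injEq] at h
      exact absurd (List.mem_cons.2 (Or.inl h.1)) h₂
  | cons b l₁ ih =>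
    cases l₂ with
    | nil =>
      rw [List.nil_append, List.cons_append, List.cons.injEq] at h
      exact absurd (List.mem_cons.2 (Or.inl h.1.symm)) h₁
    | cons b' l₂ =>
      simp only [List.cons_append, List.cons.injEq, List.mem_cons, not_or] at h h₁ h₂
      obtain ⟨rfl, e⟩ := ih h.2 h₁.2 h₂.2
      exact ⟨by rw [h.1], e⟩

theorem notMem_map_sym {s : WSym} (hs : s ≠ WSym.a ∧ s ≠ WSym.b) (u : List Side) :
    s ∉ u.map Side.sym := by
  intro h
  obtain ⟨d, -, rfl⟩ := List.mem_map.1 h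
  cases d
  · exact hs.1 rfl
  · exact hs.2 rfl

theorem notMem_of_mem_wordsABDollar {s : WSym} {w : List WSym} (hw : w ∈ wordsABDollar)
    (hs : s ≠ WSym.a ∧ s ≠ WSym.b ∧ s ≠ WSym.dollar) : s ∉ w := by
  intro h
  rcases hw s h with h | h | h
  exacts [hs.1 h, hs.2.1 h, hs.2.2 h]

theorem blocks_mem_wordsABDollar (xs : List (List Side)) : blocks xs ∈ wordsABDollar := by
  intro s hs
  obtain ⟨x, -, hx⟩ := List.mem_flatMap.1 hs
  rcases List.mem_append.1 hx with hx | hx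
  · obtain ⟨d, -, rfl⟩ := List.mem_map.1 hx
    cases d
    · exact Or.inl rfl
    · exact Or.inr (Or.inl rfl)
  · exact Or.inr (Or.inr (List.eq_of_mem_replicate hx))

theorem map_sym_mem_wordsABDollar (u : List Side) : u.map Side.sym ∈ wordsABDollar := by
  intro s hs
  obtain ⟨d, -, rfl⟩ := List.mem_map.1 hs
  cases d
  · exact Or.inl rfl
  · exact Or.inr (Or.inl rfl)

theorem replicate_length_of_ne_nil {x : List Side} (hx : x ≠ []) :
    List.replicate x.length WSym.dollar =
      WSym.dollar :: List.replicate (x.length - 1) WSym.dollar := by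
  rw [← List.replicate_succ]
  congr 1
  have := List.length_pos_iff.2 hx
  omega

/-- For non-empty words the first dollar ends the word, and its length tells how many dollars belong
to it. Empty words are invisible in the encoding, hence the hypotheses. -/
theorem blocks_injective {xs ys : List (List Side)} (hx : ∀ x ∈ xs, x ≠ [])
    (hy : ∀ y ∈ ys, y ≠ []) (h : blocks xs = blocks ys) : xs = ys := by
  induction xs generalizing ys with
  | nil =>
    cases ys with
    | nil => rfl
    | cons y ys => simp [blocks, hy y List.mem_cons_self] at h
  | cons x xs ih =>
    cases ys with
    | nil => simp [blocks, hx x List.mem_cons_self] at h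
    | cons y ys =>
      have e : ∀ (z : List Side) (zs : List (List Side)), z ≠ [] → blocks (z :: zs) =
          z.map Side.sym ++ WSym.dollar ::
            (List.replicate (z.length - 1) WSym.dollar ++ blocks zs) := by
        intro z zs hz
        simp [blocks, replicate_length_of_ne_nil hz]
      rw [e x xs (hx _ List.mem_cons_self), e y ys (hy _ List.mem_cons_self)] at h
      replace h := append_cons_inj_of_notMem_left h (notMem_map_sym (by simp) _)
        (notMem_map_sym (by simp) _)
      obtain rfl := map_sym_injective h.1
      rw [ih (fun z hz => hx z (List.mem_cons_of_mem _ hz))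
        (fun z hz => hy z (List.mem_cons_of_mem _ hz)) (List.append_cancel_left h.2)]

theorem query_mem_iff {xs : List (List Side)} (h1 : ∀ x ∈ xs, x ≠ [])
    (h2 : xs.Pairwise (fun x y => y <+: x → y = x)) {z : List WSym} (hz : z ∈ wordsABDollar)
    {y : List Side} (hy : y ≠ []) :
    blocks xs ++ WSym.cent :: (z ++ WSym.border₁ :: y.map Side.sym) ∈ hatLp ⊔ hatLmi ↔
      y ∈ xs := by
  constructor
  · rintro (h | ⟨x, v, -, -, h⟩)
    · obtain ⟨xs', z', y', g1, g2, g3, g4, h⟩ := (mem_hatLp_iff _).1 h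
      obtain ⟨e1, e2⟩ := append_cons_inj_of_notMem_left h
        (notMem_of_mem_wordsABDollar (blocks_mem_wordsABDollar _) (by simp))
        (notMem_of_mem_wordsABDollar (blocks_mem_wordsABDollar _) (by simp))
      obtain ⟨-, e3⟩ := append_cons_inj_of_notMem_left e2
        (notMem_of_mem_wordsABDollar hz (by simp)) (notMem_of_mem_wordsABDollar g3 (by simp))
      obtain rfl := blocks_injective h1 g1 e1
      obtain rfl := map_sym_injective e3
      exact g4.resolve_left hy
    · have : WSym.border₂ ∈ blocks xs ++ WSym.cent :: (z ++ WSym.border₁ :: y.map Side.sym) := by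
        rw [h]
        simp
      have n1 := notMem_of_mem_wordsABDollar (s := WSym.border₂) (blocks_mem_wordsABDollar xs)
        (by simp)
      have n2 := notMem_of_mem_wordsABDollar (s := WSym.border₂) hz (by simp)
      have n3 := notMem_of_mem_wordsABDollar (s := WSym.border₂) (map_sym_mem_wordsABDollar y)
        (by simp)
      simp only [List.mem_append, List.mem_cons, n1, n2, n3, reduceCtorEq, or_self] at this
  · intro h
    exact Or.inl ((mem_hatLp_iff _).2 ⟨xs, z, y, h1, h2, hz, Or.inr h, rfl⟩)

theorem mirror_mem_iff {x : List WSym} (hx : x ∈ wordsABDollar) (u v : List Side) :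
    x ++ WSym.cent :: (u.map Side.sym ++ WSym.dollar ::
      (v.reverse.map Side.sym ++ [WSym.border₂])) ∈ hatLp ⊔ hatLmi ↔ u = v := by
  constructor
  · rintro (h | ⟨x', v', hx', hv', h⟩)
    · obtain ⟨xs, z, y, -, -, -, -, h⟩ := (mem_hatLp_iff _).1 h
      have : WSym.border₁ ∈ x ++ WSym.cent :: (u.map Side.sym ++ WSym.dollar ::
          (v.reverse.map Side.sym ++ [WSym.border₂])) := by
        rw [h]
        simp
      have n1 := notMem_of_mem_wordsABDollar (s := WSym.border₁) hx (by simp)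
      have n2 := fun y => notMem_of_mem_wordsABDollar (s := WSym.border₁)
        (map_sym_mem_wordsABDollar y) (by simp)
      simp only [List.mem_append, List.mem_cons, n1, n2, reduceCtorEq, or_self,
        List.not_mem_nil] at this
    · obtain ⟨v', rfl⟩ := (mem_wordsAB_iff _).1 hv'
      simp only [List.append_assoc, List.cons_append, List.nil_append] at h
      obtain ⟨-, e2⟩ := append_cons_inj_of_notMem_left h
        (notMem_of_mem_wordsABDollar hx (by simp)) (notMem_of_mem_wordsABDollar hx' (by simp))
      obtain ⟨e3, e4⟩ := append_cons_inj_of_notMem_left e2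
        (notMem_map_sym (by simp) _) (notMem_map_sym (by simp) _)
      obtain rfl := map_sym_injective e3
      have := List.append_cancel_right e4
      rw [← List.map_reverse] at this
      exact (List.reverse_injective (map_sym_injective this)).symm
  · rintro rfl
    exact Or.inr ⟨x, u.map Side.sym, hx, (mem_wordsAB_iff _).2 ⟨u, rfl⟩, by simp⟩

/-! ### Storing a word to be mirrored moves the pointer away -/

namespace Snapshot

variable {Q Γ : Type}

/-- The rule `F` with start state `q` and accepting states `A` accepts the language `L`. -/
def Recognizes {σ : Type} (F : StepRule Q σ Γ) (q : Q) (A : Set Q) (L : Language σ) : Prop :=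
  ∀ w, w ∈ L ↔ (run F (initial q) (w.map .sym ++ [.endmarker])).state ∈ A

/-- What can be seen of a snapshot whose pointer is near a given position. -/
abbrev NearView (Q Γ : Type) (D : ℕ) : Type :=
  Q × (Fin (D + 1) × NodeCode D) × (Fin (D + 1) × NodeCode D → Option (WithBot Γ))

/-- If words of length `m` are too many for the configurations near a position, then the pointer
has to leave the vicinity of this position in order to store the word. -/
theorem exists_not_near [Finite Q] [Finite Γ] {F : StepRule Q WSym Γ} {q : Q} {A : Set Q}
    (hA : Recognizes F q A (hatLp ⊔ hatLmi)) {D m : ℕ}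
    (hm : Nat.card (NearView Q Γ D) < 2 ^ m) {x : List WSym} (hx : x ∈ wordsABDollar) :
    ∃ (v : Fin m → Side) (l : Fin (m + 2)),
      ¬ Near D (run F (initial q) (x.map .sym)).pointer
        (run F (initial q) ((x ++ WSym.cent ::
          (((List.ofFn v).map Side.sym ++ [WSym.dollar]).take l)).map .sym)).pointer := by
  classical
  by_contra! hnear
  set c := run F (initial q) (x.map .sym) with hc
  have hnear' : ∀ (v : Fin m → Side) (y : List (TapeSymbol WSym)),
      y <+: (WSym.cent :: ((List.ofFn v).map Side.sym ++ [WSym.dollar])).map .sym →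
        Near D c.pointer (c.run F y).pointer := by
    intro v y hy
    rw [List.prefix_iff_eq_take, ← List.map_take] at hy
    rcases hl : y.length with _ | l
    · rw [List.length_eq_zero_iff.1 hl]
      exact ⟨0, [], by simp, by simp, rfl⟩
    · rw [hl, List.take_succ_cons] at hy
      have hle : l < m + 2 := by
        have := congrArg List.length hy
        simp [hl] at this
        omega
      have := hnear v ⟨l, hle⟩
      rwa [List.map_append, run_append, ← hc, ← hy] at this
  have hview : ∀ v : Fin m → Side, ∃ V : NearView Q Γ D,
      (c.run F ((WSym.cent :: ((List.ofFn v).map Side.sym ++ [WSym.dollar])).map .sym)).state =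
        V.1 ∧
      (c.run F ((WSym.cent :: ((List.ofFn v).map Side.sym ++ [WSym.dollar])).map .sym)).pointer =
        V.2.1.2.decode ++ c.pointer.drop V.2.1.1 ∧
      ∀ i : Fin (D + 1) × NodeCode D,
        (c.run F ((WSym.cent :: ((List.ofFn v).map Side.sym ++ [WSym.dollar])).map .sym)).tree
          (i.2.decode ++ c.pointer.drop i.1) = V.2.2 i := by
    intro v
    obtain ⟨j, R, hj, hR, e⟩ := hnear' v _ (List.prefix_refl _)
    obtain ⟨r, rfl⟩ := NodeCode.exists_decode_eq hR
    exact ⟨(_, (⟨j, by omega⟩, r), _), rfl, e, fun i => rfl⟩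
  choose V hV1 hV2 hV3 using hview
  have hcard : Nat.card (NearView Q Γ D) < Nat.card (Fin m → Side) := by
    rw [Nat.card_eq_fintype_card (α := Fin m → Side)]
    simpa [card_side] using hm
  have : ¬ Function.Injective V := fun h => absurd (Nat.card_le_card_of_injective V h)
    (not_le.2 hcard)
  simp only [Function.Injective, not_forall] at this
  obtain ⟨v₁, v₂, hV, hne⟩ := this
  -- Near the old position the equal views fix the snapshot, and everything else is unchanged since
  -- `c`. So both words lead to the same snapshot, and `¢ v₂ $ v₁ᴿ #₂` would be accepted like `¢ v₁
  -- $ v₁ᴿ #₂`.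
  have heq : c.run F ((WSym.cent :: ((List.ofFn v₁).map Side.sym ++ [WSym.dollar])).map .sym) =
      c.run F ((WSym.cent :: ((List.ofFn v₂).map Side.sym ++ [WSym.dollar])).map .sym) := by
    refine Snapshot.ext ?_ (funext fun X => ?_) ?_
    · rw [hV1, hV1, hV]
    · by_cases hX : Near D c.pointer X
      · obtain ⟨j, R, hj, hR, rfl⟩ := hX
        obtain ⟨r, rfl⟩ := NodeCode.exists_decode_eq hR
        have h1 := hV3 v₁ (⟨j, by omega⟩, r)
        have h2 := hV3 v₂ (⟨j, by omega⟩, r)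
        rw [hV] at h1
        exact h1.trans h2.symm
      · rw [run_tree_eq_of_near _ (hnear' v₁) hX, run_tree_eq_of_near _ (hnear' v₂) hX]
    · rw [hV2, hV2, hV]
  have hacc := fun v : Fin m → Side => hA (x ++ WSym.cent :: ((List.ofFn v).map Side.sym ++
    WSym.dollar :: ((List.ofFn v₁).reverse.map Side.sym ++ [WSym.border₂])))
  have hsplit : ∀ v : Fin m → Side, (run F (initial q) ((x ++ WSym.cent ::
      ((List.ofFn v).map Side.sym ++ WSym.dollar ::
        ((List.ofFn v₁).reverse.map Side.sym ++ [WSym.border₂]))).map .sym ++ [.endmarker])) =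
      run F (c.run F ((WSym.cent :: ((List.ofFn v).map Side.sym ++ [WSym.dollar])).map .sym))
        (((List.ofFn v₁).reverse.map Side.sym ++ [WSym.border₂]).map .sym ++ [.endmarker]) := by
    intro v
    rw [hc, ← run_append, ← run_append]
    congr 1
    simp
  have h1 := hacc v₁
  have h2 := hacc v₂
  rw [hsplit, mirror_mem_iff hx] at h1 h2
  rw [heq] at h1
  have := h2.2 (h1.1 rfl)
  exact hne (List.ofFn_injective this).symm

end Snapshot

/-! ## Few inputs have the same crossing information -/

namespace Snapshot

variable {Q σ Γ : Type}

theorem side_trajectory_congr {F : StepRule Q σ Γ} {q : Q} {w₁ w₂ : ℕ → TapeSymbol σ}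
    {u₁ u₂ : TreeNode} (h₁ : u₁ ≠ []) (h₂ : u₂ ≠ []) (n : ℕ)
    (hc : ∀ t < n, crossing u₁ (trajectory F (initial q) w₁ t)
        (trajectory F (initial q) w₁ (t + 1)) =
      crossing u₂ (trajectory F (initial q) w₂ t) (trajectory F (initial q) w₂ (t + 1))) :
    u₁ <:+ (trajectory F (initial q) w₁ n).pointer ↔
      u₂ <:+ (trajectory F (initial q) w₂ n).pointer := by
  induction n with
  | zero => simp [trajectory, initial, h₁, h₂]
  | succ n ih => exact side_congr (hc n (by omega)) (ih fun t ht => hc t (by omega))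

/-- Suppose that the inputs `w β` have the same crossing information at `u β` and look the same
around `u β`, and that the letters `β i` can be recovered from what is seen both below `u β` at time
`tb` and above `u β` at time `ta`. As each letter is read either below or above `u β`, there are few
such inputs. -/
theorem card_sq_le_of_separates {I : Type} [Fintype I] (B : Finset (I → Side))
    (F : StepRule Q σ Γ) (q : Q) (w : (I → Side) → ℕ → TapeSymbol σ) (u : (I → Side) → TreeNode)
    (τ : I → ℕ) {n tb ta s h k : ℕ} (hs : 0 < s) (hh : 0 < h) (hk : k ≤ h + s)
    (htb : tb ≤ n) (hta : ta ≤ n) (hu : ∀ β ∈ B, u β ≠ [])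
    (hw : ∀ β ∈ B, ∀ β' ∈ B, ∀ t < n, (∀ i, τ i = t → β i = β' i) → w β t = w β' t)
    (hc : ∀ β ∈ B, ∀ β' ∈ B, ∀ t < n,
      crossing (u β) (trajectory F (initial q) (w β) t)
        (trajectory F (initial q) (w β) (t + 1)) =
      crossing (u β') (trajectory F (initial q) (w β') t)
        (trajectory F (initial q) (w β') (t + 1)))
    (htake : ∀ β ∈ B, ∀ β' ∈ B, (u β).take h = (u β').take h)
    (hab : ∀ β ∈ B, ∀ β' ∈ B, AroundEq h (u β) (u β') (trajectory F (initial q) (w β) tb)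
      (trajectory F (initial q) (w β') tb))
    (haa : ∀ β ∈ B, ∀ β' ∈ B, AroundEq h (u β) (u β') (trajectory F (initial q) (w β) ta)
      (trajectory F (initial q) (w β') ta))
    (hsep : ∀ β ∈ B, Separates s (u β) (trajectory F (initial q) (w β) tb).pointer
      (trajectory F (initial q) (w β) ta).pointer)
    (hsb : ∀ β ∈ B, ∀ β' ∈ B, Similar k (trajectory F (initial q) (w β) tb)
      (trajectory F (initial q) (w β') tb) → β = β')
    (hsa : ∀ β ∈ B, ∀ β' ∈ B, Similar k (trajectory F (initial q) (w β) ta)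
      (trajectory F (initial q) (w β') ta) → β = β') :
    B.card ^ 2 ≤ 2 ^ Fintype.card I := by
  classical
  rcases B.eq_empty_or_nonempty with rfl | ⟨β₀, hβ₀⟩
  · simp
  -- `K` collects the letters read below the cut. One representative `β₀` suffices, since equal
  -- crossing information means equal times of changing sides.
  set K : Finset I := Finset.univ.filter fun i =>
    u β₀ <:+ (trajectory F (initial q) (w β₀) (τ i)).pointer with hK
  have hside : ∀ β ∈ B, ∀ i, τ i < n →
      (u β <:+ (trajectory F (initial q) (w β) (τ i)).pointer ↔ i ∈ K) := by
    intro β hβ i hi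
    rw [hK, Finset.mem_filter, side_trajectory_congr (hu β hβ) (hu β₀ hβ₀) (τ i)
      (fun t ht => hc β hβ β₀ hβ₀ t (by omega))]
    simp
  have h1 : B.card ≤ 2 ^ K.card := by
    have : B.card ≤ (Finset.univ : Finset (K → Side)).card := by
      refine Finset.card_le_card_of_injOn (fun β i => β i) (fun _ _ => Finset.mem_univ _) ?_
      intro β hβ β' hβ' e
      rw [Finset.mem_coe] at hβ hβ'
      refine hsb β hβ β' hβ' ?_
      obtain ⟨⟨ρ, hρ, hρs⟩, -⟩ := hsep β hβ
      have hin : InsideEq (u β) (u β') (trajectory F (initial q) (w β) tb)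
          (trajectory F (initial q) (w β') tb) := by
        refine insideEq_trajectory (hu β hβ) (hu β' hβ') ?_ tb
          (fun t ht => hc β hβ β' hβ' t (by omega)) (fun t ht hin => ?_)
        · have := congrArg List.head? (htake β hβ β' hβ')
          simpa [List.head?_take, hh.ne'] using this
        · refine hw β hβ β' hβ' t (by omega) ?_
          rintro i rfl
          exact congrFun e ⟨i, (hside β hβ i (by omega)).1 hin⟩
      exact hin.similar (htake β hβ β' hβ') (hab β hβ β' hβ') hρ hρs hk
    simpa [card_side] using this
  have h2 : B.card ≤ 2 ^ Kᶜ.card := by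
    have : B.card ≤ (Finset.univ : Finset (↑(Kᶜ) → Side)).card := by
      refine Finset.card_le_card_of_injOn (fun β i => β i) (fun _ _ => Finset.mem_univ _) ?_
      intro β hβ β' hβ' e
      rw [Finset.mem_coe] at hβ hβ'
      refine hsa β hβ β' hβ' ?_
      obtain ⟨⟨ρ, hρ, hρs⟩, hfar⟩ := hsep β hβ
      -- At time `tb` the pointer is below `u β`; hence the cut has been entered, and its position
      -- is the same for both inputs.
      obtain ⟨huu, hout⟩ := outsideEq_trajectory (hu β hβ) (hu β' hβ') n (hc β hβ β' hβ')
        (fun t ht hout => by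
          refine hw β hβ β' hβ' t ht ?_
          rintro i rfl
          exact congrFun e ⟨i, Finset.mem_compl.2 (mt (hside β hβ i ht).2 hout)⟩)
        ⟨tb, htb, by rw [hρ]; exact List.suffix_append _ _⟩
      have ha := haa β hβ β' hβ'
      rw [← huu] at ha
      exact (hout ta hta).similar ha hs hfar hk
    simpa [card_side, Finset.card_compl] using this
  calc B.card ^ 2 = B.card * B.card := sq _
    _ ≤ 2 ^ K.card * 2 ^ Kᶜ.card := Nat.mul_le_mul h1 h2
    _ = 2 ^ Fintype.card I := by rw [← pow_add, Finset.card_add_card_compl]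

end Snapshot

/-- By Cauchy–Schwarz, `|α|² = (∑ |fiber|)² ≤ |δ| * ∑ |fiber|² ≤ |δ| * |δ| * |α|`, and one factor
`|α|` cancels. -/
theorem card_le_sq_of_fiber {α δ : Type*} [Fintype α] [Fintype δ] [DecidableEq δ] (f : α → δ)
    (h : ∀ x, (Finset.univ.filter fun a => f a = x).card ^ 2 ≤ Fintype.card α) :
    Fintype.card α ≤ Fintype.card δ ^ 2 := by
  rcases Nat.eq_zero_or_pos (Fintype.card α) with h0 | h0
  · simp [h0]
  have h1 : Fintype.card α = ∑ x : δ, (Finset.univ.filter fun a => f a = x).card :=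
    Finset.card_eq_sum_card_fiberwise fun _ _ => Finset.mem_coe.2 (Finset.mem_univ _)
  have h2 : Fintype.card α ^ 2 ≤ Fintype.card δ * (Fintype.card δ * Fintype.card α) := by
    calc Fintype.card α ^ 2 = (∑ x : δ, (Finset.univ.filter fun a => f a = x).card) ^ 2 := by
          rw [← h1]
      _ ≤ Fintype.card δ * ∑ x : δ, (Finset.univ.filter fun a => f a = x).card ^ 2 :=
          sq_sum_le_card_mul_sum_sq
      _ ≤ Fintype.card δ * ∑ x : δ, Fintype.card α :=
          Nat.mul_le_mul_left _ (Finset.sum_le_sum fun x _ => h x)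
      _ = _ := by rw [Finset.sum_const, Finset.card_univ, smul_eq_mul]
  rw [sq, ← mul_assoc] at h2
  rw [sq]
  exact Nat.le_of_mul_le_mul_right h2 h0

/-! ## The inputs -/

section Inputs

variable {e d : ℕ} (E : Fin (2 ^ e) ≃ (Fin e → Side))

/-- The `i`-th word consists of the `i`-th word of length `e` and `d` letters which can be chosen
freely. -/
def inputWord (β : Fin (2 ^ e) × Fin d → Side) (i : ℕ) : List Side :=
  if h : i < 2 ^ e then List.ofFn (E ⟨i, h⟩) ++ List.ofFn fun j => β (⟨i, h⟩, j)
  -- Indices beyond the range are never used; the default only keeps the length constant for all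
  -- `i`.
  else List.replicate (e + d) Side.l

/-- The list of all words of the input. -/
def inputWords (β : Fin (2 ^ e) × Fin d → Side) : List (List Side) :=
  (List.range (2 ^ e)).map (inputWord E β)

theorem length_inputWord (β : Fin (2 ^ e) × Fin d → Side) (i : ℕ) :
    (inputWord E β i).length = e + d := by
  unfold inputWord
  split_ifs <;> simp

theorem length_of_mem_inputWords {β : Fin (2 ^ e) × Fin d → Side} {x : List Side}
    (hx : x ∈ inputWords E β) : x.length = e + d := by
  obtain ⟨i, -, rfl⟩ := List.mem_map.1 hx
  exact length_inputWord E β i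

theorem pairwise_inputWords (β : Fin (2 ^ e) × Fin d → Side) :
    (inputWords E β).Pairwise (fun x y => y <+: x → y = x) := by
  refine List.Pairwise.imp_of_mem (R := fun _ _ => True) ?_ (List.pairwise_of_forall fun _ _ =>
    trivial)
  intro x y hx hy _ h
  exact h.eq_of_length
    ((length_of_mem_inputWords E hy).trans (length_of_mem_inputWords E hx).symm)

/-- The first `e` letters of a word are its index, so even the set of words, without their order,
tells which free letters belong to which index. -/
theorem eq_of_mem_inputWords_iff {β β' : Fin (2 ^ e) × Fin d → Side}
    (h : ∀ y, y.length = e + d → (y ∈ inputWords E β ↔ y ∈ inputWords E β')) : β = β' := by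
  funext ⟨i, j⟩
  have h1 : inputWord E β i ∈ inputWords E β :=
    List.mem_map.2 ⟨i, List.mem_range.2 i.2, rfl⟩
  rw [h _ (length_inputWord E β i)] at h1
  obtain ⟨i', hi', e1⟩ := List.mem_map.1 h1
  rw [inputWord, inputWord, dif_pos (List.mem_range.1 hi'), dif_pos i.2] at e1
  obtain ⟨e2, e3⟩ := List.append_inj e1 (by simp)
  have e4 := E.injective (List.ofFn_injective e2)
  have e5 := congrFun (List.ofFn_injective e3) j
  rw [e4] at e5
  exact e5.symm

theorem getElem?_flatMap_range {α : Type*} (f : ℕ → List α) {b : ℕ}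
    (hf : ∀ i, (f i).length = b) (N t : ℕ) :
    ((List.range N).flatMap f)[t]? = if t < N * b then (f (t / b))[t % b]? else none := by
  have hlen : ∀ N : ℕ, ((List.range N).flatMap f).length = N * b := by
    intro N
    simp [List.length_flatMap, hf]
  induction N with
  | zero => simp
  | succ N ih =>
    rw [List.range_succ, List.flatMap_append, List.getElem?_append, hlen, ih]
    by_cases h1 : t < N * b
    · have : t < (N + 1) * b := h1.trans_le (Nat.mul_le_mul_right _ (by omega))
      simp [h1, this]
    · simp only [h1, if_false, List.flatMap_cons, List.flatMap_nil, List.append_nil]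
      by_cases h2 : t < (N + 1) * b
      · have h3 : t / b = N := Nat.div_eq_of_lt_le (by omega) h2
        have h4 : t % b = t - N * b := by
          rw [Nat.mod_eq_sub_mul_div, h3, mul_comm]
        rw [if_pos h2, h3, h4]
      · rw [if_neg h2, List.getElem?_eq_none]
        rw [hf]
        rw [add_mul, one_mul] at h2
        omega

theorem length_blocks_inputWords (β : Fin (2 ^ e) × Fin d → Side) :
    (blocks (inputWords E β)).length = 2 ^ e * (2 * (e + d)) := by
  simp [blocks, inputWords, List.length_flatMap, Function.comp_def, length_inputWord]
  ring

/-- The time at which a free letter is read. -/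
def letterTime (i : Fin (2 ^ e) × Fin d) : ℕ := i.1 * (2 * (e + d)) + e + i.2

theorem getElem?_blocks_inputWords {β β' : Fin (2 ^ e) × Fin d → Side} (t : ℕ)
    (h : ∀ i, letterTime i = t → β i = β' i) :
    (blocks (inputWords E β))[t]? = (blocks (inputWords E β'))[t]? := by
  rcases Nat.eq_zero_or_pos (e + d) with h0 | h0
  · have : ∀ β : Fin (2 ^ e) × Fin d → Side, blocks (inputWords E β) = [] := fun β => by
      rw [← List.length_eq_zero_iff, length_blocks_inputWords, h0]
      simp
    rw [this, this]
  have hflat : ∀ β : Fin (2 ^ e) × Fin d → Side, blocks (inputWords E β) =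
      (List.range (2 ^ e)).flatMap fun i => (inputWord E β i).map Side.sym ++
        List.replicate (inputWord E β i).length WSym.dollar := fun β => by
    rw [blocks, inputWords, List.flatMap_map]
  have hlen : ∀ (β : Fin (2 ^ e) × Fin d → Side) (i : ℕ), ((inputWord E β i).map Side.sym ++
        List.replicate (inputWord E β i).length WSym.dollar).length = 2 * (e + d) := by
    intro β i
    simp only [List.length_append, List.length_map, List.length_replicate, length_inputWord]
    ring
  rw [hflat, hflat, getElem?_flatMap_range _ (hlen β),
    getElem?_flatMap_range _ (hlen β')]
  split_ifs with ht
  · have hi : t / (2 * (e + d)) < 2 ^ e := Nat.div_lt_of_lt_mul (by rwa [mul_comm])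
    have hdiv := Nat.div_add_mod' t (2 * (e + d))
    set i := t / (2 * (e + d)) with hidef
    set r := t % (2 * (e + d)) with hrdef
    have hword : (inputWord E β i)[r]? = (inputWord E β' i)[r]? := by
      rw [inputWord, inputWord, dif_pos hi, dif_pos hi, List.getElem?_append,
        List.getElem?_append]
      simp only [List.length_ofFn]
      by_cases hr : r < e
      · rw [if_pos hr, if_pos hr]
      · rw [if_neg hr, if_neg hr, List.getElem?_ofFn, List.getElem?_ofFn]
        by_cases hr' : r - e < d
        · rw [dif_pos hr', dif_pos hr', h]
          simp only [letterTime]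
          omega
        · rw [dif_neg hr', dif_neg hr']
    rw [List.getElem?_append, List.getElem?_append]
    simp only [List.length_map, length_inputWord, List.getElem?_map, hword]
  · rfl

end Inputs

/-! ## Counting -/

/-- Give a function with support of size `j` the weight `r ^ j`, where `r = 1 / (|J| * b)`. The
total weight is `(1 + 1 / b) ^ n ≤ exp (n / b) ≤ 4 ^ c`, while each of the counted functions weighs
at least `r ^ M`. -/
theorem card_sparse_le {J : Type*} [Fintype J] [Nonempty J] {n M b c : ℕ} (hb : 0 < b)
    (hn : n ≤ c * b) :
    Nat.card {f : Fin n → Option J //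
      (Finset.univ.filter fun t => (f t).isSome = true).card ≤ M} ≤
      (Fintype.card J * b) ^ M * 4 ^ c := by
  classical
  set y := Fintype.card J with hy
  have hy0 : 0 < y := Fintype.card_pos
  set r : ℝ := ((y * b : ℕ) : ℝ)⁻¹ with hr
  have hyb : (1 : ℝ) ≤ ((y * b : ℕ) : ℝ) := by
    exact_mod_cast Nat.succ_le_of_lt (Nat.mul_pos hy0 hb)
  have hr0 : 0 < r := inv_pos.2 (by linarith)
  have hr1 : r ≤ 1 := inv_le_one_of_one_le₀ hyb
  set g : Option J → ℝ := fun o => if o.isSome = true then r else 1 with hg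
  have hsum : ∑ o, g o = 1 + 1 / b := by
    rw [Fintype.sum_option]
    simp only [hg, Option.isSome_none, Option.isSome_some, if_true, Finset.sum_const,
      Finset.card_univ, nsmul_eq_mul]
    have hb' : (b : ℝ) ≠ 0 := by positivity
    have hy' : (y : ℝ) ≠ 0 := by positivity
    rw [hr, ← hy]
    push_cast
    field_simp
  have hprod : ∀ f : Fin n → Option J, ∏ t, g (f t) =
      r ^ (Finset.univ.filter fun t => (f t).isSome = true).card := by
    intro f
    simp [hg, Finset.prod_ite]
  have htotal : ∑ f : Fin n → Option J,
      r ^ (Finset.univ.filter fun t => (f t).isSome = true).card ≤ 4 ^ c := by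
    simp only [← hprod]
    rw [← Fintype.sum_pow, hsum]
    have h1 : (1 + 1 / (b : ℝ)) ≤ Real.exp (1 / b) := by
      rw [add_comm]
      exact Real.add_one_le_exp _
    have h2 : Real.exp 1 ≤ 4 := by
      have := Real.exp_one_lt_d9
      linarith
    have hb' : (0 : ℝ) < b := by exact_mod_cast hb
    calc (1 + 1 / (b : ℝ)) ^ n ≤ Real.exp (1 / b) ^ n :=
          pow_le_pow_left₀ (by positivity) h1 n
      _ ≤ Real.exp (1 / b) ^ (c * b) :=
          pow_le_pow_right₀ (Real.one_le_exp (by positivity)) hn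
      _ = Real.exp 1 ^ c := by
          rw [mul_comm c b, pow_mul, ← Real.exp_nat_mul]
          congr 2
          field_simp
      _ ≤ 4 ^ c := pow_le_pow_left₀ (Real.exp_pos _).le h2 c
  rw [Nat.card_eq_fintype_card, Fintype.card_subtype]
  have hcard : ((Finset.univ.filter fun f : Fin n → Option J =>
      (Finset.univ.filter fun t => (f t).isSome = true).card ≤ M).card : ℝ) * r ^ M ≤ 4 ^ c := by
    refine le_trans ?_ htotal
    rw [← nsmul_eq_mul, ← Finset.sum_const]
    calc _ ≤ ∑ f ∈ Finset.univ.filter fun f : Fin n → Option J =>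
          (Finset.univ.filter fun t => (f t).isSome = true).card ≤ M,
          r ^ (Finset.univ.filter fun t => (f t).isSome = true).card :=
          Finset.sum_le_sum fun f hf =>
            pow_le_pow_of_le_one hr0.le hr1 (Finset.mem_filter.1 hf).2
      _ ≤ _ := Finset.sum_le_sum_of_subset_of_nonneg (Finset.filter_subset _ _)
          fun f _ _ => by positivity
  rw [hr, inv_pow, ← div_eq_mul_inv, div_le_iff₀ (by positivity)] at hcard
  have : ((Finset.univ.filter fun f : Fin n → Option J =>
      (Finset.univ.filter fun t => (f t).isSome = true).card ≤ M).card : ℝ) ≤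
      (((y * b) ^ M * 4 ^ c : ℕ) : ℝ) := by
    push_cast at hcard ⊢
    linarith
  exact_mod_cast this

/-! ### The counting inequality for cuts -/

namespace Snapshot

variable {Q Γ : Type}

theorem mem_iff_of_similar {σ : Type} {F : StepRule Q σ Γ} {q : Q} {A : Set Q} {L : Language σ}
    (hA : Recognizes F q A L) {k : ℕ} {w₁ w₂ r : List σ}
    (h : Similar k (run F (initial q) (w₁.map .sym)) (run F (initial q) (w₂.map .sym)))
    (hk : r.length + 1 ≤ k) : w₁ ++ r ∈ L ↔ w₂ ++ r ∈ L := by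
  have e : ∀ w : List σ, run F (initial q) ((w ++ r).map .sym ++ [.endmarker]) =
      run F (run F (initial q) (w.map .sym)) (r.map .sym ++ [.endmarker]) := fun w => by
    rw [List.map_append, List.append_assoc, run_append]
  rw [hA, hA, e, e, h.run_state_eq _ (by simpa using hk)]

/-- All queries `y` of length `e + d` are asked. Each is answered after the rest `r`, the symbol
`#₁`, the word `y` and the endmarker, which explains the radius. The splitting into `v` and `r`
allows `¢ z` to be read before or after the snapshots are compared. -/
theorem eq_of_similar {F : StepRule Q WSym Γ} {q : Q} {A : Set Q}
    (hA : Recognizes F q A (hatLp ⊔ hatLmi)) {e d k : ℕ} (he : 0 < e + d)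
    (E : Fin (2 ^ e) ≃ (Fin e → Side)) {β β' : Fin (2 ^ e) × Fin d → Side} {v z r : List WSym}
    (hvr : ∀ y : List Side, v ++ (r ++ WSym.border₁ :: y.map Side.sym) =
      WSym.cent :: (z ++ WSym.border₁ :: y.map Side.sym)) (hz : z ∈ wordsABDollar)
    (h : Similar k (run F (initial q) ((blocks (inputWords E β) ++ v).map .sym))
      (run F (initial q) ((blocks (inputWords E β') ++ v).map .sym)))
    (hk : r.length + e + d + 2 ≤ k) : β = β' := by
  refine eq_of_mem_inputWords_iff E fun y hy => ?_
  have hy0 : y ≠ [] := by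
    rintro rfl
    simp at hy
    omega
  have hne : ∀ (β : Fin (2 ^ e) × Fin d → Side), ∀ x ∈ inputWords E β, x ≠ [] := by
    rintro β x hx rfl
    have := length_of_mem_inputWords E hx
    simp at this
    omega
  have := mem_iff_of_similar hA (r := r ++ WSym.border₁ :: y.map Side.sym) h (by
    simp [hy]
    omega)
  rwa [List.append_assoc, List.append_assoc, hvr,
    query_mem_iff (hne β) (pairwise_inputWords E β) hz hy0,
    query_mem_iff (hne β') (pairwise_inputWords E β') hz hy0] at this

/-- The information about a cut which is used to recover the input. -/
abbrev CutData (Q Γ : Type) (n M m h : ℕ) : Type :=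
  {f : Fin n → Option (Q × Option (WithBot Γ)) //
    (Finset.univ.filter fun t => (f t).isSome = true).card ≤ M} × Bool × (Fin m → Side) ×
    Fin (m + 2) × NodeCode h × (Fin (h + 1) × NodeCode h → Option (WithBot Γ)) ×
    (Fin (h + 1) × NodeCode h → Option (WithBot Γ))

theorem aroundEq_of_eq {h : ℕ} {u₁ u₂ : TreeNode} {c₁ c₂ : Snapshot Q Γ}
    (H : (fun i : Fin (h + 1) × NodeCode h => c₁.tree (i.2.decode ++ u₁.drop i.1)) =
      fun i => c₂.tree (i.2.decode ++ u₂.drop i.1)) : AroundEq h u₁ u₂ c₁ c₂ := by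
  intro j R hj hR
  obtain ⟨r, rfl⟩ := NodeCode.exists_decode_eq hR
  exact congrFun H (⟨j, by omega⟩, r)

/-- For each choice of the free letters a cut is fixed between the position after the blocks and the
one to which the pointer is driven by `¢ z`. Each fiber of the resulting data satisfies the
hypotheses of `card_sq_le_of_separates`. -/
theorem two_pow_le_card_cutData [Finite Q] [Finite Γ] {F : StepRule Q WSym Γ} {q : Q}
    {A : Set Q} (hA : Recognizes F q A (hatLp ⊔ hatLmi)) {e d m s h M n : ℕ} (hs : 0 < s)
    (hh : 0 < h) (he : 0 < e + d) (hk : e + d + 3 ≤ h + s)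
    (hm : Nat.card (NearView Q Γ (3 * s)) < 2 ^ m)
    (hn : n = 2 ^ e * (2 * (e + d)) + m + 2) (hM : n ≤ s * M) :
    2 ^ (2 ^ e * d) ≤ Nat.card (CutData Q Γ n M m h) ^ 2 := by
  classical
  have := Fintype.ofFinite Q
  have := Fintype.ofFinite Γ
  have : Fintype (WithBot Γ) := inferInstanceAs (Fintype (Option Γ))
  have E : Fin (2 ^ e) ≃ (Fin e → Side) :=
    (Fintype.equivFinOfCardEq (by simp [card_side])).symm
  set N := 2 ^ e * (2 * (e + d)) with hN
  have hlen := fun β : Fin (2 ^ e) × Fin d → Side => length_blocks_inputWords E β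
  choose v l hnear using fun β : Fin (2 ^ e) × Fin d → Side =>
    exists_not_near hA hm (blocks_mem_wordsABDollar (inputWords E β))
  set z : (Fin m → Side) → Fin (m + 2) → List WSym := fun v l =>
    ((List.ofFn v).map Side.sym ++ [WSym.dollar]).take l with hz
  have hzlen : ∀ v l, (z v l).length = l := by
    intro v l
    simp [hz]
    omega
  have hzmem : ∀ v l, z v l ∈ wordsABDollar := by
    intro v l t ht
    rcases List.mem_append.1 (List.mem_of_mem_take ht) with ht | ht
    · exact map_sym_mem_wordsABDollar _ t ht
    · exact Or.inr (Or.inr (by simpa using ht))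
  set W : (Fin (2 ^ e) × Fin d → Side) → List (TapeSymbol WSym) := fun β =>
    (blocks (inputWords E β) ++ WSym.cent :: z (v β) (l β)).map .sym with hW
  have hWlen : ∀ β, (W β).length = N + 1 + l β := by
    intro β
    simp [hW, hlen, hzlen]
    omega
  -- The words end at times depending on `l β`. Padding with endmarkers extends all runs to the
  -- common bound `n`; the padding comes after both of the times that matter.
  set w : (Fin (2 ^ e) × Fin d → Side) → ℕ → TapeSymbol WSym := fun β t =>
    (W β).getD t .endmarker with hw
  set c : (Fin (2 ^ e) × Fin d → Side) → ℕ → Snapshot Q Γ := fun β =>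
    trajectory F (initial q) (w β) with hc
  have hc1 : ∀ β, c β N =
      run F (initial q) ((blocks (inputWords E β) ++ []).map .sym) := by
    intro β
    change trajectory F (initial q) (fun t => (W β).getD t .endmarker) N = _
    rw [← run_take_eq_trajectory F _ _ (by rw [hWlen]; omega), hW]
    simp only [List.append_nil]
    rw [← List.map_take, List.take_left' (hlen β)]
  have hc2 : ∀ β, c β (N + 1 + l β) = run F (initial q)
      ((blocks (inputWords E β) ++ WSym.cent :: z (v β) (l β)).map .sym) := by
    intro β
    change trajectory F (initial q) (fun t => (W β).getD t .endmarker) _ = _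
    rw [← run_take_eq_trajectory F _ _ (hWlen β).ge, ← hWlen β, List.take_length]
  have hcut := fun β => exists_cut F (initial q) (w β) n s hs
    (P := (c β N).pointer) (P' := (c β (N + 1 + l β)).pointer)
    (by rw [hc1, hc2, List.append_nil]; exact hnear β)
  choose u hu hfew hsep using hcut
  set x : (Fin (2 ^ e) × Fin d → Side) → Fin n → Option (Q × Option (WithBot Γ)) :=
    fun β t => crossing (u β) (c β t) (c β (t + 1)) with hx
  have hxM : ∀ β, (Finset.univ.filter fun t => (x β t).isSome = true).card ≤ M := by
    intro β
    have h1 : s * (crossingTimes (c β) (u β) n).card ≤ s * M := (hfew β).trans hM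
    refine le_trans ?_ (Nat.le_of_mul_le_mul_left h1 hs)
    refine Finset.card_le_card_of_injOn (fun t => (t : ℕ)) ?_ (Fin.val_injective.injOn)
    intro t ht
    have := (Finset.mem_filter.1 (Finset.mem_coe.1 ht)).2
    refine Finset.mem_coe.2 (Finset.mem_filter.2 ⟨Finset.mem_range.2 t.2, ?_⟩)
    exact Option.isSome_iff_ne_none.1 this
  have hcode : ∀ β, ∃ r : NodeCode h, r.decode = (u β).take h := fun β =>
    NodeCode.exists_decode_eq (List.length_take_le _ _)
  choose r hr using hcode
  set data : (Fin (2 ^ e) × Fin d → Side) → CutData Q Γ n M m h := fun β =>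
    (⟨x β, hxM β⟩, decide (Separates s (u β) (c β N).pointer (c β (N + 1 + l β)).pointer), v β,
      l β, r β, fun i => (c β N).tree (i.2.decode ++ (u β).drop i.1),
      fun i => (c β (N + 1 + l β)).tree (i.2.decode ++ (u β).drop i.1)) with hdata
  have hcard : Fintype.card (Fin (2 ^ e) × Fin d → Side) = 2 ^ (2 ^ e * d) := by
    simp [card_side]
  rw [← hcard, Nat.card_eq_fintype_card]
  refine card_le_sq_of_fiber data fun δ => ?_
  set B := Finset.univ.filter fun β => data β = δ with hB
  have hdd : ∀ β ∈ B, data β = δ := fun β hβ => (Finset.mem_filter.1 hβ).2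
  obtain ⟨⟨δx, δM⟩, δo, δv, δl, δr, δa, δb⟩ := δ
  simp only [hdata, Prod.mk.injEq, Subtype.mk.injEq] at hdd
  have hI : 2 ^ (2 ^ e * d) = 2 ^ Fintype.card (Fin (2 ^ e) × Fin d) := by simp
  rw [hcard, hI]
  have hW' : ∀ β ∈ B, ∀ β' ∈ B, ∀ t < n, (∀ i, letterTime i = t → β i = β' i) →
      w β t = w β' t := by
    intro β hβ β' hβ' t _ hi
    obtain ⟨-, -, e1, e2, -⟩ := hdd β hβ
    obtain ⟨-, -, e1', e2', -⟩ := hdd β' hβ'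
    simp only [hw, hW, e1, e2, e1', e2', List.getD_eq_getElem?_getD, List.map_append,
      List.getElem?_append, List.length_map, hlen, List.getElem?_map]
    rw [getElem?_blocks_inputWords E t hi]
  have hcr : ∀ β ∈ B, ∀ β' ∈ B, ∀ t < n, crossing (u β) (c β t) (c β (t + 1)) =
      crossing (u β') (c β' t) (c β' (t + 1)) := by
    intro β hβ β' hβ' t ht
    exact congrFun ((hdd β hβ).1.trans (hdd β' hβ').1.symm) ⟨t, ht⟩
  have htk : ∀ β ∈ B, ∀ β' ∈ B, (u β).take h = (u β').take h := by
    intro β hβ β' hβ'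
    rw [← hr, ← hr, (hdd β hβ).2.2.2.2.1, (hdd β' hβ').2.2.2.2.1]
  have ha1 : ∀ β ∈ B, ∀ β' ∈ B, AroundEq h (u β) (u β') (c β N) (c β' N) := by
    intro β hβ β' hβ'
    exact aroundEq_of_eq ((hdd β hβ).2.2.2.2.2.1.trans (hdd β' hβ').2.2.2.2.2.1.symm)
  have ha2 : ∀ β ∈ B, ∀ β' ∈ B,
      AroundEq h (u β) (u β') (c β (N + 1 + δl)) (c β' (N + 1 + δl)) := by
    intro β hβ β' hβ'
    have h1 := (hdd β hβ).2.2.2.2.2.2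
    have h2 := (hdd β' hβ').2.2.2.2.2.2
    rw [(hdd β hβ).2.2.2.1] at h1
    rw [(hdd β' hβ').2.2.2.1] at h2
    exact aroundEq_of_eq (h1.trans h2.symm)
  have hs1 : ∀ β ∈ B, ∀ β' ∈ B, Similar (e + d + 3) (c β N) (c β' N) → β = β' := by
    intro β hβ β' hβ' hsim
    rw [hc1, hc1] at hsim
    exact eq_of_similar hA he E (r := [WSym.cent]) (z := []) (fun y => rfl)
      nil_mem_wordsABDollar hsim (by simp; omega)
  have hs2 : ∀ β ∈ B, ∀ β' ∈ B,
      Similar (e + d + 3) (c β (N + 1 + δl)) (c β' (N + 1 + δl)) → β = β' := by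
    intro β hβ β' hβ' hsim
    have e1 := hc2 β
    have e2 := hc2 β'
    rw [(hdd β hβ).2.2.1, (hdd β hβ).2.2.2.1] at e1
    rw [(hdd β' hβ').2.2.1, (hdd β' hβ').2.2.2.1] at e2
    rw [e1, e2] at hsim
    exact eq_of_similar hA he E (r := []) (fun y => by simp) (hzmem δv δl) hsim
      (by simp)
  have hsep1 : ∀ β ∈ B, (Separates s (u β) (c β N).pointer (c β (N + 1 + δl)).pointer ↔
      δo = true) := by
    intro β hβ
    have := (hdd β hβ).2.1
    rw [(hdd β hβ).2.2.2.1] at this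
    rw [← this, decide_eq_true_iff]
  have hsep2 : ∀ β ∈ B, Separates s (u β) (c β N).pointer (c β (N + 1 + δl)).pointer ∨
      Separates s (u β) (c β (N + 1 + δl)).pointer (c β N).pointer := by
    intro β hβ
    have := hsep β
    rwa [(hdd β hβ).2.2.2.1] at this
  have hδl : N + 1 + (δl : ℕ) ≤ n := by omega
  -- The data record which of the two positions is below the cut, so the roles of the two times are
  -- the same throughout the fiber.
  by_cases ho : δo = true
  · exact card_sq_le_of_separates B F q w u letterTime hs hh hk (by omega) hδl
      (fun β _ => hu β) hW' hcr htk ha1 ha2 (fun β hβ => (hsep1 β hβ).2 ho) hs1 hs2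
  · exact card_sq_le_of_separates B F q w u letterTime hs hh hk hδl (by omega)
      (fun β _ => hu β) hW' hcr htk ha2 ha1
      (fun β hβ => (hsep2 β hβ).resolve_left (mt (hsep1 β hβ).1 ho)) hs2 hs1

end Snapshot

/-! ## Estimates -/

theorem pow_four_le_two_pow {d : ℕ} (hd : 16 ≤ d) : d ^ 4 ≤ 2 ^ d := by
  induction d, hd using Nat.le_induction with
  | base => norm_num
  | succ k hk ih =>
    have h1 : (k + 1) ^ 4 ≤ 2 * k ^ 4 := by
      have h2 : 4 * k ^ 3 + 6 * k ^ 2 + 4 * k + 1 ≤ 16 * k ^ 3 := by nlinarith [sq_nonneg k]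
      have h3 : 16 * k ^ 3 ≤ k * k ^ 3 := Nat.mul_le_mul_right _ hk
      nlinarith
    calc (k + 1) ^ 4 ≤ 2 * k ^ 4 := h1
      _ ≤ 2 * 2 ^ k := by omega
      _ = 2 ^ (k + 1) := by ring

theorem mul_succ_le_two_pow (γ : ℕ) : 16384 * (γ + 1) ≤ 2 ^ (γ + 14) := by
  rw [pow_add, mul_comm]
  exact Nat.mul_le_mul Nat.lt_two_pow_self (by norm_num)

namespace Snapshot

variable {Q Γ : Type}

theorem card_nearView_lt [Finite Q] [Finite Γ] {γ D K : ℕ} (hQ : Nat.card Q ≤ 2 ^ γ)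
    (hΓ : Nat.card (Option (WithBot Γ)) ≤ 2 ^ γ) (hK : K = (D + 1) * ((D + 1) * 2 ^ D)) :
    Nat.card (NearView Q Γ D) < 2 ^ (γ + K + γ * K) := by
  classical
  have hI : Nat.card (Fin (D + 1) × NodeCode D) = K := by
    rw [Nat.card_prod, Nat.card_eq_fintype_card (α := NodeCode D), NodeCode.card, hK,
      Nat.card_eq_fintype_card, Fintype.card_fin]
  rw [Nat.card_prod, Nat.card_prod, Nat.card_fun, hI, pow_add, pow_add, pow_mul, mul_assoc]
  have hK' : K < 2 ^ K := Nat.lt_two_pow_self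
  refine lt_of_le_of_lt (Nat.mul_le_mul hQ (Nat.mul_le_mul_left K (Nat.pow_le_pow_left hΓ K))) ?_
  gcongr

theorem card_cutData_le [Finite Q] [Nonempty Q] [Finite Γ] {γ n M m h b c ℓ H : ℕ}
    (hΓ : Nat.card (Option (WithBot Γ)) ≤ 2 ^ γ)
    (hb : 0 < b) (hn : n ≤ c * b)
    (hℓ : Nat.card Q * Nat.card (Option (WithBot Γ)) * b ≤ 2 ^ ℓ)
    (hH : H = (h + 1) * ((h + 1) * 2 ^ h)) :
    Nat.card (CutData Q Γ n M m h) ≤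
      2 ^ (ℓ * M + 2 * c + 2 * m + 3 + H + 2 * (γ * H)) := by
  classical
  have := Fintype.ofFinite Q
  have := Fintype.ofFinite Γ
  have : Fintype (WithBot Γ) := inferInstanceAs (Fintype (Option Γ))
  have hI : Nat.card (Fin (h + 1) × NodeCode h) = H := by
    rw [Nat.card_prod, Nat.card_eq_fintype_card (α := NodeCode h), NodeCode.card, hH,
      Nat.card_eq_fintype_card, Fintype.card_fin]
  have h1 := card_sparse_le (J := Q × Option (WithBot Γ)) (M := M) hb hn
  rw [← Nat.card_eq_fintype_card, Nat.card_prod] at h1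
  have h2 : Nat.card (Fin m → Side) = 2 ^ m := by
    rw [Nat.card_eq_fintype_card]
    simp [card_side]
  have h3 : Nat.card (Fin (m + 2)) ≤ 2 ^ (m + 2) := by
    rw [Nat.card_eq_fintype_card, Fintype.card_fin]
    exact Nat.lt_two_pow_self.le
  have h4 : Nat.card (NodeCode h) ≤ 2 ^ H := by
    rw [Nat.card_eq_fintype_card, NodeCode.card, hH]
    refine le_trans ?_ Nat.lt_two_pow_self.le
    exact Nat.le_mul_of_pos_left _ (Nat.succ_pos h)
  have h5 : Nat.card (Fin (h + 1) × NodeCode h → Option (WithBot Γ)) ≤ 2 ^ (γ * H) := by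
    rw [Nat.card_fun, hI, pow_mul]
    exact Nat.pow_le_pow_left hΓ H
  have h6 : (Nat.card Q * Nat.card (Option (WithBot Γ)) * b) ^ M * 4 ^ c ≤
      2 ^ (ℓ * M) * 2 ^ (2 * c) := by
    rw [pow_mul, pow_mul]
    exact Nat.mul_le_mul_right _ (Nat.pow_le_pow_left hℓ M)
  rw [Nat.card_prod, Nat.card_prod, Nat.card_prod, Nat.card_prod, Nat.card_prod]
  calc _ ≤ (2 ^ (ℓ * M) * 2 ^ (2 * c)) * (2 * (2 ^ m * (2 ^ (m + 2) * (2 ^ H *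
        (2 ^ (γ * H) * 2 ^ (γ * H)))))) := by
        refine Nat.mul_le_mul (h1.trans h6) (Nat.mul_le_mul (by simp) (Nat.mul_le_mul h2.le
          (Nat.mul_le_mul h3 (Nat.mul_le_mul h4 ((Nat.card_prod _ _).trans_le (Nat.mul_le_mul h5 h5))))))
    _ = _ := by ring

/-- With `N = 2 ^ (9 * d)` words there are `d * N` free letters. The data about a cut take only
`O((γ + 1) * N)` bits, where `γ` bounds the sizes of the automaton, and `d` is exponential in `γ`.
-/
theorem not_recognizes_sup [Finite Q] [Finite Γ] (F : StepRule Q WSym Γ) (q : Q) (A : Set Q) :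
    ¬ Recognizes F q A (hatLp ⊔ hatLmi) := by
  intro hA
  have : Nonempty Q := ⟨q⟩
  set γ := Nat.card Q + Nat.card (Option (WithBot Γ)) with hγ
  have hQ : Nat.card Q ≤ 2 ^ γ := le_trans (by omega) Nat.lt_two_pow_self.le
  have hΓ : Nat.card (Option (WithBot Γ)) ≤ 2 ^ γ := le_trans (by omega) Nat.lt_two_pow_self.le
  clear_value γ
  -- This size makes `d` exceed `120 * γ + 800`, while coding the time gaps between crossings costs
  -- only about `log d`, that is `γ + O(1)`, bits per crossing.
  obtain ⟨d, hd⟩ : ∃ d, d = 2 ^ (γ + 14) := ⟨_, rfl⟩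
  have hγd : 16384 * (γ + 1) ≤ d := hd ▸ mul_succ_le_two_pow γ
  have hd4 : d ^ 4 ≤ 2 ^ d := pow_four_le_two_pow (by omega)
  obtain ⟨X, hX⟩ : ∃ X, X = 2 ^ d := ⟨_, rfl⟩
  rw [← hX] at hd4
  have hX1 : 1 ≤ X := hX ▸ Nat.one_le_two_pow
  obtain ⟨K, hK⟩ : ∃ K, K = (3 * (2 * d) + 1) * ((3 * (2 * d) + 1) * 2 ^ (3 * (2 * d))) :=
    ⟨_, rfl⟩
  obtain ⟨H, hH⟩ : ∃ H, H = (8 * d + 3 + 1) * ((8 * d + 3 + 1) * 2 ^ (8 * d + 3)) := ⟨_, rfl⟩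
  obtain ⟨N, hN⟩ : ∃ N, N = 2 ^ (9 * d) := ⟨_, rfl⟩
  have hNX : N = X ^ 9 := by rw [hN, hX, ← pow_mul, mul_comm]
  have hKX : (γ + 1) * K ≤ X ^ 7 := by
    have e : 2 ^ (3 * (2 * d)) = X ^ 6 := by rw [hX, ← pow_mul]; congr 1; ring
    have e1 : (3 * (2 * d) + 1) * (3 * (2 * d) + 1) ≤ d ^ 3 := by nlinarith
    calc (γ + 1) * K = (γ + 1) * ((3 * (2 * d) + 1) * (3 * (2 * d) + 1)) * X ^ 6 := by
          rw [hK, e]; ring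
      _ ≤ d * d ^ 3 * X ^ 6 := by
          gcongr
          omega
      _ = d ^ 4 * X ^ 6 := by ring
      _ ≤ X * X ^ 6 := by gcongr
      _ = X ^ 7 := by ring
  have hHX : (γ + 1) * H ≤ N := by
    have e : 2 ^ (8 * d + 3) = 8 * X ^ 8 := by rw [hX, ← pow_mul, pow_add]; ring
    have e1 : (8 * d + 3 + 1) * (8 * d + 3 + 1) * 8 ≤ d ^ 3 := by nlinarith
    calc (γ + 1) * H = (γ + 1) * ((8 * d + 3 + 1) * (8 * d + 3 + 1) * 8) * X ^ 8 := by
          rw [hH, e]; ring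
      _ ≤ d * d ^ 3 * X ^ 8 := by
          gcongr
          omega
      _ = d ^ 4 * X ^ 8 := by ring
      _ ≤ X * X ^ 8 := by gcongr
      _ = N := by rw [hNX]; ring
  have hX7 : X ^ 7 ≤ N := hNX ▸ Nat.pow_le_pow_right hX1 (by norm_num)
  have hdN : d ≤ N := by
    rw [hN]
    exact Nat.lt_two_pow_self.le.trans (Nat.pow_le_pow_right (by norm_num) (by omega))
  obtain ⟨m, hm⟩ : ∃ m, m = γ + K + γ * K := ⟨_, rfl⟩
  have hmN : m ≤ 2 * N := by nlinarith
  have hn : N * (2 * (9 * d + d)) + m + 2 ≤ 40 * (d * N) := by nlinarith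
  -- The radius needed is `e + d + 3 = 10 * d + 3 = h + s`. With `s = 2 * d` the vicinities of
  -- radius `h = 8 * d + 3` around the cut and of radius `3 * s = 6 * d` around the pointer have
  -- exponential parts about `2 ^ (8 * d)` and `2 ^ (6 * d)`, both well below `N`. At most `20 * N`
  -- crossings occur because `n ≤ 40 * d * N = s * (20 * N)`.
  have hmain := two_pow_le_card_cutData hA (e := 9 * d) (d := d) (s := 2 * d) (h := 8 * d + 3)
    (m := m) (M := 20 * N) (n := N * (2 * (9 * d + d)) + m + 2) (by omega) (by omega) (by omega)
    (by omega) (hm ▸ card_nearView_lt hQ hΓ hK) (by rw [hN]) (by linarith)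
  have hℓ : Nat.card Q * Nat.card (Option (WithBot Γ)) * (20 * d) ≤ 2 ^ (3 * γ + 19) := by
    calc _ ≤ 2 ^ γ * 2 ^ γ * (32 * d) := by gcongr; norm_num
      _ = 2 ^ (3 * γ + 19) := by rw [hd]; ring
  have hcard := card_cutData_le (Q := Q) (n := N * (2 * (9 * d + d)) + m + 2) (M := 20 * N)
    (m := m) (c := 2 * N) hΓ (by omega) (by linarith) hℓ hH
  have hexp := hmain.trans (Nat.pow_le_pow_left hcard 2)
  rw [← pow_mul, Nat.pow_le_pow_iff_right (by norm_num), ← hN] at hexp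
  -- The crossings account for `20 * (3 * γ + 19) * N` bits and all other data for at most `10 * N +
  -- 3`; the square doubles the sum.
  have hb : (120 * γ + 800) * N < d * N := by
    refine Nat.mul_lt_mul_of_pos_right (by omega) (by omega)
  nlinarith

end Snapshot

/-! ### The non-closure results -/

theorem hatLp_sup_hatLmi_notMem : hatLp ⊔ hatLmi ∉ rtTWSDA WSym := by
  rintro ⟨Q, Γ, _, _, M, hM, hL⟩
  refine Snapshot.not_recognizes_sup M.stepRule (some M.start)
    {o | ∃ p ∈ M.accepting, o = some p} fun w => ?_
  rw [← hL, TWSDA.mem_language_iff hM]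
  rfl

theorem mainTheorem9 :
    (hatLp ∈ rtTWSDNEA WSym ∧ hatLmi ∈ rtTWSDNEA WSym ∧ hatLp ⊔ hatLmi ∉ rtTWSDA WSym) ∧
    (¬ ClosedUnderUnion rtTWSDA ∧ ¬ ClosedUnderIntersection rtTWSDA) ∧
    (¬ ClosedUnderUnion rtTWSDNEA ∧ ¬ ClosedUnderIntersection rtTWSDNEA) := by
  have hU : ¬ ClosedUnderUnion rtTWSDA := fun h =>
    hatLp_sup_hatLmi_notMem (h WSym _ _ (rtTWSDNEA_subset_rtTWSDA _ hatLp_mem_rtTWSDNEA)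
      (rtTWSDNEA_subset_rtTWSDA _ hatLmi_mem_rtTWSDNEA))
  have hU' : ¬ ClosedUnderUnion rtTWSDNEA := fun h =>
    hatLp_sup_hatLmi_notMem (rtTWSDNEA_subset_rtTWSDA _
      (h WSym _ _ hatLp_mem_rtTWSDNEA hatLmi_mem_rtTWSDNEA))
  exact ⟨⟨hatLp_mem_rtTWSDNEA, hatLmi_mem_rtTWSDNEA, hatLp_sup_hatLmi_notMem⟩,
    ⟨hU, fun h => hU (h.closedUnderUnion fun _ _ _ => compl_mem_rtTWSDA)⟩,
    ⟨hU', fun h => hU' (h.closedUnderUnion fun _ _ _ => compl_mem_rtTWSDNEA)⟩⟩
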